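/- **The system $\mathsf P_0$.** Finite types are generated from the type $0$ of natural numbers by $\sigma\to\tau$ and $\sigma^*$ (finite sequences of objects of type $\sigma$); write $1=0\to 0$. The language has $0$, successor, the combinators $\Pi,\Sigma$, the recursor $R_0$ of type $0$, constants for forming finite sequences $\langle f(0),\dots,f(n-1)\rangle$, for their length and for their entries, the predicate $=_0$, and a predicate $\mathrm{st}_\sigma$ ("standard") for each type; $=_\sigma$ is defined extensionally from $=_0$. A formula is internal if it does not contain $\mathrm{st}$; $(\forall^{\rm st}x)$ and $(\exists^{\rm st}x)$ are quantifiers restricted to standard $x$. With classical many-sorted logic, $\mathsf P_0$ consists of * $\textsf{E-PRA}^{\omega*}$: the axioms for $=_0$ and successor, the defining equations of all constants, full extensionality, and quantifier-free induction; * $\mathsf{QF\text{-}AC}^{1,0}$: $(\forall x^1)(\exists y^0)\varphi(x,y)\to(\exists F^{1\to 0})(\forall x^1)\varphi(x,F(x))$ for quantifier-free internal $\varphi$; * $\mathcal T^*_{\rm st}$: $\mathrm{st}(x)\wedge x=y\to \mathrm{st}(y)$; $\mathrm{st}(t)$ for every closed term $t$; $\mathrm{st}(f)\wedge\mathrm{st}(x)\to\mathrm{st}(f(x))$;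 * $\mathsf{HAC_{int}}$: $(\forall^{\rm st}x^\rho)(\exists^{\rm st}y^\tau)\varphi(x,y)\to(\exists^{\rm st}F^{\rho\to\tau^*})(\forall^{\rm st}x^\rho)(\exists y^\tau\in F(x))\varphi(x,y)$ for internal $\varphi$; * $\mathsf I$: $(\forall^{\rm st}x^{\sigma^*})(\exists y^\tau)(\forall z^\sigma\in x)\varphi(z,y)\to(\exists y^\tau)(\forall^{\rm st}x^\sigma)\varphi(x,y)$ for internal $\varphi$. Formulas in the schemata may have further parameters. Let $\mathsf D$ be the sentence "every natural number below a standard one is standard", i.e. $(\forall n^0,m^0)(\mathrm{st}(n)\wedge m\le n\to\mathrm{st}(m))$. **Reals.** Natural numbers code rationals. A real is a sequence $x$ of rationals with $|x(n)-x(n+i)|<2^{-n}$ for all $n,i$. For reals $x,y$: $x\le y$ means $x(n)-y(n)\le 2\cdot 2^{-n}$ for all $n$; $x<y$ means $\neg(y\le x)$; $x\approx y$ means $|x(n)-y(n)|\le 2\cdot 2^{-n}$ for all standard $n$; $x\ll y$ means $x<y\wedge x\not\approx y$. For $\alpha,\beta$ of type $1$, $\alpha\le_1 1$ means $\alpha(n)\le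 1$ for all $n$, and $\alpha\approx_1\beta$ means $\alpha(n)=\beta(n)$ for all standard $n$. **Principles.** * $\mathsf{STP}$: $(\forall\alpha\le_1 1)(\exists^{\rm st}\beta\le_1 1)(\alpha\approx_1\beta)$. * $\mathsf{NSC}$: $(\forall x\in[0,1])(\exists^{\rm st}y\in[0,1])(x\approx y)$. * $\mathsf{HBL_{ns}}$: for every (not necessarily standard) sequence of open intervals $(c_n,d_n)$ with real end points, $$(\forall^{\rm st}x\in[0,1])(\exists^{\rm st}n)(c_n\ll x\ll d_n)\ \to\ (\exists^{\rm st}k)(\forall^{\rm st}y\in[0,1])(\exists i\le k)(c_i\ll y\ll d_i).$$ * $\mathsf{HBL'_{ns}}$: the same with $(\forall y\in[0,1])$ in place of $(\forall^{\rm st}y\in[0,1])$. **Theorem.** $\mathsf P_0$ proves $\mathsf{STP}\leftrightarrow\mathsf{NSC}$, $\mathsf{NSC}\leftrightarrow\mathsf{HBL'_{ns}}$ and $\mathsf{NSC}\to\mathsf{HBL_{ns}}$, and $\mathsf P_0+\mathsf D$ proves $\mathsf{HBL_{ns}}\to\mathsf{NSC}$. In particular all four principles are equivalent over $\mathsf P_0+\mathsf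 D$. -/

import Mathlib

/-! ### Language: finite types with finite sequences, combinators, and a standardness predicate -/

namespace NSA

/-- Finite types over `0`, with a type `seq σ` of finite sequences for each type `σ`. -/
inductive Ty : Type
  | nat : Ty
  | arr : Ty → Ty → Ty
  | seq : Ty → Ty

infixr:60 " ⇒ₜ " => Ty.arr

/-- The type `1 = 0 → 0`. -/
abbrev Ty.one : Ty := Ty.nat ⇒ₜ Ty.nat

/-- Typed de Bruijn variables of a context. -/
inductive Var : List Ty → Ty → Type
  | zero {Γ : List Ty} {σ : Ty} : Var (σ :: Γ) σ
  | succ {Γ : List Ty} {σ τ : Ty} : Var Γ τ → Var (σ :: Γ) τ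

/-- The constants: zero, successor, the combinators `Π` and `Σ`, the recursor `R₀` of type `0`, and
for finite sequences `mk n f = ⟨f 0, …, f (n-1)⟩`, the length and the entries of a sequence. -/
inductive Con : Ty → Type
  | zero : Con Ty.nat
  | succ : Con (Ty.nat ⇒ₜ Ty.nat)
  | combK (σ τ : Ty) : Con (σ ⇒ₜ τ ⇒ₜ σ)
  | combS (ρ σ τ : Ty) : Con ((ρ ⇒ₜ σ ⇒ₜ τ) ⇒ₜ (ρ ⇒ₜ σ) ⇒ₜ ρ ⇒ₜ τ)
  | recN : Con (Ty.nat ⇒ₜ Ty.nat ⇒ₜ (Ty.nat ⇒ₜ Ty.nat ⇒ₜ Ty.nat) ⇒ₜ Ty.nat)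
  | mk (σ : Ty) : Con (Ty.nat ⇒ₜ (Ty.nat ⇒ₜ σ) ⇒ₜ Ty.seq σ)
  | len (σ : Ty) : Con (Ty.seq σ ⇒ₜ Ty.nat)
  | get (σ : Ty) : Con (Ty.seq σ ⇒ₜ Ty.nat ⇒ₜ σ)

/-- Terms with free variables in the context `Γ`. -/
inductive Tm (Γ : List Ty) : Ty → Type
  | var {σ : Ty} : Var Γ σ → Tm Γ σ
  | con {σ : Ty} : Con σ → Tm Γ σ
  | app {σ τ : Ty} : Tm Γ (σ ⇒ₜ τ) → Tm Γ σ → Tm Γ τ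

infixl:100 " ⬝ " => Tm.app

/-- Formulas. The prime formulas are equations of type `0` and `st_σ(t)`; the remaining connectives
are defined classically. -/
inductive Fm : List Ty → Type
  | bot {Γ : List Ty} : Fm Γ
  | eq {Γ : List Ty} : Tm Γ Ty.nat → Tm Γ Ty.nat → Fm Γ
  | st {Γ : List Ty} {σ : Ty} : Tm Γ σ → Fm Γ
  | imp {Γ : List Ty} : Fm Γ → Fm Γ → Fm Γ
  | all {Γ : List Ty} (σ : Ty) : Fm (σ :: Γ) → Fm Γ

infixr:25 " ⇒ᶠ " => Fm.imp

/-! ### Renaming and substitution -/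

abbrev Ren (Γ Δ : List Ty) : Type := ∀ σ : Ty, Var Γ σ → Var Δ σ

abbrev Sub (Γ Δ : List Ty) : Type := ∀ σ : Ty, Var Γ σ → Tm Δ σ

def Ren.wk {Γ : List Ty} {ρ : Ty} : Ren Γ (ρ :: Γ) := fun _ v => v.succ

def Ren.lift {Γ Δ : List Ty} {ρ : Ty} (r : Ren Γ Δ) : Ren (ρ :: Γ) (ρ :: Δ)
  | _, .zero => .zero
  | _, .succ v => .succ (r _ v)

def Ren.empty {Γ : List Ty} : Ren [] Γ := fun _ v => nomatch v

def Tm.rename {Γ Δ : List Ty} (r : Ren Γ Δ) : {σ : Ty} → Tm Γ σ → Tm Δ σ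
  | _, .var v => .var (r _ v)
  | _, .con c => .con c
  | _, .app f a => .app (f.rename r) (a.rename r)

/-- Weakening of a term by one fresh variable. -/
def Tm.wk {Γ : List Ty} {ρ σ : Ty} (t : Tm Γ σ) : Tm (ρ :: Γ) σ := t.rename Ren.wk

def Tm.subst {Γ Δ : List Ty} (s : Sub Γ Δ) : {σ : Ty} → Tm Γ σ → Tm Δ σ
  | _, .var v => s _ v
  | _, .con c => .con c
  | _, .app f a => .app (f.subst s) (a.subst s)

/-- Extend a substitution by a value for the most recent variable. -/
def Sub.cons {Γ Δ : List Ty} {ρ : Ty} (t : Tm Δ ρ) (s : Sub Γ Δ) : Sub (ρ :: Γ) Δ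
  | _, .zero => t
  | _, .succ v => s _ v

def Sub.id {Γ : List Ty} : Sub Γ Γ := fun _ v => .var v

/-- The substitution that weakens every variable. -/
def Sub.wk {Γ : List Ty} {ρ : Ty} : Sub Γ (ρ :: Γ) := fun _ v => .var v.succ

def Sub.lift {Γ Δ : List Ty} {ρ : Ty} (s : Sub Γ Δ) : Sub (ρ :: Γ) (ρ :: Δ) :=
  Sub.cons (.var .zero) (fun _ v => (s _ v).wk)

def Fm.rename {Γ Δ : List Ty} (r : Ren Γ Δ) : Fm Γ → Fm Δ
  | .bot => .bot
  | .eq a b => .eq (a.rename r) (b.rename r)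
  | .st t => .st (t.rename r)
  | .imp A B => .imp (A.rename r) (B.rename r)
  | .all σ A => .all σ (A.rename r.lift)

def Fm.wk {Γ : List Ty} {ρ : Ty} (A : Fm Γ) : Fm (ρ :: Γ) := A.rename Ren.wk

def Fm.subst {Γ Δ : List Ty} (s : Sub Γ Δ) : Fm Γ → Fm Δ
  | .bot => .bot
  | .eq a b => .eq (a.subst s) (b.subst s)
  | .st t => .st (t.subst s)
  | .imp A B => .imp (A.subst s) (B.subst s)
  | .all σ A => .all σ (A.subst s.lift)

/-- `A(t)`, where `A` has one more free variable. -/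
def Fm.inst {Γ : List Ty} {ρ : Ty} (A : Fm (ρ :: Γ)) (t : Tm Γ ρ) : Fm Γ :=
  A.subst (Sub.cons t Sub.id)

/-- Universal closure. -/
def Fm.close : (Γ : List Ty) → Fm Γ → Fm []
  | [], A => A
  | σ :: Γ, A => Fm.close Γ (.all σ A)

/-! ### Defined connectives and quantifiers -/

def Fm.neg {Γ : List Ty} (A : Fm Γ) : Fm Γ := A ⇒ᶠ .bot

def Fm.and {Γ : List Ty} (A B : Fm Γ) : Fm Γ := (A ⇒ᶠ B.neg).neg

infixr:35 " ∧ᶠ " => Fm.and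

def Fm.iff {Γ : List Ty} (A B : Fm Γ) : Fm Γ := (A ⇒ᶠ B) ∧ᶠ (B ⇒ᶠ A)

infix:20 " ⇔ᶠ " => Fm.iff

def Fm.ex {Γ : List Ty} (σ : Ty) (A : Fm (σ :: Γ)) : Fm Γ := (Fm.all σ A.neg).neg

/-- The most recently bound variable, and the ones before it. -/
def v0 {Γ : List Ty} {a : Ty} : Tm (a :: Γ) a := .var .zero
def v1 {Γ : List Ty} {a b : Ty} : Tm (a :: b :: Γ) b := .var (.succ .zero)
def v2 {Γ : List Ty} {a b c : Ty} : Tm (a :: b :: c :: Γ) c := .var (.succ (.succ .zero))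
def v3 {Γ : List Ty} {a b c d : Ty} : Tm (a :: b :: c :: d :: Γ) d :=
  .var (.succ (.succ (.succ .zero)))

/-- `(∀ˢᵗ x) A`. -/
def Fm.allSt {Γ : List Ty} (σ : Ty) (A : Fm (σ :: Γ)) : Fm Γ := Fm.all σ (Fm.st v0 ⇒ᶠ A)

/-- `(∃ˢᵗ x) A`. -/
def Fm.exSt {Γ : List Ty} (σ : Ty) (A : Fm (σ :: Γ)) : Fm Γ := Fm.ex σ (Fm.st v0 ∧ᶠ A)

/-- A formula is internal if `st` does not occur in it. -/
def Fm.Internal : {Γ : List Ty} → Fm Γ → Prop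
  | _, .bot => True
  | _, .eq _ _ => True
  | _, .st _ => False
  | _, .imp A B => A.Internal ∧ B.Internal
  | _, .all _ A => A.Internal

/-- Quantifier-free internal formulas. -/
def Fm.QF : {Γ : List Ty} → Fm Γ → Prop
  | _, .bot => True
  | _, .eq _ _ => True
  | _, .st _ => False
  | _, .imp A B => A.QF ∧ B.QF
  | _, .all _ _ => False

/-! ### Abstraction and elementary primitive recursive terms -/

/-- Abstraction `λ x. t`, by the usual combinator translation. -/
def lam {Γ : List Ty} {σ : Ty} : {τ : Ty} → Tm (σ :: Γ) τ → Tm Γ (σ ⇒ₜ τ)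
  | _, .var .zero => .con (.combS σ (σ ⇒ₜ σ) σ) ⬝ .con (.combK σ (σ ⇒ₜ σ)) ⬝ .con (.combK σ σ)
  | τ, .var (.succ v) => .con (.combK τ σ) ⬝ .var v
  | τ, .con c => .con (.combK τ σ) ⬝ .con c
  | τ, .app (σ := ρ) f a => .con (.combS σ ρ τ) ⬝ lam f ⬝ lam a

def zeroT {Γ : List Ty} : Tm Γ Ty.nat := .con .zero

def succT {Γ : List Ty} (t : Tm Γ Ty.nat) : Tm Γ Ty.nat := .con .succ ⬝ t

def numT {Γ : List Ty} : ℕ → Tm Γ Ty.nat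
  | 0 => zeroT
  | n + 1 => succT (numT n)

/-- `R₀ n a (λ p i. z)`: value `a` at `0`, and `z` at the successor of `i`, with `v0 = i` and `v1 = p`
the value at `i`. -/
def recT {Γ : List Ty} (n a : Tm Γ Ty.nat) (z : Tm (Ty.nat :: Ty.nat :: Γ) Ty.nat) : Tm Γ Ty.nat :=
  .con .recN ⬝ n ⬝ a ⬝ lam (lam z)

def addC {Γ : List Ty} : Tm Γ (Ty.nat ⇒ₜ Ty.nat ⇒ₜ Ty.nat) := lam (lam (recT v0 v1 (succT v1)))
def addT {Γ : List Ty} (s t : Tm Γ Ty.nat) : Tm Γ Ty.nat := addC ⬝ s ⬝ t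

def predC {Γ : List Ty} : Tm Γ (Ty.nat ⇒ₜ Ty.nat) := lam (recT v0 zeroT v0)

/-- Truncated subtraction. -/
def subC {Γ : List Ty} : Tm Γ (Ty.nat ⇒ₜ Ty.nat ⇒ₜ Ty.nat) := lam (lam (recT v0 v1 (predC ⬝ v1)))
def subT {Γ : List Ty} (s t : Tm Γ Ty.nat) : Tm Γ Ty.nat := subC ⬝ s ⬝ t

def mulC {Γ : List Ty} : Tm Γ (Ty.nat ⇒ₜ Ty.nat ⇒ₜ Ty.nat) :=
  lam (lam (recT v0 zeroT (addT v1 v3)))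
def mulT {Γ : List Ty} (s t : Tm Γ Ty.nat) : Tm Γ Ty.nat := mulC ⬝ s ⬝ t

/-- `2 ^ n`. -/
def pow2C {Γ : List Ty} : Tm Γ (Ty.nat ⇒ₜ Ty.nat) := lam (recT v0 (numT 1) (addT v1 v1))
def pow2T {Γ : List Ty} (t : Tm Γ Ty.nat) : Tm Γ Ty.nat := pow2C ⬝ t

/-- The triangular numbers `0 + 1 + ⋯ + n`. -/
def triC {Γ : List Ty} : Tm Γ (Ty.nat ⇒ₜ Ty.nat) := lam (recT v0 zeroT (succT (addT v1 v0)))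

/-- The largest `w` whose triangular number is at most `u`. -/
def rootC {Γ : List Ty} : Tm Γ (Ty.nat ⇒ₜ Ty.nat) :=
  lam (recT v0 zeroT (addT v1 (subT (numT 1) (subT (triC ⬝ succT v1) (succT v0)))))

/-- The pairing `j(n, m) = ((n + m)² + 3 n + m) / 2`, a bijection, and its two inverses. -/
def pairC {Γ : List Ty} : Tm Γ (Ty.nat ⇒ₜ Ty.nat ⇒ₜ Ty.nat) :=
  lam (lam (addT (triC ⬝ addT v1 v0) v1))
def fstC {Γ : List Ty} : Tm Γ (Ty.nat ⇒ₜ Ty.nat) := lam (subT v0 (triC ⬝ (rootC ⬝ v0)))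
def sndC {Γ : List Ty} : Tm Γ (Ty.nat ⇒ₜ Ty.nat) := lam (subT (rootC ⬝ v0) (fstC ⬝ v0))

/-- The remainder and the quotient of the division by `2`. -/
def parC {Γ : List Ty} : Tm Γ (Ty.nat ⇒ₜ Ty.nat) := lam (recT v0 zeroT (subT (numT 1) v1))
def halfC {Γ : List Ty} : Tm Γ (Ty.nat ⇒ₜ Ty.nat) := lam (recT v0 zeroT (addT v1 (parC ⬝ v0)))

/-- The closed terms `0_σ`. -/
def defaultT {Γ : List Ty} : (σ : Ty) → Tm Γ σ
  | .nat => zeroT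
  | .arr σ τ => .con (.combK τ σ) ⬝ defaultT τ
  | .seq σ => .con (.mk σ) ⬝ zeroT ⬝ (.con (.combK σ Ty.nat) ⬝ defaultT σ)

/-! ### Order of type `0`, extensional equality, membership in finite sequences -/

def leN {Γ : List Ty} (s t : Tm Γ Ty.nat) : Fm Γ := .eq (subT s t) zeroT

def ltN {Γ : List Ty} (s t : Tm Γ Ty.nat) : Fm Γ := leN (succT s) t

def lenT {Γ : List Ty} {σ : Ty} (s : Tm Γ (Ty.seq σ)) : Tm Γ Ty.nat := .con (.len σ) ⬝ s

def getT {Γ : List Ty} {σ : Ty} (s : Tm Γ (Ty.seq σ)) (i : Tm Γ Ty.nat) : Tm Γ σ :=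
  .con (.get σ) ⬝ s ⬝ i

/-- Extensional equality `=_σ`, defined from `=_0`. -/
def eqT : {Γ : List Ty} → (σ : Ty) → Tm Γ σ → Tm Γ σ → Fm Γ
  | _, .nat, s, t => .eq s t
  | _, .arr σ τ, s, t => .all σ (eqT τ (s.wk ⬝ v0) (t.wk ⬝ v0))
  | _, .seq σ, s, t => .eq (lenT s) (lenT t) ∧ᶠ
      .all Ty.nat (ltN v0 (lenT s.wk) ⇒ᶠ eqT σ (getT s.wk v0) (getT t.wk v0))

/-- `z ∈ s`, i.e. `z` equals an entry of the finite sequence `s`. -/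
def mem {Γ : List Ty} {σ : Ty} (z : Tm Γ σ) (s : Tm Γ (Ty.seq σ)) : Fm Γ :=
  .ex Ty.nat (ltN v0 (lenT s.wk) ∧ᶠ eqT σ (getT s.wk v0) z.wk)

/-! ### Classical derivability -/

/-- Classical natural deduction from a set `T` of sentences, in the context `Γ` of free variables
and under the assumptions in a list. -/
inductive Derives (T : Set (Fm [])) : {Γ : List Ty} → List (Fm Γ) → Fm Γ → Prop
  | ax {Γ : List Ty} {H : List (Fm Γ)} {A : Fm []} : A ∈ T → Derives T H (A.rename Ren.empty)
  | hyp {Γ : List Ty} {H : List (Fm Γ)} {A : Fm Γ} : A ∈ H → Derives T H A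
  | impI {Γ : List Ty} {H : List (Fm Γ)} {A B : Fm Γ} :
      Derives T (A :: H) B → Derives T H (A ⇒ᶠ B)
  | impE {Γ : List Ty} {H : List (Fm Γ)} {A B : Fm Γ} :
      Derives T H (A ⇒ᶠ B) → Derives T H A → Derives T H B
  | raa {Γ : List Ty} {H : List (Fm Γ)} {A : Fm Γ} :
      Derives T (A.neg :: H) .bot → Derives T H A
  | allI {Γ : List Ty} {H : List (Fm Γ)} {σ : Ty} {A : Fm (σ :: Γ)} :
      Derives T (H.map Fm.wk) A → Derives T H (.all σ A)
  | allE {Γ : List Ty} {H : List (Fm Γ)} {σ : Ty} {A : Fm (σ :: Γ)} (t : Tm Γ σ) :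
      Derives T H (.all σ A) → Derives T H (A.inst t)

/-- `T ⊢ A`: the sentence `A` is provable from the axioms `T`. -/
def Proves (T : Set (Fm [])) (A : Fm []) : Prop := Derives T [] A

/-! ### The system `P₀` -/

/-- `HAC_int`: `(∀ˢᵗ x)(∃ˢᵗ y) φ(x, y) → (∃ˢᵗ F)(∀ˢᵗ x)(∃ y ∈ F(x)) φ(x, y)`;
in `φ`, `v0` is `y` and `v1` is `x`. -/
def hacInt {Γ : List Ty} (ρ τ : Ty) (φ : Fm (τ :: ρ :: Γ)) : Fm Γ :=
  Fm.allSt ρ (Fm.exSt τ φ) ⇒ᶠ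
    Fm.exSt (ρ ⇒ₜ Ty.seq τ) (Fm.allSt ρ (Fm.ex τ
      (mem v0 (v2 ⬝ v1) ∧ᶠ φ.rename Ren.wk.lift.lift)))

/-- Idealisation `I`: `(∀ˢᵗ x*)(∃ y)(∀ z ∈ x) φ(z, y) → (∃ y)(∀ˢᵗ x) φ(x, y)`;
in `φ`, `v0` is `z` and `v1` is `y`. -/
def idealisation {Γ : List Ty} (σ τ : Ty) (φ : Fm (σ :: τ :: Γ)) : Fm Γ :=
  Fm.allSt (Ty.seq σ) (Fm.ex τ (Fm.all σ (mem v0 v2 ⇒ᶠ φ.rename Ren.wk.lift.lift))) ⇒ᶠ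
    Fm.ex τ (Fm.allSt σ φ)

/-- `QF-AC^{1,0}`: `(∀ x)(∃ y) φ(x, y) → (∃ F)(∀ x) φ(x, F(x))`; in `φ`, `v0` is `y`, `v1` is `x`. -/
def qfAC {Γ : List Ty} (φ : Fm (Ty.nat :: Ty.one :: Γ)) : Fm Γ :=
  Fm.all Ty.one (Fm.ex Ty.nat φ) ⇒ᶠ
    Fm.ex (Ty.one ⇒ₜ Ty.nat) (Fm.all Ty.one
      (φ.subst (Sub.cons (v1 ⬝ v0) (Sub.cons v0 (fun _ v => .var v.succ.succ)))))

/-- Induction for `φ`. -/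
def induction {Γ : List Ty} (φ : Fm (Ty.nat :: Γ)) : Fm Γ :=
  φ.inst zeroT ⇒ᶠ
    Fm.all Ty.nat (φ ⇒ᶠ φ.subst (Sub.cons (succT v0) Sub.wk)) ⇒ᶠ Fm.all Ty.nat φ

/-- The axioms of `P₀` as open formulas; the free variables, of the context `Γ`, are parameters. -/
inductive P0Axiom : (Γ : List Ty) → Fm Γ → Prop
  | eq_refl {Γ : List Ty} (a : Tm Γ Ty.nat) : P0Axiom Γ (.eq a a)
  | eq_symm {Γ : List Ty} (a b : Tm Γ Ty.nat) : P0Axiom Γ (.eq a b ⇒ᶠ .eq b a)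
  | eq_trans {Γ : List Ty} (a b c : Tm Γ Ty.nat) :
      P0Axiom Γ (.eq a b ⇒ᶠ .eq b c ⇒ᶠ .eq a c)
  | succ_ne_zero {Γ : List Ty} (a : Tm Γ Ty.nat) : P0Axiom Γ (Fm.eq (succT a) zeroT).neg
  | succ_inj {Γ : List Ty} (a b : Tm Γ Ty.nat) :
      P0Axiom Γ (.eq (succT a) (succT b) ⇒ᶠ .eq a b)
  | combK {Γ : List Ty} (σ τ : Ty) (a : Tm Γ σ) (b : Tm Γ τ) :
      P0Axiom Γ (eqT σ (.con (.combK σ τ) ⬝ a ⬝ b) a)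
  | combS {Γ : List Ty} (ρ σ τ : Ty) (a : Tm Γ (ρ ⇒ₜ σ ⇒ₜ τ)) (b : Tm Γ (ρ ⇒ₜ σ)) (c : Tm Γ ρ) :
      P0Axiom Γ (eqT τ (.con (.combS ρ σ τ) ⬝ a ⬝ b ⬝ c) (a ⬝ c ⬝ (b ⬝ c)))
  | rec_zero {Γ : List Ty} (a : Tm Γ Ty.nat) (z : Tm Γ (Ty.nat ⇒ₜ Ty.nat ⇒ₜ Ty.nat)) :
      P0Axiom Γ (.eq (.con .recN ⬝ zeroT ⬝ a ⬝ z) a)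
  | rec_succ {Γ : List Ty} (n a : Tm Γ Ty.nat) (z : Tm Γ (Ty.nat ⇒ₜ Ty.nat ⇒ₜ Ty.nat)) :
      P0Axiom Γ (.eq (.con .recN ⬝ succT n ⬝ a ⬝ z) (z ⬝ (.con .recN ⬝ n ⬝ a ⬝ z) ⬝ n))
  | len_mk {Γ : List Ty} (σ : Ty) (n : Tm Γ Ty.nat) (f : Tm Γ (Ty.nat ⇒ₜ σ)) :
      P0Axiom Γ (.eq (lenT (.con (.mk σ) ⬝ n ⬝ f)) n)
  | get_mk {Γ : List Ty} (σ : Ty) (n i : Tm Γ Ty.nat) (f : Tm Γ (Ty.nat ⇒ₜ σ)) :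
      P0Axiom Γ (ltN i n ⇒ᶠ eqT σ (getT (.con (.mk σ) ⬝ n ⬝ f) i) (f ⬝ i))
  | get_default {Γ : List Ty} (σ : Ty) (s : Tm Γ (Ty.seq σ)) (i : Tm Γ Ty.nat) :
      P0Axiom Γ (leN (lenT s) i ⇒ᶠ eqT σ (getT s i) (defaultT σ))
  | extensionality {Γ : List Ty} (ρ τ : Ty) (a b : Tm Γ ρ) (f : Tm Γ (ρ ⇒ₜ τ)) :
      P0Axiom Γ (eqT ρ a b ⇒ᶠ eqT τ (f ⬝ a) (f ⬝ b))
  | qfInduction {Γ : List Ty} (φ : Fm (Ty.nat :: Γ)) : φ.QF → P0Axiom Γ (induction φ)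
  | qfAC {Γ : List Ty} (φ : Fm (Ty.nat :: Ty.one :: Γ)) : φ.QF → P0Axiom Γ (qfAC φ)
  | st_eq {Γ : List Ty} (σ : Ty) (a b : Tm Γ σ) : P0Axiom Γ (.st a ⇒ᶠ eqT σ a b ⇒ᶠ .st b)
  | st_closed (σ : Ty) (t : Tm [] σ) : P0Axiom [] (.st t)
  | st_app {Γ : List Ty} (σ τ : Ty) (f : Tm Γ (σ ⇒ₜ τ)) (a : Tm Γ σ) :
      P0Axiom Γ (.st f ⇒ᶠ .st a ⇒ᶠ .st (f ⬝ a))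
  | hacInt {Γ : List Ty} (ρ τ : Ty) (φ : Fm (τ :: ρ :: Γ)) :
      φ.Internal → P0Axiom Γ (hacInt ρ τ φ)
  | idealisation {Γ : List Ty} (σ τ : Ty) (φ : Fm (σ :: τ :: Γ)) :
      φ.Internal → P0Axiom Γ (idealisation σ τ φ)

/-- The system `P₀ = E-PRA^{ω*} + T*_st + HAC_int + I + QF-AC^{1,0}`. -/
def P0 : Set (Fm []) := {A | ∃ (Γ : List Ty) (B : Fm Γ), P0Axiom Γ B ∧ A = Fm.close Γ B}

/-- `(∀ n, m)(st(n) ∧ m ≤ n → st(m))`. -/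
def stDownward : Fm [] :=
  Fm.all Ty.nat (Fm.all Ty.nat ((Fm.st v1 ∧ᶠ leN v0 v1) ⇒ᶠ Fm.st v0))

/-! ### Rational and real numbers inside the language -/

/-- A number `j(a, b)` codes the rational `(a/2)/(b+1)` for even `a`, and `-((a+1)/2)/(b+1)` for odd
`a`; thus every number codes a rational `(p - m) / d`. -/
def ratPos {Γ : List Ty} (q : Tm Γ Ty.nat) : Tm Γ Ty.nat :=
  mulT (halfC ⬝ (fstC ⬝ q)) (subT (numT 1) (parC ⬝ (fstC ⬝ q)))
def ratNeg {Γ : List Ty} (q : Tm Γ Ty.nat) : Tm Γ Ty.nat :=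
  mulT (succT (halfC ⬝ (fstC ⬝ q))) (parC ⬝ (fstC ⬝ q))
def ratDen {Γ : List Ty} (q : Tm Γ Ty.nat) : Tm Γ Ty.nat := succT (sndC ⬝ q)

/-- The two sides, cleared of denominators, of the comparison of `q - r` with `k / 2 ^ n`. -/
def diffL {Γ : List Ty} (q r n : Tm Γ Ty.nat) : Tm Γ Ty.nat :=
  mulT (pow2T n) (addT (mulT (ratPos q) (ratDen r)) (mulT (ratNeg r) (ratDen q)))
def diffR {Γ : List Ty} (q r k n : Tm Γ Ty.nat) : Tm Γ Ty.nat :=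
  addT (mulT (pow2T n) (addT (mulT (ratNeg q) (ratDen r)) (mulT (ratPos r) (ratDen q))))
    (mulT k (mulT (ratDen q) (ratDen r)))

/-- `q - r < k / 2 ^ n`. -/
def diffLt {Γ : List Ty} (q r k n : Tm Γ Ty.nat) : Fm Γ := ltN (diffL q r n) (diffR q r k n)

/-- `q - r ≤ k / 2 ^ n`. -/
def diffLe {Γ : List Ty} (q r k n : Tm Γ Ty.nat) : Fm Γ := leN (diffL q r n) (diffR q r k n)

/-- `x` is a real, i.e. a fast converging sequence of rationals:
`|x(n) - x(n+i)| < 1 / 2 ^ n` for all `n`, `i`. -/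
def isReal {Γ : List Ty} (x : Tm Γ Ty.one) : Fm Γ :=
  Fm.all Ty.nat (Fm.all Ty.nat
    (diffLt (x.wk.wk ⬝ v1) (x.wk.wk ⬝ addT v1 v0) (numT 1) v1 ∧ᶠ
      diffLt (x.wk.wk ⬝ addT v1 v0) (x.wk.wk ⬝ v1) (numT 1) v1))

/-- `x ≤ y` for reals: `x(n) - y(n) ≤ 2 / 2 ^ n` for all `n`. -/
def leR {Γ : List Ty} (x y : Tm Γ Ty.one) : Fm Γ :=
  Fm.all Ty.nat (diffLe (x.wk ⬝ v0) (y.wk ⬝ v0) (numT 2) v0)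

/-- `x < y` for reals. -/
def ltR {Γ : List Ty} (x y : Tm Γ Ty.one) : Fm Γ := (leR y x).neg

/-- `x ≈ y` for reals: `|x(n) - y(n)| ≤ 2 / 2 ^ n` for all standard `n`. -/
def approxR {Γ : List Ty} (x y : Tm Γ Ty.one) : Fm Γ :=
  Fm.allSt Ty.nat (diffLe (x.wk ⬝ v0) (y.wk ⬝ v0) (numT 2) v0 ∧ᶠ
    diffLe (y.wk ⬝ v0) (x.wk ⬝ v0) (numT 2) v0)

/-- `x ≪ y` for reals: `x < y` and not `x ≈ y`. -/
def llR {Γ : List Ty} (x y : Tm Γ Ty.one) : Fm Γ := ltR x y ∧ᶠ (approxR x y).neg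

/-- The real given by the constant sequence of the rational with code `q`. -/
def constR {Γ : List Ty} (q : Tm Γ Ty.nat) : Tm Γ Ty.one := .con (.combK Ty.nat Ty.nat) ⬝ q

def zeroR {Γ : List Ty} : Tm Γ Ty.one := constR (pairC ⬝ numT 0 ⬝ numT 0)
def oneR {Γ : List Ty} : Tm Γ Ty.one := constR (pairC ⬝ numT 2 ⬝ numT 0)

/-- `x ∈ [0, 1]`. -/
def inUnit {Γ : List Ty} (x : Tm Γ Ty.one) : Fm Γ := isReal x ∧ᶠ leR zeroR x ∧ᶠ leR x oneR

/-! ### The principles -/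

/-- `α ≤₁ 1`. -/
def leOne {Γ : List Ty} (α : Tm Γ Ty.one) : Fm Γ := Fm.all Ty.nat (leN (α.wk ⬝ v0) (numT 1))

/-- `α ≈₁ β`. -/
def approxOne {Γ : List Ty} (α β : Tm Γ Ty.one) : Fm Γ :=
  Fm.allSt Ty.nat (.eq (α.wk ⬝ v0) (β.wk ⬝ v0))

/-- `STP`: `(∀ α ≤₁ 1)(∃ˢᵗ β ≤₁ 1)(α ≈₁ β)`. -/
def STP : Fm [] :=
  Fm.all Ty.one (leOne v0 ⇒ᶠ Fm.exSt Ty.one (leOne v0 ∧ᶠ approxOne v1 v0))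

/-- Nonstandard compactness of the unit interval: `(∀ x ∈ [0,1])(∃ˢᵗ y ∈ [0,1])(x ≈ y)`. -/
def unitCompact : Fm [] :=
  Fm.all Ty.one (inUnit v0 ⇒ᶠ Fm.exSt Ty.one (inUnit v0 ∧ᶠ approxR v1 v0))

/-- `c` and `d` are sequences of reals: the end points of a sequence of open intervals. -/
def areIntervals {Γ : List Ty} (c d : Tm Γ (Ty.nat ⇒ₜ Ty.one)) : Fm Γ :=
  Fm.all Ty.nat (isReal (c.wk ⬝ v0) ∧ᶠ isReal (d.wk ⬝ v0))

/-- `c(i) ≪ y ≪ d(i)`. -/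
def inInterval {Γ : List Ty} (c d : Tm Γ (Ty.nat ⇒ₜ Ty.one)) (i : Tm Γ Ty.nat) (y : Tm Γ Ty.one) :
    Fm Γ := llR (c ⬝ i) y ∧ᶠ llR y (d ⬝ i)

/-- `(∀ˢᵗ x ∈ [0,1])(∃ˢᵗ n)(c(n) ≪ x ≪ d(n))`. -/
def stCover {Γ : List Ty} (c d : Tm Γ (Ty.nat ⇒ₜ Ty.one)) : Fm Γ :=
  Fm.allSt Ty.one (inUnit v0 ⇒ᶠ Fm.exSt Ty.nat (inInterval c.wk.wk d.wk.wk v0 v1))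

/-- `y ∈ [0,1] → (∃ i ≤ k)(c(i) ≪ y ≪ d(i))`. -/
def finCovers {Γ : List Ty} (c d : Tm Γ (Ty.nat ⇒ₜ Ty.one)) (k : Tm Γ Ty.nat) (y : Tm Γ Ty.one) :
    Fm Γ :=
  inUnit y ⇒ᶠ Fm.ex Ty.nat (leN v0 k.wk ∧ᶠ inInterval c.wk d.wk v0 y.wk)

/-- `HBL_ns`: every sequence of open intervals with `stCover` satisfies
`(∃ˢᵗ k)(∀ˢᵗ y ∈ [0,1])(∃ i ≤ k)(c(i) ≪ y ≪ d(i))`. -/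
def HBLns : Fm [] :=
  Fm.all (Ty.nat ⇒ₜ Ty.one) (Fm.all (Ty.nat ⇒ₜ Ty.one)
    (areIntervals v1 v0 ⇒ᶠ stCover v1 v0 ⇒ᶠ
      Fm.exSt Ty.nat (Fm.allSt Ty.one (finCovers v3 v2 v1 v0))))

/-- `HBL_ns` with the final quantifier over all `y ∈ [0,1]`, standard or not. -/
def HBLnsAll : Fm [] :=
  Fm.all (Ty.nat ⇒ₜ Ty.one) (Fm.all (Ty.nat ⇒ₜ Ty.one)
    (areIntervals v1 v0 ⇒ᶠ stCover v1 v0 ⇒ᶠ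
      Fm.exSt Ty.nat (Fm.all Ty.one (finCovers v3 v2 v1 v0))))

end NSA

namespace NSA

/-! ### Renaming and substitution lemmas -/

section Syntactic

variable {Γ Δ Θ : List Ty} {σ ρ : Ty}

/-! Formal derivations are replaced by semantics. A Henkin term model yields completeness
(`proves_of_forall_sat`). Full extensionality makes `=_σ` a congruence, and dividing by it gives
`proves_of_forall_model`: it suffices to argue in a `P0Model`, where extensional equality is
equality. There quantifier-free induction makes the objects of type `0` an ordered semiring,
rational codes take values in its fraction field `K`, and estimates between reals become linear
inequalities in `K`.

From `STP` to `NSC`: `STP` for 0-1 sequences extends to sequences under a standard bound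
(`Stp.bounded`) by coding the relation `f(n) ≤ k`. Applied to the numerators of dyadic
approximations of `x`, this gives a standard rational sequence that converges fast at standard
places. There is no transfer to the remaining places, so `exists_real` freezes the sequence just
before its first failure. Conversely, a 0-1 sequence `α` is coded as the real with base-4 digits
`α(n)`; digits 0 and 1 leave gaps, so they can be read off a standard part of that real at standard
places (`UnitCompact.stp`).

From `NSC` to `HBL'_ns`: if no standard `k` works, idealisation gives one point `y` that avoids
every standard interval by a margin, but the standard part of `y` lies well inside some standard
interval. The strong membership is external, so the internal formula `outside` takes its place.

For the converses, let `x` have no standard part. The intervals of radius `2⁻ᵐ` about rationals `a`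
at distance at least `2 · 2⁻ᵐ` from `x(m)` cover the standard points and never contain `x`
(`exists_intervals`). This refutes `HBL'_ns` at once. For `HBL_ns` a standard uncovered point is
needed: the largest right end point of those of the first `k` intervals that lie left of `x`, or 0.
By `D` its index is standard, hence so is the point. It is beyond all intervals on the left, and it
is at most `x`, hence before those on the right. -/

theorem Ren.lift_comp (r : Ren Γ Δ) (r' : Ren Δ Θ) :
    (fun τ v => (r'.lift (ρ := ρ)) τ (r.lift τ v)) = Ren.lift (fun τ v => r' τ (r τ v)) := by
  funext τ v; cases v <;> rfl

theorem Tm.rename_rename (r : Ren Γ Δ) (r' : Ren Δ Θ) (t : Tm Γ σ) :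
    (t.rename r).rename r' = t.rename (fun τ v => r' τ (r τ v)) := by
  induction t with
  | var v => rfl
  | con c => rfl
  | app f a hf ha => simp only [Tm.rename, hf, ha]

theorem Tm.subst_rename (r : Ren Γ Δ) (s : Sub Δ Θ) (t : Tm Γ σ) :
    (t.rename r).subst s = t.subst (fun τ v => s τ (r τ v)) := by
  induction t with
  | var v => rfl
  | con c => rfl
  | app f a hf ha => simp only [Tm.rename, Tm.subst, hf, ha]

theorem Tm.rename_subst (s : Sub Γ Δ) (r : Ren Δ Θ) (t : Tm Γ σ) :
    (t.subst s).rename r = t.subst (fun τ v => (s τ v).rename r) := by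
  induction t with
  | var v => rfl
  | con c => rfl
  | app f a hf ha => simp only [Tm.rename, Tm.subst, hf, ha]

theorem Tm.subst_subst (s : Sub Γ Δ) (s' : Sub Δ Θ) (t : Tm Γ σ) :
    (t.subst s).subst s' = t.subst (fun τ v => (s τ v).subst s') := by
  induction t with
  | var v => rfl
  | con c => rfl
  | app f a hf ha => simp only [Tm.subst, hf, ha]

theorem Tm.subst_id (t : Tm Γ σ) : t.subst Sub.id = t := by
  induction t with
  | var v => rfl
  | con c => rfl
  | app f a hf ha => simp only [Tm.subst, hf, ha]

theorem Tm.rename_lift_wk (r : Ren Γ Δ) (t : Tm Γ σ) :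
    (t.wk (ρ := ρ)).rename r.lift = (t.rename r).wk := by
  simp only [Tm.wk, Tm.rename_rename]; rfl

theorem Tm.wk_subst_cons (s : Sub Γ Δ) (u : Tm Δ ρ) (t : Tm Γ σ) :
    (t.wk (ρ := ρ)).subst (Sub.cons u s) = t.subst s := by
  simp only [Tm.wk, Tm.subst_rename]; rfl

theorem Tm.wk_subst_lift (s : Sub Γ Δ) (t : Tm Γ σ) :
    (t.wk (ρ := ρ)).subst s.lift = (t.subst s).wk := by
  rw [Sub.lift, Tm.wk_subst_cons]; simp only [Tm.wk, Tm.rename_subst]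

theorem Sub.lift_comp_ren (r : Ren Γ Δ) (s : Sub Δ Θ) :
    (fun τ v => (s.lift (ρ := ρ)) τ (r.lift τ v)) = Sub.lift (fun τ v => s τ (r τ v)) := by
  funext τ v; cases v <;> rfl

theorem Sub.ren_comp_lift (s : Sub Γ Δ) (r : Ren Δ Θ) :
    (fun τ v => ((s.lift (ρ := ρ)) τ v).rename r.lift) =
      Sub.lift (fun τ v => (s τ v).rename r) := by
  funext τ v
  cases v with
  | zero => rfl
  | succ v => exact Tm.rename_lift_wk r _

theorem Sub.lift_comp (s : Sub Γ Δ) (s' : Sub Δ Θ) :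
    (fun τ v => ((s.lift (ρ := ρ)) τ v).subst s'.lift) =
      Sub.lift (fun τ v => (s τ v).subst s') := by
  funext τ v
  cases v with
  | zero => rfl
  | succ v => exact Tm.wk_subst_lift s' _

theorem Fm.rename_rename (r : Ren Γ Δ) (r' : Ren Δ Θ) (A : Fm Γ) :
    (A.rename r).rename r' = A.rename (fun τ v => r' τ (r τ v)) := by
  induction A generalizing Δ Θ with
  | bot => rfl
  | eq a b => simp only [Fm.rename, Tm.rename_rename]
  | st t => simp only [Fm.rename, Tm.rename_rename]
  | imp A B hA hB => simp only [Fm.rename, hA, hB]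
  | all τ A hA => simp only [Fm.rename, hA, Ren.lift_comp]

theorem Fm.subst_rename (r : Ren Γ Δ) (s : Sub Δ Θ) (A : Fm Γ) :
    (A.rename r).subst s = A.subst (fun τ v => s τ (r τ v)) := by
  induction A generalizing Δ Θ with
  | bot => rfl
  | eq a b => simp only [Fm.rename, Fm.subst, Tm.subst_rename]
  | st t => simp only [Fm.rename, Fm.subst, Tm.subst_rename]
  | imp A B hA hB => simp only [Fm.rename, Fm.subst, hA, hB]
  | all τ A hA => simp only [Fm.rename, Fm.subst, hA, Sub.lift_comp_ren]

theorem Fm.rename_subst (s : Sub Γ Δ) (r : Ren Δ Θ) (A : Fm Γ) :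
    (A.subst s).rename r = A.subst (fun τ v => (s τ v).rename r) := by
  induction A generalizing Δ Θ with
  | bot => rfl
  | eq a b => simp only [Fm.rename, Fm.subst, Tm.rename_subst]
  | st t => simp only [Fm.rename, Fm.subst, Tm.rename_subst]
  | imp A B hA hB => simp only [Fm.rename, Fm.subst, hA, hB]
  | all τ A hA => simp only [Fm.rename, Fm.subst, hA, Sub.ren_comp_lift]

theorem Fm.subst_subst (s : Sub Γ Δ) (s' : Sub Δ Θ) (A : Fm Γ) :
    (A.subst s).subst s' = A.subst (fun τ v => (s τ v).subst s') := by
  induction A generalizing Δ Θ with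
  | bot => rfl
  | eq a b => simp only [Fm.subst, Tm.subst_subst]
  | st t => simp only [Fm.subst, Tm.subst_subst]
  | imp A B hA hB => simp only [Fm.subst, hA, hB]
  | all τ A hA => simp only [Fm.subst, hA, Sub.lift_comp]

theorem Sub.lift_id : (Sub.id (Γ := Γ)).lift (ρ := ρ) = Sub.id := by
  funext τ v; cases v <;> rfl

theorem Fm.subst_id (A : Fm Γ) : A.subst Sub.id = A := by
  induction A with
  | bot => rfl
  | eq a b => simp only [Fm.subst, Tm.subst_id]
  | st t => simp only [Fm.subst, Tm.subst_id]
  | imp A B hA hB => simp only [Fm.subst, hA, hB]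
  | all τ A hA => simp only [Fm.subst, Sub.lift_id, hA]

theorem Fm.rename_eq_subst (r : Ren Γ Δ) (A : Fm Γ) :
    A.rename r = A.subst (fun τ v => .var (r τ v)) := by
  have := Fm.subst_rename r Sub.id A
  rwa [Fm.subst_id] at this

theorem Fm.rename_lift_wk (r : Ren Γ Δ) (A : Fm Γ) :
    (A.wk (ρ := ρ)).rename r.lift = (A.rename r).wk := by
  simp only [Fm.wk, Fm.rename_rename]; rfl

/-- This matches `allE` with semantics: a value given to the bound variable extends the environment,
which in the term model is `Sub.cons`. -/
theorem Fm.inst_subst_lift (A : Fm (ρ :: Γ)) (s : Sub Γ Δ) (t : Tm Δ ρ) :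
    (A.subst s.lift).inst t = A.subst (Sub.cons t s) := by
  rw [Fm.inst, Fm.subst_subst]
  congr 1
  funext τ v
  cases v with
  | zero => rfl
  | succ v => exact (Tm.wk_subst_cons _ _ _).trans (Tm.subst_id _)

theorem Fm.inst_rename (A : Fm (ρ :: Γ)) (t : Tm Γ ρ) (r : Ren Γ Δ) :
    (A.inst t).rename r = (A.rename r.lift).inst (t.rename r) := by
  rw [Fm.inst, Fm.rename_subst, Fm.inst, Fm.subst_rename]
  congr 1
  funext τ v; cases v <;> rfl

end Syntactic

/-! ### Admissible rules -/

namespace Derives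

variable {T : Set (Fm [])} {Γ Δ : List Ty} {H H' : List (Fm Γ)} {A B : Fm Γ}

theorem rename (h : Derives T H A) (r : Ren Γ Δ) :
    Derives T (H.map (Fm.rename r)) (A.rename r) := by
  induction h generalizing Δ with
  | ax h => rw [Fm.rename_rename]; convert Derives.ax h using 2; funext τ v; nomatch v
  | hyp h => exact .hyp (List.mem_map_of_mem h)
  | impI _ ih => exact .impI (ih r)
  | impE _ _ ih₁ ih₂ => exact .impE (ih₁ r) (ih₂ r)
  | raa _ ih => exact .raa (ih r)
  | allI _ ih =>
    refine .allI ?_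
    have := ih r.lift
    simp only [List.map_map, Function.comp_def, Fm.rename_lift_wk] at this ⊢
    exact this
  | allE t _ ih => rw [Fm.inst_rename]; exact .allE _ (ih r)

theorem weaken (h : Derives T H A) (hH : H ⊆ H') : Derives T H' A := by
  induction h with
  | ax h => exact .ax h
  | hyp h => exact .hyp (hH h)
  | impI _ ih => exact .impI (ih (List.cons_subset_cons _ hH))
  | impE _ _ ih₁ ih₂ => exact .impE (ih₁ hH) (ih₂ hH)
  | raa _ ih => exact .raa (ih (List.cons_subset_cons _ hH))
  | allI _ ih => exact .allI (ih (List.map_subset _ hH))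
  | allE t _ ih => exact .allE _ (ih hH)

theorem falso (h : Derives T H .bot) : Derives T H A :=
  .raa (h.weaken (List.subset_cons_self _ _))

theorem head : Derives T (A :: H) A := .hyp List.mem_cons_self

theorem tail (h : Derives T H A) : Derives T (B :: H) A := h.weaken (List.subset_cons_self _ _)

end Derives

/-- `H` is consistent with `T`. -/
def Consistent (T : Set (Fm [])) {Γ : List Ty} (H : List (Fm Γ)) : Prop := ¬ Derives T H .bot

theorem Consistent.cons_neg {T : Set (Fm [])} {Γ : List Ty} {H : List (Fm Γ)} {B : Fm Γ}
    (h : Consistent T H) (hB : ¬ Consistent T (B :: H)) : Consistent T (B.neg :: H) :=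
  fun h' => h (.impE (.impI h') (.impI (not_not.1 hB)))

/-- Adding a Henkin axiom for a fresh variable preserves consistency. -/
theorem Consistent.henkin {T : Set (Fm [])} {Γ : List Ty} {σ : Ty} {H : List (Fm Γ)}
    (h : Consistent T H) (C : Fm (σ :: Γ)) :
    Consistent T ((C ⇒ᶠ (Fm.all σ C).wk) :: H.map Fm.wk) := by
  intro h'
  -- A refuted implication yields its premise `C`; as the variable is fresh, `C` generalises to the
  -- conclusion of that same implication.
  have hn : Derives T (H.map Fm.wk) (C ⇒ᶠ (Fm.all σ C).wk).neg := .impI h'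
  have hC : Derives T (H.map Fm.wk) C :=
    .raa (.impE hn.tail (.impI (.falso (.impE (Derives.head).tail .head))))
  have hA : Derives T (H.map Fm.wk) (Fm.all σ C).wk :=
    (Derives.allI hC).rename (Ren.wk (ρ := σ))
  have hb : Derives T (H.map Fm.wk) (Fm.bot (Γ := σ :: Γ)) := .impE hn (.impI hA.tail)
  -- The contradiction still lives in the larger context; the closed term `defaultT σ` removes the
  -- extra variable.
  exact h (Derives.allE (defaultT σ) (.allI hb))

/-! ### Countability of the syntax -/

def Ty.code : Ty → ℕ
  | .nat => 0
  | .arr σ τ => Nat.pair 0 (Nat.pair σ.code τ.code) + 1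
  | .seq σ => Nat.pair 1 σ.code + 1

theorem Ty.code_injective : Function.Injective Ty.code := by
  intro σ
  induction σ with
  | nat => intro τ h; cases τ <;> simp [Ty.code] at h ⊢
  | arr a b ha hb =>
    intro τ h
    cases τ <;> simp [Ty.code] at h ⊢
    exact ⟨ha h.1, hb h.2⟩
  | seq a ha =>
    intro τ h
    cases τ <;> simp [Ty.code] at h ⊢
    exact ha h

instance : Countable Ty := Ty.code_injective.countable

def Var.code : {Γ : List Ty} → {σ : Ty} → Var Γ σ → ℕ
  | _, _, .zero => 0
  | _, _, .succ v => v.code + 1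

theorem Var.code_injective {Γ : List Ty} {σ : Ty} (v w : Var Γ σ) (h : v.code = w.code) :
    v = w := by
  induction v with
  | zero => cases w with
    | zero => rfl
    | succ w => simp [Var.code] at h
  | succ v ih => cases w with
    | zero => simp [Var.code] at h
    | succ w => simp only [Var.code, add_left_inj] at h; rw [ih w h]

/-- The types of any two different constants fail to unify, so a constant is determined by its type.
This is why `Tm.code` gives all constants the same number. -/
theorem Con.eq {σ : Ty} (c d : Con σ) : c = d := by
  cases c <;> cases d <;> rfl

/-- The type of an application does not show the type of its argument, so the code records it. -/
def Tm.code {Γ : List Ty} : {σ : Ty} → Tm Γ σ → ℕ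
  | _, .var v => Nat.pair 0 v.code
  | _, .con _ => Nat.pair 1 0
  | _, .app (σ := σ) f a => Nat.pair 2 (Nat.pair σ.code (Nat.pair f.code a.code))

theorem Tm.code_injective {Γ : List Ty} {σ : Ty} (t u : Tm Γ σ) (h : t.code = u.code) :
    t = u := by
  induction t with
  | var v => cases u with
    | var w => simp only [Tm.code, Nat.pair_eq_pair, true_and] at h; rw [Var.code_injective _ _ h]
    | con c => simp [Tm.code] at h
    | app f a => simp [Tm.code] at h
  | con c => cases u with
    | var w => simp [Tm.code] at h
    | con d => rw [Con.eq c d]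
    | app f a => simp [Tm.code] at h
  | app f a hf ha => cases u with
    | var w => simp [Tm.code] at h
    | con d => simp [Tm.code] at h
    | app g b =>
      simp only [Tm.code, Nat.pair_eq_pair, true_and] at h
      obtain ⟨h₁, h₂, h₃⟩ := h
      obtain rfl := Ty.code_injective h₁
      rw [hf g h₂, ha b h₃]

def Fm.code : {Γ : List Ty} → Fm Γ → ℕ
  | _, .bot => Nat.pair 0 0
  | _, .eq a b => Nat.pair 1 (Nat.pair a.code b.code)
  | _, .st (σ := σ) t => Nat.pair 2 (Nat.pair σ.code t.code)
  | _, .imp A B => Nat.pair 3 (Nat.pair A.code B.code)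
  | _, .all σ A => Nat.pair 4 (Nat.pair σ.code A.code)

theorem Fm.code_injective {Γ : List Ty} (A B : Fm Γ) (h : A.code = B.code) : A = B := by
  induction A with
  | bot => cases B <;> simp [Fm.code] at h ⊢
  | eq a b =>
    cases B <;> simp [Fm.code] at h ⊢
    exact ⟨Tm.code_injective _ _ h.1, Tm.code_injective _ _ h.2⟩
  | st t => cases B with
    | st u =>
      simp only [Fm.code, Nat.pair_eq_pair, true_and] at h
      obtain rfl := Ty.code_injective h.1
      rw [Tm.code_injective _ _ h.2]
    | _ => simp [Fm.code] at h
  | imp A₁ A₂ h₁ h₂ =>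
    cases B <;> simp [Fm.code] at h ⊢
    exact ⟨h₁ _ h.1, h₂ _ h.2⟩
  | all σ A hA => cases B with
    | all τ B =>
      simp only [Fm.code, Nat.pair_eq_pair, true_and] at h
      obtain rfl := Ty.code_injective h.1
      rw [hA _ h.2]
    | _ => simp [Fm.code] at h

instance {Γ : List Ty} : Countable (Fm Γ) :=
  Function.Injective.countable (f := Fm.code) fun A B => Fm.code_injective A B

instance {Γ : List Ty} : Inhabited (Fm Γ) := ⟨.bot⟩

instance : Inhabited Ty := ⟨.nat⟩

instance {Γ : List Ty} {σ : Ty} : Inhabited (Tm Γ σ) := ⟨defaultT σ⟩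

/-! ### Structures and satisfaction -/

/-- Structures for the language; `=₀` need not be interpreted as equality. -/
structure Str where
  D : Ty → Type
  app : ∀ {σ τ : Ty}, D (σ ⇒ₜ τ) → D σ → D τ
  con : ∀ {σ : Ty}, Con σ → D σ
  eq : D .nat → D .nat → Prop
  st : ∀ {σ : Ty}, D σ → Prop

abbrev Str.Env (M : Str) (Γ : List Ty) : Type := ∀ σ : Ty, Var Γ σ → M.D σ

namespace Str

variable {M : Str} {Γ Δ : List Ty} {σ τ ρ : Ty}

def nil : M.Env [] := fun _ v => nomatch v

def cons (a : M.D ρ) (e : M.Env Γ) : M.Env (ρ :: Γ)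
  | _, .zero => a
  | _, .succ v => e _ v

def eval (e : M.Env Γ) : {σ : Ty} → Tm Γ σ → M.D σ
  | _, .var v => e _ v
  | _, .con c => M.con c
  | _, .app f a => M.app (eval e f) (eval e a)

def Sat : {Γ : List Ty} → M.Env Γ → Fm Γ → Prop
  | _, _, .bot => False
  | _, e, .eq a b => M.eq (eval e a) (eval e b)
  | _, e, .st t => M.st (eval e t)
  | _, e, .imp A B => Sat e A → Sat e B
  | _, e, .all σ A => ∀ a : M.D σ, Sat (cons a e) A

theorem cons_comp_lift (r : Ren Γ Δ) (e : M.Env Δ) (a : M.D ρ) :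
    (fun τ v => cons a e τ (r.lift τ v)) = cons a (fun τ v => e τ (r τ v)) := by
  funext τ v; cases v <;> rfl

theorem eval_rename (r : Ren Γ Δ) (e : M.Env Δ) (t : Tm Γ σ) :
    eval e (t.rename r) = eval (fun τ v => e τ (r τ v)) t := by
  induction t with
  | var v => rfl
  | con c => rfl
  | app f a hf ha => simp only [Tm.rename, eval, hf, ha]

theorem eval_wk (e : M.Env Γ) (a : M.D ρ) (t : Tm Γ σ) : eval (cons a e) t.wk = eval e t :=
  eval_rename _ _ _

theorem eval_subst (s : Sub Γ Δ) (e : M.Env Δ) (t : Tm Γ σ) :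
    eval e (t.subst s) = eval (fun τ v => eval e (s τ v)) t := by
  induction t with
  | var v => rfl
  | con c => rfl
  | app f a hf ha => simp only [Tm.subst, eval, hf, ha]

theorem sat_rename (r : Ren Γ Δ) (e : M.Env Δ) (A : Fm Γ) :
    Sat e (A.rename r) ↔ Sat (fun τ v => e τ (r τ v)) A := by
  induction A generalizing Δ with
  | bot => rfl
  | eq a b => simp only [Fm.rename, Sat, eval_rename]
  | st t => simp only [Fm.rename, Sat, eval_rename]
  | imp A B hA hB => simp only [Fm.rename, Sat, hA, hB]
  | all τ A hA => simp only [Fm.rename, Sat, hA, cons_comp_lift]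

theorem eval_lift (s : Sub Γ Δ) (e : M.Env Δ) (a : M.D ρ) :
    (fun τ v => eval (cons a e) (s.lift τ v)) = cons a (fun τ v => eval e (s τ v)) := by
  funext τ v
  cases v with
  | zero => rfl
  | succ v => exact eval_wk _ _ _

theorem sat_subst (s : Sub Γ Δ) (e : M.Env Δ) (A : Fm Γ) :
    Sat e (A.subst s) ↔ Sat (fun τ v => eval e (s τ v)) A := by
  induction A generalizing Δ with
  | bot => rfl
  | eq a b => simp only [Fm.subst, Sat, eval_subst]
  | st t => simp only [Fm.subst, Sat, eval_subst]
  | imp A B hA hB => simp only [Fm.subst, Sat, hA, hB]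
  | all τ A hA => simp only [Fm.subst, Sat, hA, eval_lift]

theorem cons_eta (e : M.Env (ρ :: Γ)) : cons (e ρ .zero) (fun τ v => e τ v.succ) = e := by
  funext τ v; cases v <;> rfl

theorem env_nil (e : M.Env []) : e = nil := by
  funext τ v; nomatch v

theorem sat_close (A : Fm Γ) : Sat (M := M) nil (Fm.close Γ A) ↔ ∀ e : M.Env Γ, Sat e A := by
  induction Γ with
  | nil => exact ⟨fun h e => env_nil e ▸ h, fun h => h _⟩
  | cons σ Γ ih =>
    rw [Fm.close, ih]
    exact ⟨fun h e => cons_eta e ▸ h _ _, fun h e a => h _⟩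

end Str

/-! ### The term model -/

section Extension

variable {F : ℕ → Type} (step : ∀ n, F n → F (n + 1)) (dflt : ∀ n, F n)

/-- The sequence with value `x.2` at `x.1`, continued upwards by `step`. -/
def extend (x : Σ k, F k) : ∀ n, F n
  | 0 => if h : x.1 = 0 then h ▸ x.2 else dflt 0
  | n + 1 => if h : x.1 = n + 1 then h ▸ x.2 else step n (extend x n)

theorem extend_self (k : ℕ) (x : F k) : extend step dflt ⟨k, x⟩ k = x := by
  cases k <;> simp [extend]

theorem extend_succ (k : ℕ) (x : F k) (n : ℕ) (h : k ≤ n) :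
    extend step dflt ⟨k, x⟩ (n + 1) = step n (extend step dflt ⟨k, x⟩ n) := by
  rw [extend, dif_neg]; show k ≠ n + 1; omega

theorem extend_eq (d : ∀ n, F n) (k : ℕ) (hd : ∀ n ≥ k, d (n + 1) = step n (d n)) (n : ℕ)
    (h : k ≤ n) : extend step dflt ⟨k, d k⟩ n = d n := by
  induction n, h using Nat.le_induction with
  | base => exact extend_self _ _ _ _
  | succ n h ih => rw [extend_succ _ _ _ _ _ h, ih, hd n h]

/-- An enumeration of extended sequences in which each one occurs arbitrarily late. -/
theorem exists_extend_enum [∀ n, Countable (F n)] :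
    ∃ b : ℕ → ∀ n, F n, ∀ x : Σ k, F k, ∃ j, b j = extend step dflt x := by
  have : Nonempty (Σ k, F k) := ⟨⟨0, dflt 0⟩⟩
  obtain ⟨e, he⟩ := exists_surjective_nat (Σ k, F k)
  exact ⟨fun j => extend step dflt (e j), fun x => (he x).imp fun j hj => congrArg _ hj⟩

end Extension

/-! ### The Henkin construction in contexts that grow by one variable per stage -/

namespace Henkin

noncomputable def typeEnum : ℕ → Ty := (exists_surjective_nat Ty).choose

theorem typeEnum_surjective : Function.Surjective typeEnum := (exists_surjective_nat Ty).choose_spec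

/-- The type of the witness variable added at stage `n`. -/
noncomputable def ty (n : ℕ) : Ty := typeEnum n.unpair.1

noncomputable def ctx : ℕ → List Ty
  | 0 => []
  | n + 1 => ty n :: ctx n

noncomputable def up (n : ℕ) : Ren (ctx n) (ctx (n + 1)) := Ren.wk (ρ := ty n)

noncomputable def fmEnum : ℕ → ∀ n, Fm (ctx n) :=
  (exists_extend_enum (fun n (A : Fm (ctx n)) => A.rename (up n)) default).choose

theorem fmEnum_spec : ∀ x : Σ k, Fm (ctx k), ∃ j, fmEnum j = extend
    (fun n (A : Fm (ctx n)) => A.rename (up n)) default x :=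
  (exists_extend_enum (fun n (A : Fm (ctx n)) => A.rename (up n)) default).choose_spec

noncomputable def bodyEnum (σ : Ty) : ℕ → ∀ n, Fm (σ :: ctx n) :=
  (exists_extend_enum (fun n (A : Fm (σ :: ctx n)) =>
    A.rename (up n).lift) default).choose

theorem bodyEnum_spec (σ : Ty) : ∀ x : Σ k, Fm (σ :: ctx k), ∃ j, bodyEnum σ j = extend
    (fun n (A : Fm (σ :: ctx n)) => A.rename (up n).lift) default x :=
  (exists_extend_enum (fun n (A : Fm (σ :: ctx n)) =>
    A.rename (up n).lift) default).choose_spec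

/-- The formula that is decided at stage `n`. -/
noncomputable def decided (n : ℕ) : Fm (ctx n) := fmEnum n.unpair.1 n

/-- The formula with a Henkin axiom added at stage `n`. -/
noncomputable def body (n : ℕ) (σ : Ty) : Fm (σ :: ctx n) := bodyEnum σ n.unpair.2.unpair.1 n

/-- The enumeration reads only the first component of the stage number, so the second is free to
push the stage beyond `N`. -/
theorem exists_decided (d : ∀ n, Fm (ctx n)) (N : ℕ)
    (hd : ∀ n ≥ N, d (n + 1) = (d n).rename (up n)) : ∃ n ≥ N, decided n = d n := by
  obtain ⟨j, hj⟩ := fmEnum_spec ⟨N, d N⟩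
  refine ⟨Nat.pair j N, Nat.right_le_pair _ _, ?_⟩
  rw [decided, Nat.unpair_pair, hj]
  exact extend_eq _ _ d N hd _ (Nat.right_le_pair _ _)

theorem exists_body (σ : Ty) (d : ∀ n, Fm (σ :: ctx n)) (N : ℕ)
    (hd : ∀ n ≥ N, d (n + 1) = (d n).rename (up n).lift) :
    ∃ n ≥ N, ty n = σ ∧ body n σ = d n := by
  obtain ⟨j, hj⟩ := bodyEnum_spec σ ⟨N, d N⟩
  obtain ⟨a, ha⟩ := typeEnum_surjective σ
  have hN : N ≤ Nat.pair a (Nat.pair j N) :=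
    (Nat.right_le_pair _ _).trans (Nat.right_le_pair _ _)
  refine ⟨Nat.pair a (Nat.pair j N), hN, ?_, ?_⟩
  · rw [ty, Nat.unpair_pair, ha]
  · rw [body, Nat.unpair_pair, Nat.unpair_pair, hj]
    exact extend_eq _ _ d N hd _ hN

variable (T : Set (Fm []))

open Classical in
/-- The hypotheses added up to stage `n`, starting from the sentence `A`. -/
noncomputable def hyps (A : Fm []) : ∀ n, List (Fm (ctx n))
  | 0 => [A]
  | n + 1 =>
    let H : List (Fm (ty n :: ctx n)) :=
      (body n (ty n) ⇒ᶠ (Fm.all _ (body n (ty n))).wk) :: (hyps A n).map Fm.wk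
    if Consistent T ((decided n).wk :: H) then (decided n).wk :: H else (decided n).wk.neg :: H

variable {T} {A : Fm []}

theorem hyps_consistent (hA : Consistent T [A]) (n : ℕ) : Consistent T (hyps T A n) := by
  induction n with
  | zero => exact hA
  | succ n ih =>
    rw [hyps]
    split_ifs with h
    · exact h
    · exact (ih.henkin _).cons_neg h

theorem hyps_subset (n : ℕ) :
    (body n (ty n) ⇒ᶠ (Fm.all _ (body n (ty n))).wk) :: (hyps T A n).map Fm.wk ⊆
      hyps T A (n + 1) := by
  rw [hyps]; split_ifs <;> exact List.subset_cons_self _ _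

theorem derives_succ {n : ℕ} {B : Fm (ctx n)} (h : Derives T (hyps T A n) B) :
    Derives T (hyps T A (n + 1)) (B.rename (up n)) :=
  (h.rename (up n)).weaken (List.Subset.trans (List.subset_cons_self _ _) (hyps_subset n))

theorem henkin_mem (n : ℕ) :
    (body n (ty n) ⇒ᶠ (Fm.all _ (body n (ty n))).wk) ∈ hyps T A (n + 1) :=
  hyps_subset n List.mem_cons_self

theorem decided_mem (n : ℕ) : (decided n).rename (up n) ∈ hyps T A (n + 1) ∨
    ((decided n).rename (up n)).neg ∈ hyps T A (n + 1) := by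
  rw [hyps]; split_ifs
  · exact Or.inl List.mem_cons_self
  · exact Or.inr List.mem_cons_self

/-- `B` is eventually weakened from stage to stage. -/
def Coh (d : ∀ n, Fm (ctx n)) : Prop := ∃ N, ∀ n ≥ N, d (n + 1) = (d n).rename (up n)

variable (T A) in
/-- `d` is eventually derivable. -/
def Ev (d : ∀ n, Fm (ctx n)) : Prop := ∃ N, ∀ n ≥ N, Derives T (hyps T A n) (d n)

theorem Coh.ev {d : ∀ n, Fm (ctx n)} (N : ℕ)
    (hd : ∀ n ≥ N, d (n + 1) = (d n).rename (up n)) {m : ℕ} (hm : N ≤ m)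
    (h : Derives T (hyps T A m) (d m)) : Ev T A d := by
  refine ⟨m, fun n hn => ?_⟩
  induction n, hn using Nat.le_induction with
  | base => exact h
  | succ n hn ih => rw [hd n (hm.trans hn)]; exact derives_succ ih

/-- Some late stage puts `d` or its negation among the hypotheses, and derivability persists along
weakening. -/
theorem Coh.ev_or {d : ∀ n, Fm (ctx n)} (hd : Coh d) : Ev T A d ∨ Ev T A (fun n => (d n).neg) := by
  obtain ⟨N, hN⟩ := hd
  obtain ⟨n, hn, h⟩ := exists_decided d N hN
  refine (decided_mem (T := T) (A := A) n).imp (fun h' => ?_) (fun h' => ?_)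
  · refine Coh.ev N hN (m := n + 1) (by omega) (.hyp ?_)
    rwa [hN n hn, ← h]
  · refine Coh.ev (d := fun n => (d n).neg) N (fun n hn => by simp only [hN n hn]; rfl)
      (m := n + 1) (by omega) (.hyp ?_)
    rwa [hN n hn, ← h]

/-- Elements of the term model: eventually constant sequences of terms. -/
def Elt (σ : Ty) : Type :=
  {d : ∀ n, Tm (ctx n) σ // ∃ N, ∀ n ≥ N, d (n + 1) = (d n).rename (up n)}

variable (T A) in
/-- The term model. -/
def model : Str where
  D := Elt
  app f a := ⟨fun n => f.1 n ⬝ a.1 n, by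
    obtain ⟨N, hN⟩ := f.2
    obtain ⟨K, hK⟩ := a.2
    refine ⟨max N K, fun n hn => ?_⟩
    exact congrArg₂ Tm.app (hN n (by omega)) (hK n (by omega))⟩
  con c := ⟨fun n => .con c, 0, fun n _ => rfl⟩
  eq a b := Ev T A fun n => .eq (a.1 n) (b.1 n)
  st a := Ev T A fun n => .st (a.1 n)

variable {Γ : List Ty}

def envSub (e : (model T A).Env Γ) (n : ℕ) : Sub Γ (ctx n) := fun σ v => (e σ v).1 n

theorem eval_model (e : (model T A).Env Γ) {σ : Ty} (t : Tm Γ σ) (n : ℕ) :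
    (Str.eval e t).1 n = t.subst (envSub e n) := by
  induction t with
  | var v => rfl
  | con c => rfl
  | app f a hf ha => rw [Tm.subst, ← hf, ← ha]; rfl

theorem envSub_cons (e : (model T A).Env Γ) {σ : Ty} (a : (model T A).D σ) (n : ℕ) :
    envSub (Str.cons a e) n = Sub.cons (a.1 n) (envSub e n) := by
  funext τ v; cases v <;> rfl

theorem envSub_coh (e : (model T A).Env Γ) :
    ∃ N, ∀ n ≥ N, envSub e (n + 1) = fun σ v => (envSub e n σ v).rename (up n) := by
  induction Γ with
  | nil => exact ⟨0, fun n _ => by funext σ v; nomatch v⟩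
  | cons ρ Γ ih =>
    obtain ⟨N, hN⟩ := ih (fun τ v => e τ v.succ)
    obtain ⟨K, hK⟩ := (e ρ .zero).2
    refine ⟨max N K, fun n hn => ?_⟩
    funext τ v
    cases v with
    | zero => exact hK n (by omega)
    | succ v => exact congrFun (congrFun (hN n (by omega)) τ) v

theorem subst_envSub_coh (e : (model T A).Env Γ) (B : Fm Γ) :
    Coh fun n => B.subst (envSub e n) := by
  obtain ⟨N, hN⟩ := envSub_coh e
  refine ⟨N, fun n hn => ?_⟩
  simp only [hN n hn]
  exact (Fm.rename_subst _ _ _).symm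

theorem Ev.and {d d' d'' : ∀ n, Fm (ctx n)} (h : Ev T A d) (h' : Ev T A d')
    (H : ∀ n, Derives T (hyps T A n) (d n) → Derives T (hyps T A n) (d' n) →
      Derives T (hyps T A n) (d'' n)) : Ev T A d'' := by
  obtain ⟨N, hN⟩ := h
  obtain ⟨K, hK⟩ := h'
  exact ⟨max N K, fun n hn => H n (hN n (by omega)) (hK n (by omega))⟩

theorem Ev.mono {d d' : ∀ n, Fm (ctx n)} (h : Ev T A d)
    (H : ∀ n, Derives T (hyps T A n) (d n) → Derives T (hyps T A n) (d' n)) : Ev T A d' :=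
  h.and h fun n h _ => H n h

theorem not_ev_bot (hA : Consistent T [A]) : ¬ Ev T A fun _ => .bot :=
  fun ⟨N, hN⟩ => hyps_consistent hA N (hN N le_rfl)

/-- Truth in the term model is eventual derivability. -/
theorem sat_model (hA : Consistent T [A]) (e : (model T A).Env Γ) (B : Fm Γ) :
    Str.Sat e B ↔ Ev T A fun n => B.subst (envSub e n) := by
  induction B with
  | bot => exact ⟨False.elim, not_ev_bot hA⟩
  | eq a b => simp only [Str.Sat, Fm.subst, ← eval_model]; rfl
  | st t => simp only [Str.Sat, Fm.subst, ← eval_model]; rfl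
  | imp B C hB hC =>
    rw [Str.Sat, hB, hC]
    constructor
    · intro h
      -- Completeness of the limit theory is what turns the semantic implication into a derivable
      -- one.
      rcases (subst_envSub_coh e B).ev_or (T := T) (A := A) with h' | h'
      · exact (h h').mono fun n h => .impI h.tail
      · exact h'.mono fun n h => .impI (.falso (.impE h.tail .head))
    · exact fun h h' => h.and h' fun n => .impE
  | all σ B hB =>
    rw [Str.Sat]
    constructor
    · intro h
      obtain ⟨N, hN⟩ := envSub_coh e
      have hstep : ∀ n ≥ N, B.subst (envSub e (n + 1)).lift =
          (B.subst (envSub e n).lift).rename (up n).lift := by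
        intro n hn
        rw [hN n hn, Fm.rename_subst, Sub.ren_comp_lift]
      -- At stage `m` the Henkin axiom for this very body is added. The element `x` is its witness
      -- variable, weakened at all later stages; truth of the body at `x` then yields the universal
      -- formula.
      obtain ⟨m, hm, rfl, hb⟩ := exists_body σ (fun n => B.subst (envSub e n).lift) N hstep
      let x : (model T A).D (ty m) :=
        ⟨extend (fun n (t : Tm (ctx n) (ty m)) => t.rename (up n)) default
          ⟨m + 1, (v0 : Tm (ty m :: ctx m) (ty m))⟩, m + 1, fun n hn => extend_succ _ _ _ _ _ hn⟩
      obtain ⟨K, hK⟩ := (hB _).1 (h x)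
      have key : ∀ n ≥ m + 1, Derives T (hyps T A n) (B.subst (envSub (Str.cons x e) n)) →
          Derives T (hyps T A n) ((Fm.all (ty m) B).subst (envSub e n)) := by
        intro n hn h'
        have hx : ∀ n ≥ m + 1, Derives T (hyps T A n)
            (B.subst (envSub (Str.cons x e) n) ⇒ᶠ (Fm.all (ty m) B).subst (envSub e n)) := by
          intro n hn
          induction n, hn using Nat.le_induction with
          | base =>
            have h₀ := Derives.hyp (T := T) (henkin_mem (T := T) (A := A) m)
            rw [hb] at h₀
            have h₁ : B.subst (envSub (Str.cons x e) (m + 1)) = B.subst (envSub e m).lift := by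
              rw [envSub_cons, hN m hm, show x.1 (m + 1) = _ from extend_self _ _ _ _]; rfl
            have h₂ : (Fm.all (ty m) B).subst (envSub e (m + 1)) =
                ((Fm.all (ty m) B).subst (envSub e m)).rename (up m) := by
              rw [hN m hm, Fm.rename_subst]
            rw [h₁, h₂]
            exact h₀
          | succ n hn ih =>
            have h₀ := derives_succ ih
            have h₁ : B.subst (envSub (Str.cons x e) (n + 1)) =
                (B.subst (envSub (Str.cons x e) n)).rename (up n) := by
              rw [envSub_cons, envSub_cons, hN n (by omega), Fm.rename_subst,
                show x.1 (n + 1) = (x.1 n).rename (up n) from extend_succ _ _ _ _ _ hn]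
              congr 1
              funext τ v
              cases v <;> rfl
            have h₂ : (Fm.all (ty m) B).subst (envSub e (n + 1)) =
                ((Fm.all (ty m) B).subst (envSub e n)).rename (up n) := by
              rw [hN n (by omega), Fm.rename_subst]
            rw [h₁, h₂]
            exact h₀
        exact .impE (hx n hn) h'
      exact ⟨max (m + 1) K, fun n hn => key n (by omega) (hK n (by omega))⟩
    · intro h a
      rw [hB]
      refine h.mono fun n h => ?_
      rw [envSub_cons, ← Fm.inst_subst_lift]
      exact .allE _ h

end Henkin

/-- Completeness: a sentence that holds in all structures satisfying `T` is provable from `T`. -/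
theorem proves_of_forall_sat {T : Set (Fm [])} {A : Fm []}
    (h : ∀ M : Str, (∀ B ∈ T, Str.Sat (M := M) Str.nil B) → Str.Sat (M := M) Str.nil A) :
    Proves T A := by
  refine .raa (by_contra fun hc => ?_)
  have hA : Consistent T [A.neg] := hc
  refine (Henkin.sat_model hA Str.nil A.neg).2 ⟨0, fun n _ => ?_⟩
    (h (Henkin.model T A.neg) fun B hB => ?_)
  · have key : ∀ n, ∀ s : Sub [] (Henkin.ctx n),
        Derives T (Henkin.hyps T A.neg n) (A.neg.subst s) := by
      intro n
      induction n with
      | zero =>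
        intro (s : Sub [] [])
        have hs : s = Sub.id := by funext τ v; cases v
        show Derives T [A.neg] (A.neg.subst s)
        rw [hs, Fm.subst_id]
        exact .head
      | succ n ih =>
        intro s
        have := Henkin.derives_succ (ih (fun τ v => nomatch v))
        rw [Fm.rename_subst] at this
        convert this using 2
        funext τ v; nomatch v
    exact key n _
  · refine (Henkin.sat_model hA Str.nil B).2 ⟨0, fun n _ => ?_⟩
    have := Derives.ax (H := Henkin.hyps T A.neg n) hB
    rw [Fm.rename_eq_subst] at this
    convert this using 2
    funext τ v; nomatch v

namespace Str

variable {M : Str} {Γ Δ : List Ty} {σ τ ρ : Ty}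

/-! ### Evaluation of the defined syntax -/

@[simp] theorem eval_v0 (e : M.Env Γ) (a : M.D σ) : eval (cons a e) v0 = a := rfl
@[simp] theorem eval_v1 (e : M.Env Γ) (a : M.D σ) (b : M.D τ) :
    eval (cons a (cons b e)) v1 = b := rfl
@[simp] theorem eval_v2 (e : M.Env Γ) (a : M.D σ) (b : M.D τ) (c : M.D ρ) :
    eval (cons a (cons b (cons c e))) v2 = c := rfl
@[simp] theorem eval_v3 (e : M.Env Γ) {π : Ty} (a : M.D σ) (b : M.D τ) (c : M.D ρ) (d : M.D π) :
    eval (cons a (cons b (cons c (cons d e)))) v3 = d := rfl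
@[simp] theorem eval_app (e : M.Env Γ) (f : Tm Γ (σ ⇒ₜ τ)) (a : Tm Γ σ) :
    eval e (f ⬝ a) = M.app (eval e f) (eval e a) := rfl
@[simp] theorem eval_con (e : M.Env Γ) (c : Con σ) : eval e (Tm.con c) = M.con c := rfl
theorem eval_var (e : M.Env Γ) (v : Var Γ σ) : eval e (Tm.var v) = e σ v := rfl
@[simp] theorem cons_zero (e : M.Env Γ) (a : M.D σ) : cons a e σ .zero = a := rfl
@[simp] theorem cons_succ (e : M.Env Γ) (a : M.D ρ) (v : Var Γ σ) : cons a e σ v.succ = e σ v := rfl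
attribute [simp] eval_wk eval_var

@[simp] theorem sat_bot (e : M.Env Γ) : Sat e .bot ↔ False := Iff.rfl
@[simp] theorem sat_eq (e : M.Env Γ) (s t : Tm Γ .nat) :
    Sat e (.eq s t) ↔ M.eq (eval e s) (eval e t) := Iff.rfl
@[simp] theorem sat_st (e : M.Env Γ) (t : Tm Γ σ) : Sat e (.st t) ↔ M.st (eval e t) := Iff.rfl
@[simp] theorem sat_imp (e : M.Env Γ) (A B : Fm Γ) : Sat e (A ⇒ᶠ B) ↔ (Sat e A → Sat e B) := Iff.rfl
@[simp] theorem sat_all (e : M.Env Γ) (A : Fm (σ :: Γ)) :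
    Sat e (.all σ A) ↔ ∀ a : M.D σ, Sat (cons a e) A := Iff.rfl
@[simp] theorem sat_neg (e : M.Env Γ) (A : Fm Γ) : Sat e A.neg ↔ ¬ Sat e A := Iff.rfl
@[simp] theorem sat_and (e : M.Env Γ) (A B : Fm Γ) : Sat e (A ∧ᶠ B) ↔ Sat e A ∧ Sat e B := by
  simp [Fm.and]
@[simp] theorem sat_iff (e : M.Env Γ) (A B : Fm Γ) : Sat e (A ⇔ᶠ B) ↔ (Sat e A ↔ Sat e B) := by
  simp [Fm.iff, iff_def]
@[simp] theorem sat_ex (e : M.Env Γ) (A : Fm (σ :: Γ)) :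
    Sat e (.ex σ A) ↔ ∃ a : M.D σ, Sat (cons a e) A := by
  simp [Fm.ex]
@[simp] theorem sat_allSt (e : M.Env Γ) (A : Fm (σ :: Γ)) :
    Sat e (.allSt σ A) ↔ ∀ a : M.D σ, M.st a → Sat (cons a e) A := Iff.rfl
@[simp] theorem sat_exSt (e : M.Env Γ) (A : Fm (σ :: Γ)) :
    Sat e (.exSt σ A) ↔ ∃ a : M.D σ, M.st a ∧ Sat (cons a e) A := by
  simp [Fm.exSt]

theorem eval_cons_subst (s : Sub Γ Δ) (e : M.Env Δ) (t : Tm Δ ρ) :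
    (fun τ v => eval e (Sub.cons t s τ v)) = cons (eval e t) (fun τ v => eval e (s τ v)) := by
  funext τ v; cases v <;> rfl

@[simp] theorem sat_inst (e : M.Env Γ) (t : Tm Γ ρ) (A : Fm (ρ :: Γ)) :
    Sat e (A.inst t) ↔ Sat (cons (eval e t) e) A := by
  rw [Fm.inst, sat_subst, eval_cons_subst]; rfl

theorem eval_empty (e : M.Env Γ) (t : Tm [] σ) : eval e (t.rename Ren.empty) = eval nil t := by
  rw [eval_rename]; congr 1; funext τ v; nomatch v

/-! ### Extensional equality -/

def sub (M : Str) (a b : M.D .nat) : M.D .nat := M.app (M.app (eval nil subC) a) b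

@[simp] theorem eval_subT (e : M.Env Γ) (s t : Tm Γ .nat) :
    eval e (subT s t) = M.sub (eval e s) (eval e t) := by
  have : eval e (subC (Γ := Γ)) = eval nil subC := eval_empty e subC
  simp [subT, sub, this]

/-- The interpretation of `=_σ`. -/
def E (M : Str) : (σ : Ty) → M.D σ → M.D σ → Prop
  | .nat, a, b => M.eq a b
  | .arr σ τ, f, g => ∀ a : M.D σ, M.E τ (M.app f a) (M.app g a)
  | .seq σ, s, t => M.eq (M.app (M.con (.len σ)) s) (M.app (M.con (.len σ)) t) ∧
      ∀ i : M.D .nat, M.eq (M.sub (M.app (M.con .succ) i) (M.app (M.con (.len σ)) s))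
        (M.con .zero) →
        M.E σ (M.app (M.app (M.con (.get σ)) s) i) (M.app (M.app (M.con (.get σ)) t) i)

@[simp] theorem sat_eqT (e : M.Env Γ) (s t : Tm Γ σ) :
    Sat e (eqT σ s t) ↔ M.E σ (eval e s) (eval e t) := by
  induction σ generalizing Γ with
  | nat => rfl
  | arr σ τ _ ih => simp [eqT, E, ih]
  | seq σ ih => simp [eqT, E, ih, ltN, leN, lenT, getT, succT, zeroT]

/-- `M` satisfies the axioms of `P₀`. -/
def IsP0 (M : Str) : Prop := ∀ (Γ : List Ty) (B : Fm Γ), P0Axiom Γ B → ∀ e : M.Env Γ, Sat e B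

theorem isP0_iff : M.IsP0 ↔ ∀ B ∈ P0, Sat (M := M) nil B := by
  constructor
  · rintro h _ ⟨Γ, B, hB, rfl⟩
    exact (sat_close B).2 (h Γ B hB)
  · exact fun h Γ B hB => (sat_close B).1 (h _ ⟨Γ, B, hB, rfl⟩)

namespace IsP0

theorem eq_refl (h : M.IsP0) (a : M.D .nat) : M.eq a a :=
  h _ _ (.eq_refl v0) (cons a nil)

theorem eq_symm (h : M.IsP0) {a b : M.D .nat} : M.eq a b → M.eq b a :=
  h _ _ (.eq_symm v0 v1) (cons a (cons b nil))

theorem eq_trans (h : M.IsP0) {a b c : M.D .nat} : M.eq a b → M.eq b c → M.eq a c :=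
  h _ _ (.eq_trans v0 v1 v2) (cons a (cons b (cons c nil)))

/-- This is the extensionality axiom. Congruence in the function place is the definition of `E` at
arrow types; together they let application descend to the quotient. -/
theorem congr_arg (h : M.IsP0) (f : M.D (σ ⇒ₜ τ)) {a b : M.D σ} (hab : M.E σ a b) :
    M.E τ (M.app f a) (M.app f b) := by
  have := h _ _ (.extensionality σ τ v0 v1 v2) (cons a (cons b (cons f nil)))
  simp only [sat_imp, sat_eqT, eval_app, eval_v0, eval_v1, eval_v2] at this
  exact this hab

theorem sub_congr (h : M.IsP0) (a : M.D .nat) {b c : M.D .nat} (hbc : M.eq b c) :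
    M.eq (M.sub a b) (M.sub a c) :=
  h.congr_arg (τ := .nat) _ hbc

theorem e_refl (h : M.IsP0) (a : M.D σ) : M.E σ a a := by
  induction σ with
  | nat => exact h.eq_refl a
  | arr σ τ _ ih => exact fun x => ih _
  | seq σ ih => exact ⟨h.eq_refl _, fun i _ => ih _⟩

theorem e_symm (h : M.IsP0) {a b : M.D σ} (hab : M.E σ a b) : M.E σ b a := by
  induction σ with
  | nat => exact h.eq_symm hab
  | arr σ τ _ ih => exact fun x => ih (hab x)
  | seq σ ih =>
    -- The bound on `i` refers to the length of the other sequence, and is carried over along the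
    -- equality of lengths.
    exact ⟨h.eq_symm hab.1, fun i hi => ih (hab.2 i (h.eq_trans (h.sub_congr _ hab.1) hi))⟩

theorem e_trans (h : M.IsP0) {a b c : M.D σ} (hab : M.E σ a b) (hbc : M.E σ b c) :
    M.E σ a c := by
  induction σ with
  | nat => exact h.eq_trans hab hbc
  | arr σ τ _ ih => exact fun x => ih (hab x) (hbc x)
  | seq σ ih =>
    exact ⟨h.eq_trans hab.1 hbc.1, fun i hi => ih (hab.2 i hi)
      (hbc.2 i (h.eq_trans (h.sub_congr _ (h.eq_symm hab.1)) hi))⟩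

theorem st_congr (h : M.IsP0) {a b : M.D σ} (hab : M.E σ a b) (ha : M.st a) : M.st b := by
  have := h _ _ (.st_eq σ v0 v1) (cons a (cons b nil))
  simp only [sat_imp, sat_eqT, sat_st, eval_v0, eval_v1] at this
  exact this ha hab

/-! ### The quotient by extensional equality -/

def setoid (h : M.IsP0) (σ : Ty) : Setoid (M.D σ) := ⟨M.E σ, h.e_refl, h.e_symm, h.e_trans⟩

def quot (h : M.IsP0) : Str where
  D σ := Quotient (h.setoid σ)
  app {σ τ} := Quotient.map₂ (sa := h.setoid (σ ⇒ₜ τ)) (sb := h.setoid σ) (sc := h.setoid τ)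
    (fun f a => M.app f a) fun f _ hfg _ b hab => h.e_trans (h.congr_arg f hab) (hfg b)
  con c := Quotient.mk _ (M.con c)
  eq a b := a = b
  st {σ} a := Quotient.lift (s := h.setoid σ) (fun a => M.st a)
    (fun _ _ hab => propext ⟨h.st_congr hab, h.st_congr (h.e_symm hab)⟩) a

def mk (h : M.IsP0) (a : M.D σ) : h.quot.D σ := Quotient.mk (h.setoid σ) a

theorem mk_surj (h : M.IsP0) (a : h.quot.D σ) : ∃ b, h.mk b = a := Quotient.exists_rep a

theorem mk_eq (h : M.IsP0) {a b : M.D σ} : h.mk a = h.mk b ↔ M.E σ a b :=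
  Quotient.eq (r := h.setoid σ)

theorem eval_quot (h : M.IsP0) (e : M.Env Γ) (t : Tm Γ σ) :
    eval (M := h.quot) (fun τ v => h.mk (e τ v)) t = h.mk (eval e t) := by
  induction t with
  | var v => rfl
  | con c => rfl
  | app f a hf ha => rw [eval_app, hf, ha]; rfl

theorem cons_quot (h : M.IsP0) (e : M.Env Γ) (a : M.D σ) :
    cons (h.mk a) (fun τ v => h.mk (e τ v)) = fun τ v => h.mk (cons a e τ v) := by
  funext τ v; cases v <;> rfl

theorem sat_quot (h : M.IsP0) (e : M.Env Γ) (A : Fm Γ) :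
    Sat (M := h.quot) (fun τ v => h.mk (e τ v)) A ↔ Sat e A := by
  induction A with
  | bot => rfl
  | eq s t => rw [sat_eq, eval_quot, eval_quot]; exact h.mk_eq
  | st t => rw [sat_st, eval_quot]; rfl
  | imp A B hA hB => rw [sat_imp, hA, hB]; rfl
  | all σ A hA =>
    rw [sat_all, sat_all]
    constructor
    · intro H a
      rw [← hA, ← cons_quot]; exact H _
    · intro H a
      obtain ⟨b, rfl⟩ := h.mk_surj a
      rw [cons_quot, hA]; exact H b

theorem env_surj (h : M.IsP0) (e : h.quot.Env Γ) :
    ∃ e' : M.Env Γ, e = fun τ v => h.mk (e' τ v) :=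
  ⟨fun τ v => (h.mk_surj (e τ v)).choose,
    funext fun τ => funext fun v => (h.mk_surj (e τ v)).choose_spec.symm⟩

/-- `E` is defined by the formula `eqT` in both structures, and the quotient map preserves truth, so
no induction on types is needed. -/
theorem e_quot (h : M.IsP0) (a b : h.quot.D σ) : h.quot.E σ a b ↔ a = b := by
  obtain ⟨a, rfl⟩ := h.mk_surj a
  obtain ⟨b, rfl⟩ := h.mk_surj b
  rw [h.mk_eq]
  have := h.sat_quot (cons a (cons b nil)) (eqT σ v0 v1)
  rwa [sat_eqT, sat_eqT, eval_quot, eval_quot] at this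

end IsP0

end Str

/-- Models of `P₀` in which extensional equality is equality. -/
structure P0Model extends Str where
  e_iff : ∀ {σ : Ty} (a b : D σ), toStr.E σ a b ↔ a = b
  isP0 : toStr.IsP0

/-- Completeness with respect to extensional models of `P₀`. -/
theorem proves_of_forall_model {T : Set (Fm [])} (hT : P0 ⊆ T) {A : Fm []}
    (h : ∀ M : P0Model, (∀ B ∈ T, Str.Sat (M := M.toStr) Str.nil B) →
      Str.Sat (M := M.toStr) Str.nil A) : Proves T A := by
  refine proves_of_forall_sat fun M hM => ?_
  have hP : M.IsP0 := Str.isP0_iff.2 fun B hB => hM B (hT hB)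
  have key : ∀ B, Str.Sat (M := hP.quot) Str.nil B ↔ Str.Sat (M := M) Str.nil B := fun B => by
    rw [← hP.sat_quot]
    exact iff_of_eq (congrArg (fun e => Str.Sat e B) (Str.env_nil _).symm)
  refine (key A).1 (h ⟨hP.quot, hP.e_quot, fun Γ B hB e => ?_⟩ fun B hB => (key B).2 (hM B hB))
  obtain ⟨e, rfl⟩ := hP.env_surj e
  exact (hP.sat_quot e B).2 (hP Γ B hB e)

/-! ### The ordered field of fractions of an ordered semiring -/

/-- Formal fractions `(p - m) / d`. -/
structure PreFrac (N : Type) [CommSemiring N] [LinearOrder N] where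
  p : N
  m : N
  d : N
  pos : 0 < d

namespace PreFrac

variable {N : Type} [CommSemiring N] [LinearOrder N] [IsStrictOrderedRing N]

def Rel (x y : PreFrac N) : Prop := x.p * y.d + y.m * x.d = y.p * x.d + x.m * y.d

def Le (x y : PreFrac N) : Prop := x.p * y.d + y.m * x.d ≤ y.p * x.d + x.m * y.d

/-- Bring both inequalities to the common denominator and add them: the terms of `y` occur on both
sides and cancel, and so does the positive factor `y.d`. -/
theorem Le.trans {x y z : PreFrac N} (h : Le x y) (h' : Le y z) : Le x z := by
  unfold Le at *
  have h₁ := mul_le_mul_of_nonneg_right h z.pos.le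
  have h₂ := mul_le_mul_of_nonneg_right h' x.pos.le
  refine le_of_mul_le_mul_right (a := y.d) ?_ y.pos
  refine le_of_add_le_add_right (a := y.m * x.d * z.d + y.p * x.d * z.d) ?_
  calc _ = (x.p * y.d + y.m * x.d) * z.d + (y.p * z.d + z.m * y.d) * x.d := by ring
    _ ≤ _ := add_le_add h₁ h₂
    _ = _ := by ring

omit [IsStrictOrderedRing N] in
theorem rel_iff (x y : PreFrac N) : Rel x y ↔ Le x y ∧ Le y x := by
  exact le_antisymm_iff

instance setoid : Setoid (PreFrac N) where
  r := Rel
  iseqv :=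
    { refl := fun x => (add_comm _ _).trans (add_comm _ _)
      symm := fun {x y} h => by rw [rel_iff] at *; exact h.symm
      trans := fun {x y z} h h' => by
        rw [rel_iff] at *; exact ⟨h.1.trans h'.1, h'.2.trans h.2⟩ }

end PreFrac

/-- Fractions of an ordered semiring. -/
def Frac (N : Type) [CommSemiring N] [LinearOrder N] [IsStrictOrderedRing N] : Type :=
  Quotient (PreFrac.setoid (N := N))

namespace Frac

variable {N : Type} [CommSemiring N] [LinearOrder N] [IsStrictOrderedRing N]

def mk (x : PreFrac N) : Frac N := Quotient.mk _ x

theorem sound {x y : PreFrac N} (h : x.p * y.d + y.m * x.d = y.p * x.d + x.m * y.d) :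
    mk x = mk y := Quotient.sound h

theorem exact {x y : PreFrac N} (h : mk x = mk y) : PreFrac.Rel x y := Quotient.exact h

theorem ind {P : Frac N → Prop} (h : ∀ x, P (mk x)) (x : Frac N) : P x := Quotient.ind h x

instance : Zero (Frac N) := ⟨mk ⟨0, 0, 1, one_pos⟩⟩
instance : One (Frac N) := ⟨mk ⟨1, 0, 1, one_pos⟩⟩

instance : Neg (Frac N) := ⟨Quotient.map (fun x => ⟨x.m, x.p, x.d, x.pos⟩) fun x y h => by
  change x.m * y.d + y.p * x.d = y.m * x.d + x.p * y.d
  have h : x.p * y.d + y.m * x.d = y.p * x.d + x.m * y.d := h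
  rw [add_comm, ← h, add_comm]⟩

instance : Add (Frac N) := ⟨Quotient.map₂
  (fun x y => ⟨x.p * y.d + y.p * x.d, x.m * y.d + y.m * x.d, x.d * y.d, mul_pos x.pos y.pos⟩)
  fun x x' h y y' k => by
    have h : x.p * x'.d + x'.m * x.d = x'.p * x.d + x.m * x'.d := h
    have k : y.p * y'.d + y'.m * y.d = y'.p * y.d + y.m * y'.d := k
    change (x.p * y.d + y.p * x.d) * (x'.d * y'.d) + (x'.m * y'.d + y'.m * x'.d) * (x.d * y.d) =
      (x'.p * y'.d + y'.p * x'.d) * (x.d * y.d) + (x.m * y.d + y.m * x.d) * (x'.d * y'.d)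
    calc _ = (x.p * x'.d + x'.m * x.d) * (y.d * y'.d) + (y.p * y'.d + y'.m * y.d) * (x.d * x'.d) := by
          ring
      _ = (x'.p * x.d + x.m * x'.d) * (y.d * y'.d) + (y'.p * y.d + y.m * y'.d) * (x.d * x'.d) := by
          rw [h, k]
      _ = _ := by ring⟩

instance : Mul (Frac N) := ⟨Quotient.map₂
  (fun x y => ⟨x.p * y.p + x.m * y.m, x.p * y.m + x.m * y.p, x.d * y.d, mul_pos x.pos y.pos⟩)
  fun x x' h y y' k => by
    have h : x.p * x'.d + x'.m * x.d = x'.p * x.d + x.m * x'.d := h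
    have k : y.p * y'.d + y'.m * y.d = y'.p * y.d + y.m * y'.d := k
    -- Replacing one factor at a time keeps each identity linear in its hypothesis.
    refine Setoid.trans
      (b := ⟨x'.p * y.p + x'.m * y.m, x'.p * y.m + x'.m * y.p, x'.d * y.d, mul_pos x'.pos y.pos⟩) ?_ ?_
    · change (x.p * y.p + x.m * y.m) * (x'.d * y.d) + (x'.p * y.m + x'.m * y.p) * (x.d * y.d) =
        (x'.p * y.p + x'.m * y.m) * (x.d * y.d) + (x.p * y.m + x.m * y.p) * (x'.d * y.d)
      calc _ = (x.p * x'.d + x'.m * x.d) * (y.p * y.d) + (x'.p * x.d + x.m * x'.d) * (y.m * y.d) := by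
            ring
        _ = (x'.p * x.d + x.m * x'.d) * (y.p * y.d) + (x.p * x'.d + x'.m * x.d) * (y.m * y.d) := by
            rw [h]
        _ = _ := by ring
    · change (x'.p * y.p + x'.m * y.m) * (x'.d * y'.d) + (x'.p * y'.m + x'.m * y'.p) * (x'.d * y.d) =
        (x'.p * y'.p + x'.m * y'.m) * (x'.d * y.d) + (x'.p * y.m + x'.m * y.p) * (x'.d * y'.d)
      calc _ = (y.p * y'.d + y'.m * y.d) * (x'.p * x'.d) + (y'.p * y.d + y.m * y'.d) * (x'.m * x'.d) := by
            ring
        _ = (y'.p * y.d + y.m * y'.d) * (x'.p * x'.d) + (y.p * y'.d + y'.m * y.d) * (x'.m * x'.d) := by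
            rw [k]
        _ = _ := by ring⟩

theorem neg_mk (x : PreFrac N) : -mk x = mk ⟨x.m, x.p, x.d, x.pos⟩ := rfl
theorem add_mk (x y : PreFrac N) : mk x + mk y =
    mk ⟨x.p * y.d + y.p * x.d, x.m * y.d + y.m * x.d, x.d * y.d, mul_pos x.pos y.pos⟩ := rfl
theorem mul_mk (x y : PreFrac N) : mk x * mk y =
    mk ⟨x.p * y.p + x.m * y.m, x.p * y.m + x.m * y.p, x.d * y.d, mul_pos x.pos y.pos⟩ := rfl
theorem zero_def : (0 : Frac N) = mk ⟨0, 0, 1, one_pos⟩ := rfl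
theorem one_def : (1 : Frac N) = mk ⟨1, 0, 1, one_pos⟩ := rfl

instance : CommRing (Frac N) where
  add_assoc x y z := by
    induction x using ind; induction y using ind; induction z using ind
    simp only [add_mk]; exact sound (by ring)
  zero_add x := by induction x using ind; rw [zero_def, add_mk]; exact sound (by ring)
  add_zero x := by induction x using ind; rw [zero_def, add_mk]; exact sound (by ring)
  add_comm x y := by
    induction x using ind; induction y using ind
    simp only [add_mk]; exact sound (by ring)
  left_distrib x y z := by
    induction x using ind; induction y using ind; induction z using ind
    simp only [add_mk, mul_mk]; exact sound (by ring)
  right_distrib x y z := by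
    induction x using ind; induction y using ind; induction z using ind
    simp only [add_mk, mul_mk]; exact sound (by ring)
  zero_mul x := by induction x using ind; simp only [zero_def, mul_mk]; exact sound (by ring)
  mul_zero x := by induction x using ind; simp only [zero_def, mul_mk]; exact sound (by ring)
  mul_assoc x y z := by
    induction x using ind; induction y using ind; induction z using ind
    simp only [mul_mk]; exact sound (by ring)
  one_mul x := by induction x using ind; simp only [one_def, mul_mk]; exact sound (by ring)
  mul_one x := by induction x using ind; simp only [one_def, mul_mk]; exact sound (by ring)
  mul_comm x y := by
    induction x using ind; induction y using ind
    simp only [mul_mk]; exact sound (by ring)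
  neg_add_cancel x := by
    induction x using ind; simp only [neg_mk, add_mk, zero_def]; exact sound (by ring)
  nsmul := nsmulRec
  zsmul := zsmulRec

instance : LE (Frac N) := ⟨Quotient.lift₂ PreFrac.Le fun x y x' y' h k => by
  have h := (PreFrac.rel_iff _ _).1 h
  have k := (PreFrac.rel_iff _ _).1 k
  exact propext ⟨fun H => (h.2.trans H).trans k.1, fun H => (h.1.trans H).trans k.2⟩⟩

theorem le_mk {x y : PreFrac N} : mk x ≤ mk y ↔ x.p * y.d + y.m * x.d ≤ y.p * x.d + x.m * y.d :=
  Iff.rfl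

noncomputable instance : LinearOrder (Frac N) where
  le_refl x := by induction x using ind; rw [le_mk, add_comm]
  le_trans x y z := by
    induction x using ind; induction y using ind; induction z using ind
    exact PreFrac.Le.trans
  le_antisymm x y := by
    induction x using ind; induction y using ind
    exact fun h k => Quotient.sound ((PreFrac.rel_iff _ _).2 ⟨h, k⟩)
  le_total x y := by
    induction x using ind; induction y using ind
    exact le_total (α := N) _ _
  toDecidableLE := Classical.decRel _

instance : IsOrderedAddMonoid (Frac N) where
  add_le_add_left x y h z := by
    induction x using ind; induction y using ind; induction z using ind
    rename_i x y z
    rw [add_mk, add_mk, le_mk]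
    rw [le_mk] at h
    have h := add_le_add_left (mul_le_mul_of_nonneg_right h (mul_pos z.pos z.pos).le)
      ((z.p + z.m) * z.d * x.d * y.d)
    calc _ = _ := by ring
      _ ≤ _ := h
      _ = _ := by ring

instance : ZeroLEOneClass (Frac N) := ⟨by rw [zero_def, one_def, le_mk]; simp⟩

instance : Nontrivial (Frac N) := ⟨0, 1, fun h => by
  have := exact h
  simp [PreFrac.Rel] at this⟩

instance [ExistsAddOfLE N] : IsStrictOrderedRing (Frac N) := by
  refine IsStrictOrderedRing.of_mul_pos fun x y => ?_
  induction x using ind; induction y using ind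
  rename_i x y
  rw [← not_le, ← not_le, ← not_le, zero_def, le_mk, le_mk, mul_mk, le_mk]
  simp only [mul_one, zero_mul, add_zero, zero_add, not_le]
  intro h k
  -- Positive numerators `p - m` become elements `a`, `b` of the semiring; after expansion the two
  -- sides of the product differ by exactly `a * b`.
  obtain ⟨a, ha⟩ := exists_add_of_le h.le
  obtain ⟨b, hb⟩ := exists_add_of_le k.le
  have ha0 : 0 < a := by rw [ha] at h; exact (lt_add_iff_pos_right _).1 h
  have hb0 : 0 < b := by rw [hb] at k; exact (lt_add_iff_pos_right _).1 k
  rw [ha, hb]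
  calc _ < x.m * y.m + (x.m * b) + x.m * y.m + a * y.m + a * b := by
        rw [show (x.m + a) * y.m + x.m * (y.m + b) =
          x.m * y.m + (x.m * b) + x.m * y.m + a * y.m by ring]
        exact lt_add_of_pos_right _ (mul_pos ha0 hb0)
    _ = _ := by ring

/-- The embedding of the semiring. -/
def of : N →+* Frac N where
  toFun a := mk ⟨a, 0, 1, one_pos⟩
  map_zero' := rfl
  map_one' := rfl
  map_add' a b := by rw [add_mk]; exact sound (by ring)
  map_mul' a b := by rw [mul_mk]; exact sound (by ring)

theorem of_le_of {a b : N} : of a ≤ of b ↔ a ≤ b := by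
  show mk _ ≤ mk _ ↔ _
  rw [le_mk]; simp

/-- A nonzero numerator `p - m` is `a` or `-a` for some positive `a` in the semiring, so `± d / a`
is again a legitimate fraction. -/
theorem isField [ExistsAddOfLE N] : IsField (Frac N) where
  exists_pair_ne := exists_pair_ne _
  mul_comm := mul_comm
  mul_inv_cancel {x} hx := by
    induction x using ind with | h x => ?_
    have hne : x.p ≠ x.m := fun h => hx (by
      rw [zero_def]; exact sound (by rw [h]; ring))
    rcases hne.lt_or_gt with h | h
    · obtain ⟨a, ha⟩ := exists_add_of_le h.le
      have ha0 : 0 < a := by rw [ha] at h; exact (lt_add_iff_pos_right _).1 h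
      refine ⟨mk ⟨0, x.d, a, ha0⟩, ?_⟩
      rw [mul_mk, one_def]; exact sound (by simp only [ha]; ring)
    · obtain ⟨a, ha⟩ := exists_add_of_le h.le
      have ha0 : 0 < a := by rw [ha] at h; exact (lt_add_iff_pos_right _).1 h
      refine ⟨mk ⟨x.d, 0, a, ha0⟩, ?_⟩
      rw [mul_mk, one_def]; exact sound (by simp only [ha]; ring)

noncomputable instance [ExistsAddOfLE N] : Field (Frac N) := isField.toField

end Frac

infixl:100 " ⋆ " => Str.app _

namespace P0Model

open Str

variable {M : P0Model} {Γ : List Ty} {σ τ ρ : Ty}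

/-! ### Combinators, recursion, and induction in a model -/

@[simp] theorem eq_iff (a b : M.D .nat) : M.eq a b ↔ a = b := M.e_iff (σ := .nat) a b

theorem ext {f g : M.D (σ ⇒ₜ τ)} (h : ∀ x, f ⋆ x = g ⋆ x) : f = g :=
  (M.e_iff f g).1 fun x => (M.e_iff _ _).2 (h x)

theorem app_combK (a : M.D σ) (b : M.D τ) : M.con (.combK σ τ) ⋆ a ⋆ b = a := by
  have := M.isP0 _ _ (.combK σ τ v0 v1) (cons a (cons b nil))
  simpa [M.e_iff] using this

theorem app_combS (a : M.D (ρ ⇒ₜ σ ⇒ₜ τ)) (b : M.D (ρ ⇒ₜ σ)) (c : M.D ρ) :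
    M.con (.combS ρ σ τ) ⋆ a ⋆ b ⋆ c = a ⋆ c ⋆ (b ⋆ c) := by
  have := M.isP0 _ _ (.combS ρ σ τ v0 v1 v2) (cons a (cons b (cons c nil)))
  simpa [M.e_iff] using this

@[simp] theorem app_lam (e : M.Env Γ) (t : Tm (σ :: Γ) τ) (a : M.D σ) :
    eval e (lam t) ⋆ a = eval (cons a e) t := by
  induction t with
  | var v => cases v <;> simp [lam, app_combK, app_combS]
  | con c => simp [lam, app_combK]
  | app f b hf hb => rw [lam, eval_app, eval_app, eval_con, app_combS, hf, hb, eval_app]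

/-- `F` is represented by an element of the model. -/
def Rep (F : M.D σ → M.D τ) : Prop := ∃ f : M.D (σ ⇒ₜ τ), ∀ x, f ⋆ x = F x

theorem Rep.const (a : M.D τ) : Rep fun _ : M.D σ => a :=
  ⟨M.con (.combK τ σ) ⋆ a, fun _ => app_combK _ _⟩

theorem rep_id : Rep fun x : M.D σ => x :=
  ⟨eval nil (lam v0), fun _ => by simp⟩

theorem Rep.app {F : M.D ρ → M.D (σ ⇒ₜ τ)} {G : M.D ρ → M.D σ} (hF : Rep F) (hG : Rep G) :
    Rep fun x => F x ⋆ G x := by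
  obtain ⟨f, hf⟩ := hF
  obtain ⟨g, hg⟩ := hG
  exact ⟨M.con (.combS ρ σ τ) ⋆ f ⋆ g, fun x => by rw [app_combS, hf, hg]⟩

theorem rep_app (f : M.D (σ ⇒ₜ τ)) : Rep fun x : M.D σ => f ⋆ x := ⟨f, fun _ => rfl⟩

instance : Zero (M.D .nat) := ⟨M.con .zero⟩
instance : One (M.D .nat) := ⟨M.con .succ ⋆ 0⟩

abbrev S (n : M.D .nat) : M.D .nat := M.con .succ ⋆ n

@[simp] theorem eval_zeroT (e : M.Env Γ) : eval e zeroT = 0 := rfl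
@[simp] theorem con_zero : M.con .zero = 0 := rfl
@[simp] theorem eval_succT (e : M.Env Γ) (t : Tm Γ .nat) : eval e (succT t) = S (eval e t) := rfl

theorem S_ne_zero (n : M.D .nat) : S n ≠ 0 := by
  have := M.isP0 _ _ (.succ_ne_zero v0) (cons n nil)
  simpa using this

theorem S_inj {m n : M.D .nat} (h : S m = S n) : m = n := by
  have := M.isP0 _ _ (.succ_inj v0 v1) (cons m (cons n nil))
  simp only [sat_imp, sat_eq, eq_iff] at this
  exact this h

theorem qf_induction (e : M.Env Γ) (φ : Fm (.nat :: Γ)) (hφ : φ.QF) (h0 : Sat (cons 0 e) φ)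
    (hs : ∀ n, Sat (cons n e) φ → Sat (cons (S n) e) φ) (n : M.D .nat) : Sat (cons n e) φ := by
  have := M.isP0 _ _ (.qfInduction φ hφ) e
  simp only [NSA.induction, sat_imp, sat_inst, sat_all, sat_subst, eval_cons_subst] at this
  exact this h0 hs n

/-- The represented functions enter the induction formula as parameters, which keeps it
quantifier-free. The premise is allowed to depend on the induction variable. -/
theorem ind_imp {F G F' G' : M.D .nat → M.D .nat} (hF : Rep F) (hG : Rep G) (hF' : Rep F')
    (hG' : Rep G') (h0 : F 0 = G 0 → F' 0 = G' 0)
    (hs : ∀ n, (F n = G n → F' n = G' n) → F (S n) = G (S n) → F' (S n) = G' (S n))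
    (n : M.D .nat) : F n = G n → F' n = G' n := by
  obtain ⟨f, hf⟩ := hF
  obtain ⟨g, hg⟩ := hG
  obtain ⟨f', hf'⟩ := hF'
  obtain ⟨g', hg'⟩ := hG'
  simp only [← hf, ← hg, ← hf', ← hg'] at *
  have := qf_induction (M := M) (cons f (cons g (cons f' (cons g' nil))))
    (.eq (v1 ⬝ v0) (v2 ⬝ v0) ⇒ᶠ .eq (v3 ⬝ v0) (.var (.succ (.succ (.succ (.succ .zero)))) ⬝ v0))
    ⟨trivial, trivial⟩
  simp only [sat_imp, sat_eq, eq_iff, eval_app, eval_v0, eval_v1, eval_v2, eval_v3, eval_var,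
    cons_succ, cons_zero] at this
  exact this h0 hs n

theorem ind_eq {F G : M.D .nat → M.D .nat} (hF : Rep F) (hG : Rep G) (h0 : F 0 = G 0)
    (hs : ∀ n, F n = G n → F (S n) = G (S n)) (n : M.D .nat) : F n = G n :=
  ind_imp (Rep.const 0) (Rep.const 0) hF hG (fun _ => h0) (fun n h _ => hs n (h rfl)) n rfl

def Rep₂ (G : M.D .nat → M.D .nat → M.D .nat) : Prop :=
  ∃ z : M.D (.nat ⇒ₜ .nat ⇒ₜ .nat), ∀ p i, z ⋆ p ⋆ i = G p i

open Classical in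
/-- Recursion with start value `a` and step `G`. -/
noncomputable def nrec (n a : M.D .nat) (G : M.D .nat → M.D .nat → M.D .nat) : M.D .nat :=
  if h : Rep₂ G then M.con .recN ⋆ n ⋆ a ⋆ h.choose else 0

/-- Representatives of the same step function are equal by extensionality, so the choice made in
`nrec` is harmless. -/
theorem nrec_eq {G : M.D .nat → M.D .nat → M.D .nat} (n a : M.D .nat)
    (z : M.D (.nat ⇒ₜ .nat ⇒ₜ .nat)) (hz : ∀ p i, z ⋆ p ⋆ i = G p i) :
    M.con .recN ⋆ n ⋆ a ⋆ z = nrec n a G := by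
  have h : Rep₂ G := ⟨z, hz⟩
  rw [nrec, dif_pos h]
  congr 1
  exact ext fun p => ext fun i => by rw [hz, h.choose_spec]

theorem rep₂_eval (e : M.Env Γ) (t : Tm (.nat :: .nat :: Γ) .nat) :
    Rep₂ fun p i => eval (cons i (cons p e)) t :=
  ⟨eval e (lam (lam t)), fun p i => by simp⟩

@[simp] theorem eval_recT (e : M.Env Γ) (n a : Tm Γ .nat) (z : Tm (.nat :: .nat :: Γ) .nat) :
    eval e (recT n a z) = nrec (eval e n) (eval e a) fun p i => eval (cons i (cons p e)) z := by
  rw [← nrec_eq (eval e n) (eval e a) (eval e (lam (lam z))) (fun p i => by simp)]; rfl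

theorem nrec_zero {G : M.D .nat → M.D .nat → M.D .nat} (h : Rep₂ G) (a : M.D .nat) :
    nrec 0 a G = a := by
  obtain ⟨z, hz⟩ := h
  rw [← nrec_eq _ _ z hz]
  have := M.isP0 _ _ (.rec_zero v0 v1) (cons a (cons z nil))
  simpa using this

theorem nrec_succ {G : M.D .nat → M.D .nat → M.D .nat} (h : Rep₂ G) (n a : M.D .nat) :
    nrec (S n) a G = G (nrec n a G) n := by
  obtain ⟨z, hz⟩ := h
  rw [← nrec_eq _ _ z hz, ← nrec_eq _ _ z hz, ← hz]
  have := M.isP0 _ _ (.rec_succ v0 v1 v2) (cons n (cons a (cons z nil)))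
  simpa using this

/-! ### Closed terms -/

section Closed

variable {Δ : List Ty}

@[simp] theorem rename_lam (r : Ren Γ Δ) (t : Tm (σ :: Γ) τ) :
    (lam t).rename r = lam (t.rename r.lift) := by
  induction t with
  | var v => cases v <;> rfl
  | con c => rfl
  | app f a hf ha => simp only [lam, Tm.rename, hf, ha]

@[simp] theorem rename_app (r : Ren Γ Δ) (f : Tm Γ (σ ⇒ₜ τ)) (a : Tm Γ σ) :
    (f ⬝ a).rename r = f.rename r ⬝ a.rename r := rfl
@[simp] theorem rename_con (r : Ren Γ Δ) (c : Con σ) : (Tm.con c).rename r = .con c := rfl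
@[simp] theorem rename_zeroT (r : Ren Γ Δ) : zeroT.rename r = zeroT := rfl
@[simp] theorem rename_succT (r : Ren Γ Δ) (t : Tm Γ .nat) :
    (succT t).rename r = succT (t.rename r) := rfl
@[simp] theorem rename_v0 (r : Ren Γ Δ) : (v0 (a := σ)).rename r.lift = v0 := rfl
@[simp] theorem rename_v1 (r : Ren Γ Δ) :
    (v1 (a := σ) (b := τ)).rename r.lift.lift = v1 := rfl
@[simp] theorem rename_v2 (r : Ren Γ Δ) :
    (v2 (a := σ) (b := τ) (c := ρ)).rename r.lift.lift.lift = v2 := rfl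
@[simp] theorem rename_v3 {π : Ty} (r : Ren Γ Δ) :
    (v3 (a := σ) (b := τ) (c := ρ) (d := π)).rename r.lift.lift.lift.lift = v3 := rfl
@[simp] theorem rename_recT (r : Ren Γ Δ) (n a : Tm Γ .nat) (z : Tm (.nat :: .nat :: Γ) .nat) :
    (recT n a z).rename r = recT (n.rename r) (a.rename r) (z.rename r.lift.lift) := by
  simp [recT]
@[simp] theorem rename_addC (r : Ren Γ Δ) : addC.rename r = addC := by simp [addC]
@[simp] theorem rename_addT (r : Ren Γ Δ) (s t : Tm Γ .nat) :
    (addT s t).rename r = addT (s.rename r) (t.rename r) := by simp [addT]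
@[simp] theorem rename_predC (r : Ren Γ Δ) : predC.rename r = predC := by simp [predC]
@[simp] theorem rename_subC (r : Ren Γ Δ) : subC.rename r = subC := by simp [subC]
@[simp] theorem rename_subT (r : Ren Γ Δ) (s t : Tm Γ .nat) :
    (subT s t).rename r = subT (s.rename r) (t.rename r) := by simp [subT]
@[simp] theorem rename_mulC (r : Ren Γ Δ) : mulC.rename r = mulC := by simp [mulC]
@[simp] theorem rename_numT (r : Ren Γ Δ) (k : ℕ) : (numT k).rename r = numT k := by
  induction k with
  | zero => rfl
  | succ k ih => simp [numT, ih]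

theorem eval_closed (e : M.Env Γ) {t : Tm Γ σ} {t' : Tm [] σ} (h : t'.rename Ren.empty = t) :
    eval e t = eval nil t' := by rw [← h, eval_empty]

end Closed

/-! ### The semiring of numbers of a model -/

instance : Add (M.D .nat) := ⟨fun a b => eval nil addC ⋆ a ⋆ b⟩
instance : Mul (M.D .nat) := ⟨fun a b => eval nil mulC ⋆ a ⋆ b⟩
instance : _root_.Sub (M.D .nat) := ⟨fun a b => M.sub a b⟩
def pred (a : M.D .nat) : M.D .nat := eval nil predC ⋆ a

@[simp] theorem eval_addT (e : M.Env Γ) (s t : Tm Γ .nat) :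
    eval e (addT s t) = eval e s + eval e t := by
  have : eval e (addC (Γ := Γ)) = eval nil addC := eval_closed e (rename_addC _)
  rw [addT, eval_app, eval_app, this]; rfl

@[simp] theorem eval_mulT (e : M.Env Γ) (s t : Tm Γ .nat) :
    eval e (mulT s t) = eval e s * eval e t := by
  have : eval e (mulC (Γ := Γ)) = eval nil mulC := eval_closed e (rename_mulC _)
  rw [mulT, eval_app, eval_app, this]; rfl

@[simp] theorem sub_def (a b : M.D .nat) : M.sub a b = a - b := rfl

@[simp] theorem eval_predC (e : M.Env Γ) (a : M.D .nat) : eval e predC ⋆ a = pred a := by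
  have : eval e (predC (Γ := Γ)) = eval nil predC := eval_closed e (rename_predC _)
  rw [this]; rfl

theorem Rep.add {F G : M.D σ → M.D .nat} (hF : Rep F) (hG : Rep G) : Rep fun x => F x + G x :=
  ((Rep.const _).app hF).app hG
theorem Rep.mul {F G : M.D σ → M.D .nat} (hF : Rep F) (hG : Rep G) : Rep fun x => F x * G x :=
  ((Rep.const _).app hF).app hG
theorem Rep.sub {F G : M.D σ → M.D .nat} (hF : Rep F) (hG : Rep G) : Rep fun x => F x - G x :=
  ((Rep.const _).app hF).app hG
theorem Rep.succ {F : M.D σ → M.D .nat} (hF : Rep F) : Rep fun x => S (F x) :=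
  (Rep.const _).app hF

/-! ### Recursion equations, addition, multiplication and truncated subtraction -/

namespace Arith

theorem add_eq (a b : M.D .nat) : a + b = nrec b a fun p _ => S p := by
  show eval nil addC ⋆ a ⋆ b = _
  simp [addC]

theorem rep₂_succ : Rep₂ fun p _ : M.D .nat => S p :=
  rep₂_eval nil (succT v1)

theorem add_zero (a : M.D .nat) : a + 0 = a := by rw [add_eq, nrec_zero rep₂_succ]
theorem add_succ (a b : M.D .nat) : a + S b = S (a + b) := by
  rw [add_eq, add_eq, nrec_succ rep₂_succ]

theorem mul_eq (a b : M.D .nat) : a * b = nrec b 0 fun p _ => p + a := by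
  show eval nil mulC ⋆ a ⋆ b = _
  simp [mulC]

theorem rep₂_add (a : M.D .nat) : Rep₂ fun p _ : M.D .nat => p + a := by
  simpa using rep₂_eval (M := M) (cons a nil) (addT v1 v2)

theorem mul_zero (a : M.D .nat) : a * 0 = 0 := by rw [mul_eq, nrec_zero (rep₂_add a)]
theorem mul_succ (a b : M.D .nat) : a * S b = a * b + a := by
  rw [mul_eq, mul_eq, nrec_succ (rep₂_add a)]

theorem pred_eq (a : M.D .nat) : pred a = nrec a 0 fun _ i => i := by
  show eval nil predC ⋆ a = _
  simp [predC]

theorem pred_zero : pred (0 : M.D .nat) = 0 := by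
  rw [pred_eq, nrec_zero (by simpa using rep₂_eval (M := M) nil v0)]
theorem pred_succ (a : M.D .nat) : pred (S a) = a := by
  rw [pred_eq, nrec_succ (by simpa using rep₂_eval (M := M) nil v0)]

theorem sub_eq (a b : M.D .nat) : a - b = nrec b a fun p _ => pred p := by
  show eval nil subC ⋆ a ⋆ b = _
  simp [subC]

theorem rep₂_pred : Rep₂ fun p _ : M.D .nat => pred p := by
  simpa using rep₂_eval (M := M) nil (predC ⬝ v1)

theorem sub_zero (a : M.D .nat) : a - 0 = a := by rw [sub_eq, nrec_zero rep₂_pred]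
theorem sub_succ (a b : M.D .nat) : a - S b = pred (a - b) := by
  rw [sub_eq, sub_eq, nrec_succ rep₂_pred]

theorem zero_add (a : M.D .nat) : 0 + a = a :=
  ind_eq ((Rep.const 0).add rep_id) rep_id (add_zero 0) (fun n h => by rw [add_succ, h]) a

theorem succ_add (a b : M.D .nat) : S a + b = S (a + b) :=
  ind_eq ((Rep.const _).add rep_id) ((Rep.const _).add rep_id).succ
    (by rw [add_zero, add_zero]) (fun n h => by rw [add_succ, add_succ, h]) b

theorem add_comm (a b : M.D .nat) : a + b = b + a :=
  ind_eq ((Rep.const _).add rep_id) (rep_id.add (Rep.const _))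
    (by rw [add_zero, zero_add]) (fun n h => by rw [add_succ, succ_add, h]) b

theorem add_assoc (a b c : M.D .nat) : a + b + c = a + (b + c) :=
  ind_eq ((Rep.const _).add rep_id) ((Rep.const _).add ((Rep.const _).add rep_id))
    (by rw [add_zero, add_zero]) (fun n h => by rw [add_succ, add_succ, add_succ, h]) c

theorem zero_mul (a : M.D .nat) : 0 * a = 0 :=
  ind_eq ((Rep.const 0).mul rep_id) (Rep.const 0) (mul_zero 0)
    (fun n h => by rw [mul_succ, h, add_zero]) a

theorem succ_mul (a b : M.D .nat) : S a * b = a * b + b :=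
  ind_eq ((Rep.const _).mul rep_id) (((Rep.const _).mul rep_id).add rep_id)
    (by rw [mul_zero, mul_zero, add_zero])
    (fun n h => by rw [mul_succ, mul_succ, h, add_succ, add_succ, add_assoc, add_comm n,
      add_assoc]) b

theorem mul_comm (a b : M.D .nat) : a * b = b * a :=
  ind_eq ((Rep.const _).mul rep_id) (rep_id.mul (Rep.const _))
    (by rw [mul_zero, zero_mul]) (fun n h => by rw [mul_succ, succ_mul, h]) b

theorem mul_add (a b c : M.D .nat) : a * (b + c) = a * b + a * c :=
  ind_eq ((Rep.const _).mul ((Rep.const _).add rep_id))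
    ((Rep.const _).add ((Rep.const _).mul rep_id))
    (by rw [add_zero, mul_zero, add_zero])
    (fun n h => by rw [add_succ, mul_succ, mul_succ, h, add_assoc]) c

theorem mul_assoc (a b c : M.D .nat) : a * b * c = a * (b * c) :=
  ind_eq ((Rep.const _).mul rep_id) ((Rep.const _).mul ((Rep.const _).mul rep_id))
    (by rw [mul_zero, mul_zero, mul_zero])
    (fun n h => by rw [mul_succ, mul_succ, mul_add, h]) c

theorem mul_one (a : M.D .nat) : a * 1 = a := by
  show a * S 0 = a
  rw [mul_succ, mul_zero, zero_add]

theorem add_right_cancel {a b : M.D .nat} (c : M.D .nat) : a + c = b + c → a = b := by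
  refine ind_imp ((Rep.const _).add rep_id) ((Rep.const _).add rep_id) (Rep.const _) (Rep.const _)
    ?_ ?_ c
  · rw [add_zero, add_zero]; exact id
  · intro n h h'
    rw [add_succ, add_succ] at h'
    exact h (S_inj h')

theorem eq_zero_or (a : M.D .nat) : a = 0 ∨ ∃ b, a = S b := by
  by_contra h
  push Not at h
  -- "Zero or a successor" has a quantifier. For a counterexample `a`, the quantifier-free `a = n →
  -- 0 = 1` is vacuous at 0 and at successors, and `n = a` is absurd.
  have : ∀ n : M.D .nat, a = n → (0 : M.D .nat) = 1 := fun n =>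
    ind_imp (Rep.const a) rep_id (Rep.const 0) (Rep.const 1) (fun h' => absurd h' h.1)
      (fun n _ h' => absurd h' (h.2 n)) n
  exact S_ne_zero _ (this a rfl).symm

theorem zero_sub (a : M.D .nat) : 0 - a = 0 :=
  ind_eq ((Rep.const 0).sub rep_id) (Rep.const 0) (sub_zero 0)
    (fun n h => by rw [sub_succ, h, pred_zero]) a

theorem succ_sub_succ (a b : M.D .nat) : S a - S b = a - b :=
  ind_eq ((Rep.const _).sub rep_id.succ) ((Rep.const _).sub rep_id)
    (by rw [sub_succ, sub_zero, sub_zero, pred_succ])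
    (fun n h => by rw [sub_succ, h, sub_succ]) b

theorem add_sub_cancel (a b : M.D .nat) : a + b - b = a :=
  ind_eq (((Rep.const _).add rep_id).sub rep_id) (Rep.const _)
    (by rw [add_zero, sub_zero]) (fun n h => by rw [add_succ, succ_sub_succ, h]) b

theorem sub_self (a : M.D .nat) : a - a = 0 := by
  have := add_sub_cancel 0 a
  rwa [zero_add] at this

theorem sub_add (a b c : M.D .nat) : a - (b + c) = a - b - c :=
  ind_eq ((Rep.const _).sub ((Rep.const _).add rep_id)) ((Rep.const _).sub rep_id)
    (by rw [add_zero, sub_zero]) (fun n h => by rw [add_succ, sub_succ, sub_succ, h]) c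

theorem one_sub_succ (a : M.D .nat) : 1 - S a = 0 := by
  show S 0 - S a = 0
  rw [succ_sub_succ, zero_sub]

theorem one_sub_eq_zero {a : M.D .nat} : 1 - a = 0 ↔ a ≠ 0 := by
  rcases eq_zero_or a with rfl | ⟨b, rfl⟩
  · rw [sub_zero]; exact iff_of_false (S_ne_zero _) (not_not.2 rfl)
  · rw [one_sub_succ]; exact iff_of_true rfl (S_ne_zero _)

/-- Induction on `b`, where the nonvanishing of `a - b` is written as the equation `1 - (a - b) = 0`
so that `ind_imp` applies. -/
theorem add_sub_of_ne {a b : M.D .nat} (h : a - b ≠ 0) : b + (a - b) = a := by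
  refine ind_imp ((Rep.const 1).sub ((Rep.const a).sub rep_id)) (Rep.const 0)
    (rep_id.add ((Rep.const a).sub rep_id)) (Rep.const a) ?_ ?_ b (one_sub_eq_zero.2 h)
  · rw [sub_zero, zero_add]; exact fun _ => rfl
  · intro n ih h
    rw [one_sub_eq_zero] at ih h
    rw [sub_succ] at h ⊢
    have hn : a - n ≠ 0 := fun h' => h (by rw [h', pred_zero])
    obtain ⟨c, hc⟩ := (eq_zero_or (a - n)).resolve_left hn
    have := ih hn
    rw [hc, add_succ] at this
    rw [hc, pred_succ, succ_add, this]

theorem sub_total (a b : M.D .nat) : a - b = 0 ∨ b - a = 0 := by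
  by_contra! h
  have := add_sub_of_ne h.1
  apply h.2
  rw [← this, sub_add, sub_self, zero_sub]

theorem add_sub_of_eq {a b : M.D .nat} (h : a - b = 0) : a + (b - a) = b := by
  refine ind_imp ((Rep.const a).sub rep_id) (Rep.const 0)
    ((Rep.const a).add (rep_id.sub (Rep.const a))) rep_id ?_ ?_ b h
  · rw [sub_zero]; rintro rfl; rw [sub_self, add_zero]
  · intro n ih h
    rw [sub_succ] at h
    rcases eq_zero_or (a - n) with h' | ⟨c, hc⟩
    · have h₁ := ih h'
      have : S n = S (n - a) + a := by rw [succ_add, add_comm, h₁]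
      rw [this, add_sub_cancel, add_comm]
    · rw [hc, pred_succ] at h
      subst h
      have := add_sub_of_ne (a := a) (b := n) (by rw [hc]; exact S_ne_zero _)
      rw [hc, add_succ, add_zero] at this
      rw [this, sub_self, add_zero]

end Arith

open Arith

/-! ### The ordered semiring structure -/

noncomputable instance : CommSemiring (M.D .nat) where
  add_assoc := Arith.add_assoc
  zero_add := Arith.zero_add
  add_zero := Arith.add_zero
  add_comm := Arith.add_comm
  left_distrib := Arith.mul_add
  right_distrib a b c := by rw [Arith.mul_comm, Arith.mul_add, Arith.mul_comm c, Arith.mul_comm c]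
  zero_mul := Arith.zero_mul
  mul_zero := Arith.mul_zero
  mul_assoc := Arith.mul_assoc
  one_mul a := by rw [Arith.mul_comm, Arith.mul_one]
  mul_one := Arith.mul_one
  mul_comm := Arith.mul_comm
  nsmul := nsmulRec

instance : LE (M.D .nat) := ⟨fun a b => a - b = 0⟩

theorem le_iff_sub {a b : M.D .nat} : a ≤ b ↔ a - b = 0 := Iff.rfl

theorem le_iff_exists_add {a b : M.D .nat} : a ≤ b ↔ ∃ c, b = a + c := by
  constructor
  · exact fun h => ⟨b - a, (add_sub_of_eq h).symm⟩
  · rintro ⟨c, rfl⟩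
    rw [le_iff_sub, Arith.sub_add, Arith.sub_self, Arith.zero_sub]

@[simp] theorem S_eq (n : M.D .nat) : S n = n + 1 := by
  show S n = n + S 0
  rw [Arith.add_succ, Arith.add_zero]

noncomputable instance : LinearOrder (M.D .nat) where
  le_refl := Arith.sub_self
  le_trans a b c h h' := by
    rw [le_iff_exists_add] at *
    obtain ⟨x, rfl⟩ := h
    obtain ⟨y, rfl⟩ := h'
    exact ⟨x + y, _root_.add_assoc _ _ _⟩
  le_antisymm a b h h' := by
    have := add_sub_of_eq h
    rwa [le_iff_sub.1 h', _root_.add_zero] at this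
  le_total := sub_total
  toDecidableLE := Classical.decRel _

instance : IsCancelAdd (M.D .nat) :=
  have : IsRightCancelAdd (M.D .nat) := ⟨fun c _ _ h => Arith.add_right_cancel c h⟩
  AddCommMagma.IsRightCancelAdd.toIsCancelAdd _

theorem add_one_ne_zero (a : M.D .nat) : a + 1 ≠ 0 := by rw [← S_eq]; exact S_ne_zero a

theorem zero_or_succ (a : M.D .nat) : a = 0 ∨ ∃ b, a = b + 1 := by
  simpa using eq_zero_or a

instance : CanonicallyOrderedAdd (M.D .nat) where
  exists_add_of_le := le_iff_exists_add.1
  le_self_add _ b := le_iff_exists_add.2 ⟨b, rfl⟩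
  le_add_self _ b := le_iff_exists_add.2 ⟨b, _root_.add_comm _ _⟩

instance : IsOrderedAddMonoid (M.D .nat) where
  add_le_add_left a b h c := by
    rw [le_iff_exists_add] at *
    obtain ⟨x, rfl⟩ := h
    exact ⟨x, by ring⟩

theorem mul_ne_zero' {a b : M.D .nat} (ha : a ≠ 0) (hb : b ≠ 0) : a * b ≠ 0 := by
  obtain ⟨c, rfl⟩ := (zero_or_succ a).resolve_left ha
  obtain ⟨d, rfl⟩ := (zero_or_succ b).resolve_left hb
  rw [show (c + 1) * (d + 1) = c * d + c + d + 1 by ring]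
  exact add_one_ne_zero _

instance : IsOrderedCancelAddMonoid (M.D .nat) where
  le_of_add_le_add_left a b c h := by
    rcases le_total b c with h' | h'
    · exact h'
    · exact (_root_.add_left_cancel (h.antisymm (add_le_add_right h' a))).le

instance : IsStrictOrderedRing (M.D .nat) :=
  have : Nontrivial (M.D .nat) := ⟨1, 0, S_ne_zero 0⟩
  have : PosMulStrictMono (M.D .nat) := ⟨fun a ha b c hbc => by
    obtain ⟨x, rfl⟩ := le_iff_exists_add.1 hbc.le
    have hx : x ≠ 0 := by rintro rfl; simp at hbc
    simp only [_root_.mul_add]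
    refine lt_of_le_of_ne (le_iff_exists_add.2 ⟨_, rfl⟩) fun h => ?_
    have : a * b + 0 = a * b + a * x := by rw [_root_.add_zero]; exact h
    exact mul_ne_zero' (ne_of_gt ha) hx (_root_.add_left_cancel this).symm⟩
  have : ZeroLEOneClass (M.D .nat) := ⟨_root_.zero_le⟩
  have : MulPosStrictMono (M.D .nat) := ⟨fun a ha b c hbc => by
    simpa only [_root_.mul_comm _ a] using mul_lt_mul_of_pos_left hbc ha⟩
  ⟨⟩

theorem lt_iff_succ_le {a b : M.D .nat} : a < b ↔ a + 1 ≤ b := by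
  constructor
  · intro h
    obtain ⟨c, rfl⟩ := le_iff_exists_add.1 h.le
    rcases zero_or_succ c with rfl | ⟨d, rfl⟩
    · simp at h
    · exact le_iff_exists_add.2 ⟨d, by ring⟩
  · exact fun h => lt_of_lt_of_le (lt_add_one a) h

theorem lt_succ_iff {a b : M.D .nat} : a < b + 1 ↔ a ≤ b := by
  rw [lt_iff_succ_le]; exact add_le_add_iff_right 1

instance : OrderedSub (M.D .nat) where
  tsub_le_iff_right a b c := by
    rw [le_iff_sub, le_iff_sub, _root_.add_comm c b, Arith.sub_add]

end P0Model

/-- `if t = 0 then a else b`. -/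
def ifT {Γ : List Ty} (t a b : Tm Γ Ty.nat) : Tm Γ Ty.nat := recT t a b.wk.wk

/-- The least `k ≤ b` with `f(k) = 0`, and `b` if there is none. -/
def muC {Γ : List Ty} : Tm Γ (Ty.nat ⇒ₜ Ty.one ⇒ₜ Ty.nat) :=
  lam (lam (recT v1 zeroT (ifT (v2 ⬝ v1) v1 (succT v0))))

/-- A code of `(p - m) / d`. -/
def ratT {Γ : List Ty} (p m d : Tm Γ Ty.nat) : Tm Γ Ty.nat :=
  pairC ⬝ addT (addT (subT p m) (subT p m)) (subT (addT (subT m p) (subT m p)) (numT 1)) ⬝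
    subT d (numT 1)

namespace P0Model

open Str

variable {M : P0Model} {Γ Δ : List Ty} {σ τ ρ : Ty}

/-! ### Closed terms for pairing and fractions -/

@[simp] theorem rename_wk_lift (r : Ren Γ Δ) (t : Tm Γ σ) :
    (t.wk (ρ := ρ)).rename r.lift = (t.rename r).wk := Tm.rename_lift_wk r t
@[simp] theorem rename_ifT (r : Ren Γ Δ) (t a b : Tm Γ .nat) :
    (ifT t a b).rename r = ifT (t.rename r) (a.rename r) (b.rename r) := by simp [ifT]
@[simp] theorem rename_muC (r : Ren Γ Δ) : muC.rename r = muC := by simp [muC]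
@[simp] theorem rename_pow2C (r : Ren Γ Δ) : pow2C.rename r = pow2C := by simp [pow2C]
@[simp] theorem rename_triC (r : Ren Γ Δ) : triC.rename r = triC := by simp [triC]
@[simp] theorem rename_rootC (r : Ren Γ Δ) : rootC.rename r = rootC := by simp [rootC]
@[simp] theorem rename_pairC (r : Ren Γ Δ) : pairC.rename r = pairC := by simp [pairC]
@[simp] theorem rename_fstC (r : Ren Γ Δ) : fstC.rename r = fstC := by simp [fstC]
@[simp] theorem rename_sndC (r : Ren Γ Δ) : sndC.rename r = sndC := by simp [sndC]
@[simp] theorem rename_parC (r : Ren Γ Δ) : parC.rename r = parC := by simp [parC]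
@[simp] theorem rename_halfC (r : Ren Γ Δ) : halfC.rename r = halfC := by simp [halfC]

def mu (b : M.D .nat) (f : M.D .one) : M.D .nat := eval nil muC ⋆ b ⋆ f
def pow2 (a : M.D .nat) : M.D .nat := eval nil pow2C ⋆ a
def tri (a : M.D .nat) : M.D .nat := eval nil triC ⋆ a
def root (a : M.D .nat) : M.D .nat := eval nil rootC ⋆ a
def pair (a b : M.D .nat) : M.D .nat := eval nil pairC ⋆ a ⋆ b
def fst (a : M.D .nat) : M.D .nat := eval nil fstC ⋆ a
def snd (a : M.D .nat) : M.D .nat := eval nil sndC ⋆ a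
def par (a : M.D .nat) : M.D .nat := eval nil parC ⋆ a
def half (a : M.D .nat) : M.D .nat := eval nil halfC ⋆ a

@[simp] theorem eval_muC (e : M.Env Γ) (b : M.D .nat) (f : M.D .one) :
    eval e muC ⋆ b ⋆ f = mu b f := by rw [eval_closed e (rename_muC _)]; rfl
@[simp] theorem eval_pow2C (e : M.Env Γ) (a : M.D .nat) : eval e pow2C ⋆ a = pow2 a := by
  rw [eval_closed e (rename_pow2C _)]; rfl
@[simp] theorem eval_triC (e : M.Env Γ) (a : M.D .nat) : eval e triC ⋆ a = tri a := by
  rw [eval_closed e (rename_triC _)]; rfl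
@[simp] theorem eval_rootC (e : M.Env Γ) (a : M.D .nat) : eval e rootC ⋆ a = root a := by
  rw [eval_closed e (rename_rootC _)]; rfl
@[simp] theorem eval_pairC (e : M.Env Γ) (a b : M.D .nat) : eval e pairC ⋆ a ⋆ b = pair a b := by
  rw [eval_closed e (rename_pairC _)]; rfl
@[simp] theorem eval_fstC (e : M.Env Γ) (a : M.D .nat) : eval e fstC ⋆ a = fst a := by
  rw [eval_closed e (rename_fstC _)]; rfl
@[simp] theorem eval_sndC (e : M.Env Γ) (a : M.D .nat) : eval e sndC ⋆ a = snd a := by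
  rw [eval_closed e (rename_sndC _)]; rfl
@[simp] theorem eval_parC (e : M.Env Γ) (a : M.D .nat) : eval e parC ⋆ a = par a := by
  rw [eval_closed e (rename_parC _)]; rfl
@[simp] theorem eval_halfC (e : M.Env Γ) (a : M.D .nat) : eval e halfC ⋆ a = half a := by
  rw [eval_closed e (rename_halfC _)]; rfl
@[simp] theorem eval_pow2T (e : M.Env Γ) (t : Tm Γ .nat) : eval e (pow2T t) = pow2 (eval e t) := by
  simp [pow2T]
@[simp] theorem eval_numT (e : M.Env Γ) (k : ℕ) : eval e (numT k) = (k : M.D .nat) := by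
  induction k with
  | zero => exact Nat.cast_zero.symm
  | succ k ih => rw [numT, eval_succT, ih, S_eq, Nat.cast_succ]

/-! ### Standard elements -/

theorem st_eval (e : M.Env Γ) (he : ∀ σ (v : Var Γ σ), M.st (e σ v)) (t : Tm Γ σ) :
    M.st (eval e t) := by
  induction t with
  | var v => exact he _ v
  | con c => exact M.isP0 _ _ (.st_closed _ (.con c)) nil
  | app f a hf ha =>
    exact M.isP0 _ _ (.st_app _ _ v0 v1) (cons (eval e f) (cons (eval e a) nil)) hf ha

theorem st_app {f : M.D (σ ⇒ₜ τ)} {a : M.D σ} (hf : M.st f) (ha : M.st a) : M.st (f ⋆ a) :=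
  M.isP0 _ _ (.st_app _ _ v0 v1) (cons f (cons a nil)) hf ha

theorem st_closed (t : Tm [] σ) : M.st (eval (M := M.toStr) nil t) :=
  st_eval _ (fun _ v => by cases v) t

theorem st_zero : M.st (0 : M.D .nat) := st_closed zeroT
theorem st_add {a b : M.D .nat} (ha : M.st a) (hb : M.st b) : M.st (a + b) :=
  st_app (st_app (st_closed _) ha) hb
theorem st_sub {a b : M.D .nat} (ha : M.st a) (hb : M.st b) : M.st (a - b) :=
  st_app (st_app (st_closed _) ha) hb
theorem st_natCast (k : ℕ) : M.st (k : M.D .nat) := by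
  rw [← eval_numT (M := M) nil]; exact st_closed _
theorem st_ofNat (k : ℕ) [k.AtLeastTwo] : M.st (OfNat.ofNat k : M.D .nat) := by
  have := st_natCast (M := M) (OfNat.ofNat k)
  rwa [Nat.cast_ofNat] at this
theorem st_one : M.st (1 : M.D .nat) := by simpa using st_natCast (M := M) 1
theorem st_mu {b : M.D .nat} {f : M.D .one} (hb : M.st b) (hf : M.st f) : M.st (mu b f) :=
  st_app (st_app (st_closed _) hb) hf
theorem st_pair {a b : M.D .nat} (ha : M.st a) (hb : M.st b) : M.st (pair a b) :=
  st_app (st_app (st_closed _) ha) hb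

/-! ### Decidable predicates and induction -/

/-- `P` is the zero set of an element of the model. -/
def QP (P : M.D .nat → Prop) : Prop := ∃ f : M.D .one, ∀ n, P n ↔ f ⋆ n = 0

theorem QP.of_rep {P : M.D .nat → Prop} {F : M.D .nat → M.D .nat} (hF : Rep F)
    (h : ∀ n, P n ↔ F n = 0) : QP P := by
  obtain ⟨f, hf⟩ := hF
  exact ⟨f, fun n => by rw [h, hf]⟩

theorem QP.le {F G : M.D .nat → M.D .nat} (hF : Rep F) (hG : Rep G) : QP fun n => F n ≤ G n :=
  .of_rep (hF.sub hG) fun _ => le_iff_sub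

theorem QP.eq {F G : M.D .nat → M.D .nat} (hF : Rep F) (hG : Rep G) : QP fun n => F n = G n :=
  .of_rep ((hF.sub hG).add (hG.sub hF)) fun _ => by
    rw [add_eq_zero, ← le_iff_sub, ← le_iff_sub, le_antisymm_iff]

theorem QP.not {P : M.D .nat → Prop} (hP : QP P) : QP fun n => ¬ P n := by
  obtain ⟨f, hf⟩ := hP
  exact .of_rep ((Rep.const 1).sub (rep_app f)) fun n => by rw [hf, Arith.one_sub_eq_zero]

theorem QP.lt {F G : M.D .nat → M.D .nat} (hF : Rep F) (hG : Rep G) : QP fun n => F n < G n := by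
  simpa using (QP.le hG hF).not

theorem QP.or {P Q : M.D .nat → Prop} (hP : QP P) (hQ : QP Q) : QP fun n => P n ∨ Q n := by
  obtain ⟨f, hf⟩ := hP
  obtain ⟨g, hg⟩ := hQ
  refine .of_rep ((rep_app f).mul (rep_app g)) fun n => ?_
  rw [hf, hg]
  exact ⟨fun h => by rcases h with h | h <;> simp [h], fun h => by
    by_contra! h'
    exact mul_ne_zero' h'.1 h'.2 h⟩

theorem QP.imp {P Q : M.D .nat → Prop} (hP : QP P) (hQ : QP Q) : QP fun n => P n → Q n := by
  simpa only [imp_iff_not_or] using hP.not.or hQ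

theorem QP.and {P Q : M.D .nat → Prop} (hP : QP P) (hQ : QP Q) : QP fun n => P n ∧ Q n := by
  simpa only [not_or, not_not] using (hP.not.or hQ.not).not

/-- The metatheory decides `P`, which may be external, since it does not depend on the number. -/
theorem QP.const (P : Prop) : QP fun _ : M.D .nat => P := by
  by_cases h : P
  · exact .of_rep (Rep.const 0) fun _ => iff_of_true h rfl
  · exact .of_rep (Rep.const 1) fun _ => iff_of_false h one_ne_zero

theorem QP.induction {P : M.D .nat → Prop} (hP : QP P) (h0 : P 0) (hs : ∀ n, P n → P (n + 1))
    (n : M.D .nat) : P n := by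
  obtain ⟨f, hf⟩ := hP
  refine (hf n).2 (ind_imp (Rep.const 0) (Rep.const 0) (rep_app f) (Rep.const 0)
    (fun _ => (hf 0).1 h0) (fun n h _ => ?_) n rfl)
  rw [S_eq, ← hf]
  exact hs n ((hf n).2 (h rfl))

/-! ### Case distinction and bounded search -/

theorem nrec_zero' (e : M.Env Γ) (t : Tm (.nat :: .nat :: Γ) .nat) (a : M.D .nat) :
    nrec 0 a (fun p i => eval (cons i (cons p e)) t) = a := nrec_zero (rep₂_eval e t) a

theorem nrec_succ' (e : M.Env Γ) (t : Tm (.nat :: .nat :: Γ) .nat) (n a : M.D .nat) :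
    nrec (n + 1) a (fun p i => eval (cons i (cons p e)) t) =
      eval (cons n (cons (nrec n a (fun p i => eval (cons i (cons p e)) t)) e)) t := by
  rw [← S_eq]; exact nrec_succ (rep₂_eval e t) n a

@[simp] theorem eval_ifT (e : M.Env Γ) (t a b : Tm Γ .nat) :
    eval e (ifT t a b) = if eval e t = 0 then eval e a else eval e b := by
  rw [ifT, eval_recT]
  rcases zero_or_succ (eval e t) with h | ⟨n, h⟩
  · rw [h, nrec_zero', if_pos rfl]
  · rw [h, nrec_succ', if_neg (add_one_ne_zero n), eval_wk, eval_wk]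

section Mu

variable (f : M.D .one)

theorem mu_eq (b : M.D .nat) : mu b f =
    nrec b 0 fun p i => eval (cons i (cons p (cons f nil))) (ifT (v2 ⬝ v1) v1 (succT v0)) := by
  show eval nil muC ⋆ b ⋆ f = _
  simp [muC]

theorem mu_zero : mu 0 f = 0 := by rw [mu_eq, nrec_zero']

theorem mu_succ (b : M.D .nat) : mu (b + 1) f = if f ⋆ mu b f = 0 then mu b f else b + 1 := by
  rw [mu_eq, nrec_succ', ← mu_eq]; simp

theorem rep_mu : Rep fun b => mu b f := ((Rep.const _).app rep_id).app (Rep.const f)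

theorem mu_le (b : M.D .nat) : mu b f ≤ b := by
  refine QP.induction (.le (rep_mu f) rep_id) (mu_zero f).le (fun b h => ?_) b
  rw [mu_succ]
  split_ifs
  · exact h.trans (le_add_of_nonneg_right zero_le)
  · exact le_rfl

theorem app_mu {b : M.D .nat} : mu b f < b → f ⋆ mu b f = 0 := by
  refine QP.induction (.imp (.lt (rep_mu f) rep_id) (.eq ((Rep.const f).app (rep_mu f))
    (Rep.const 0))) (fun h => absurd h not_lt_zero) (fun b h => ?_) b
  rw [mu_succ]
  split_ifs with h'
  · exact fun _ => h'
  · exact fun h => absurd h (lt_irrefl _)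

theorem app_ne_of_lt_mu {b k : M.D .nat} : k < mu b f → f ⋆ k ≠ 0 := by
  refine QP.induction (.imp (.lt (Rep.const k) (rep_mu f)) (.const _))
    (fun h => absurd h (by rw [mu_zero]; exact not_lt_zero)) (fun b h => ?_) b
  rw [mu_succ]
  split_ifs with h'
  · exact h
  · intro hk
    -- A search value that is not a zero of `f` can only be the default `b`.
    have hb : mu b f = b := (mu_le f b).eq_or_lt.resolve_right fun h => h' (app_mu f h)
    rcases (lt_succ_iff.1 hk).eq_or_lt with rfl | hk
    · rwa [hb] at h'
    · exact h (hb.symm ▸ hk)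

theorem mu_le_of_app {b k : M.D .nat} (h : f ⋆ k = 0) : mu b f ≤ k :=
  not_lt.1 fun h' => app_ne_of_lt_mu f h' h

end Mu

/-! ### Powers of two, parity, pairing -/

section Pairing

theorem pow2_eq (a : M.D .nat) :
    pow2 a = nrec a 1 fun p i => eval (cons i (cons p nil)) (addT v1 v1) := by
  show eval nil pow2C ⋆ a = _
  simp [pow2C]

@[simp] theorem pow2_zero : pow2 (0 : M.D .nat) = 1 := by rw [pow2_eq, nrec_zero']
theorem pow2_succ (a : M.D .nat) : pow2 (a + 1) = 2 * pow2 a := by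
  rw [pow2_eq, nrec_succ', ← pow2_eq]; simp [two_mul]

theorem rep_pow2 {F : M.D .nat → M.D .nat} (hF : Rep F) : Rep fun n => pow2 (F n) :=
  (Rep.const _).app hF

theorem pow2_add (a b : M.D .nat) : pow2 (a + b) = pow2 a * pow2 b := by
  refine QP.induction (.eq (rep_pow2 ((Rep.const a).add rep_id))
    ((Rep.const _).mul (rep_pow2 rep_id))) (by simp) (fun n h => ?_) b
  rw [← add_assoc, pow2_succ, h, pow2_succ]; ring

theorem pow2_pos (a : M.D .nat) : 0 < pow2 a := by
  refine QP.induction (.lt (Rep.const 0) (rep_pow2 rep_id)) (by simp) (fun n h => ?_) a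
  rw [pow2_succ]; exact mul_pos two_pos h

theorem par_eq (a : M.D .nat) :
    par a = nrec a 0 fun p i => eval (cons i (cons p nil)) (subT (numT 1) v1) := by
  show eval nil parC ⋆ a = _
  simp [parC]

@[simp] theorem par_zero : par (0 : M.D .nat) = 0 := by rw [par_eq, nrec_zero']
theorem par_succ (a : M.D .nat) : par (a + 1) = 1 - par a := by
  rw [par_eq, nrec_succ', ← par_eq]; simp

theorem half_eq (a : M.D .nat) :
    half a = nrec a 0 fun p i => eval (cons i (cons p nil)) (addT v1 (parC ⬝ v0)) := by
  show eval nil halfC ⋆ a = _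
  simp [halfC]

@[simp] theorem half_zero : half (0 : M.D .nat) = 0 := by rw [half_eq, nrec_zero']
theorem half_succ (a : M.D .nat) : half (a + 1) = half a + par a := by
  rw [half_eq, nrec_succ', ← half_eq]; simp

theorem par_le_one (a : M.D .nat) : par a ≤ 1 := by
  rcases zero_or_succ a with rfl | ⟨b, rfl⟩
  · simp
  · rw [par_succ]; exact tsub_le_self

theorem par_double (a : M.D .nat) : par (a + a) = 0 := by
  refine QP.induction (.eq ((Rep.const _).app (rep_id.add rep_id)) (Rep.const 0)) ?_
    (fun n h => ?_) a
  · rw [add_zero]; exact par_zero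
  · change par (n + n) = 0 at h
    show par (n + 1 + (n + 1)) = 0
    rw [show n + 1 + (n + 1) = n + n + 1 + 1 by ring, par_succ, par_succ, h, tsub_zero, tsub_self]

theorem half_double (a : M.D .nat) : half (a + a) = a := by
  refine QP.induction (.eq ((Rep.const _).app (rep_id.add rep_id)) rep_id) ?_ (fun n h => ?_) a
  · rw [add_zero]; exact half_zero
  · change half (n + n) = n at h
    show half (n + 1 + (n + 1)) = n + 1
    rw [show n + 1 + (n + 1) = n + n + 1 + 1 by ring, half_succ, half_succ, h, par_succ,
      par_double, tsub_zero, add_zero]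

theorem par_double_succ (a : M.D .nat) : par (a + a + 1) = 1 := by
  rw [par_succ, par_double, tsub_zero]

theorem half_double_succ (a : M.D .nat) : half (a + a + 1) = a := by
  rw [half_succ, half_double, par_double, add_zero]

theorem tri_eq (a : M.D .nat) :
    tri a = nrec a 0 fun p i => eval (cons i (cons p nil)) (succT (addT v1 v0)) := by
  show eval nil triC ⋆ a = _
  simp [triC]

theorem tri_zero : tri (0 : M.D .nat) = 0 := by rw [tri_eq, nrec_zero']
theorem tri_succ (a : M.D .nat) : tri (a + 1) = tri a + a + 1 := by
  rw [tri_eq, nrec_succ', ← tri_eq]; simp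

theorem root_eq (a : M.D .nat) : root a = nrec a 0 fun p i => eval (cons i (cons p nil))
    (addT v1 (subT (numT 1) (subT (triC ⬝ succT v1) (succT v0)))) := by
  show eval nil rootC ⋆ a = _
  simp [rootC]

theorem root_zero : root (0 : M.D .nat) = 0 := by rw [root_eq, nrec_zero']
theorem root_succ (a : M.D .nat) :
    root (a + 1) = root a + (1 - (tri (root a + 1) - (a + 1))) := by
  rw [root_eq, nrec_succ', ← root_eq]; simp

theorem rep_tri {F : M.D .nat → M.D .nat} (hF : Rep F) : Rep fun n => tri (F n) :=
  (Rep.const _).app hF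
theorem rep_root {F : M.D .nat → M.D .nat} (hF : Rep F) : Rep fun n => root (F n) :=
  (Rep.const _).app hF

/-- The recursion for `root` increases its value exactly when the argument reaches the next
triangular number. This locates `pair a b` in the diagonal `a + b`. -/
theorem tri_root (a : M.D .nat) : tri (root a) ≤ a ∧ a < tri (root a + 1) := by
  refine QP.induction (.and (.le (rep_tri (rep_root rep_id)) rep_id)
    (.lt rep_id (rep_tri ((rep_root rep_id).add (Rep.const 1))))) ?_ (fun n h => ?_) a
  · rw [root_zero, tri_succ, tri_zero]; simp
  · rw [root_succ]
    by_cases h' : tri (root n + 1) - (n + 1) = 0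
    · rw [h', tsub_zero]
      refine ⟨le_iff_sub.2 h', ?_⟩
      rw [tri_succ, lt_succ_iff]
      have := lt_iff_succ_le.1 h.2
      exact this.trans (le_add_of_nonneg_right zero_le)
    · rw [Arith.one_sub_eq_zero.2 h', add_zero]
      exact ⟨h.1.trans (le_add_of_nonneg_right zero_le), not_le.1 fun h => h' (le_iff_sub.1 h)⟩

theorem tri_mono {a b : M.D .nat} (h : a ≤ b) : tri a ≤ tri b := by
  obtain ⟨c, rfl⟩ := le_iff_exists_add.1 h
  refine QP.induction (.le (Rep.const (tri a)) (rep_tri ((Rep.const a).add rep_id))) ?_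
    (fun n h => ?_) c
  · rw [add_zero]
  · rw [← add_assoc, tri_succ, add_assoc]; exact h.trans (le_add_of_nonneg_right zero_le)

theorem root_unique {r u : M.D .nat} (h : tri r ≤ u) (h' : u < tri (r + 1)) : root u = r := by
  have := tri_root u
  rcases lt_trichotomy (root u) r with hr | hr | hr
  · exact absurd (this.2.trans_le ((tri_mono (lt_iff_succ_le.1 hr)).trans h)) (lt_irrefl _)
  · exact hr
  · exact absurd (h'.trans_le ((tri_mono (lt_iff_succ_le.1 hr)).trans this.1)) (lt_irrefl _)

theorem pair_eq (a b : M.D .nat) : pair a b = tri (a + b) + a := by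
  show eval nil pairC ⋆ a ⋆ b = _
  simp [pairC]

theorem root_pair (a b : M.D .nat) : root (pair a b) = a + b := by
  rw [pair_eq]
  refine root_unique (le_add_of_nonneg_right zero_le) ?_
  rw [tri_succ, lt_succ_iff, ← add_assoc]
  exact le_add_of_nonneg_right zero_le

@[simp] theorem fst_pair (a b : M.D .nat) : fst (pair a b) = a := by
  have : ∀ u : M.D .nat, fst u = u - tri (root u) := fun u => by
    show eval nil fstC ⋆ u = _
    simp [fstC]
  rw [this, root_pair, pair_eq, add_tsub_cancel_left]

@[simp] theorem snd_pair (a b : M.D .nat) : snd (pair a b) = b := by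
  have : ∀ u : M.D .nat, snd u = root u - fst u := fun u => by
    show eval nil sndC ⋆ u = _
    simp [sndC]
  rw [this, root_pair, fst_pair, add_tsub_cancel_left]

end Pairing

/-! ### The field of fractions, and rational codes -/

/-- The ordered field of fractions of the numbers of the model. -/
abbrev K (M : P0Model) : Type := Frac (M.D .nat)

noncomputable def of : M.D .nat →+* M.K := Frac.of

theorem of_le_of {a b : M.D .nat} : of a ≤ of b ↔ a ≤ b := Frac.of_le_of
theorem of_lt_of {a b : M.D .nat} : of a < of b ↔ a < b := by
  rw [← not_le, of_le_of, not_le]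
theorem of_nonneg (a : M.D .nat) : 0 ≤ of a := by
  rw [← map_zero of, of_le_of]; exact zero_le
theorem of_pos {a : M.D .nat} (h : 0 < a) : 0 < of a := by
  rw [← map_zero of, of_lt_of]; exact h
theorem of_sub {a b : M.D .nat} (h : b ≤ a) : of (a - b) = of a - of b := by
  rw [eq_sub_iff_add_eq, ← map_add, tsub_add_cancel_of_le h]

/-- `2⁻ⁿ`. -/
noncomputable def eps (n : M.D .nat) : M.K := (of (pow2 n))⁻¹

theorem of_pow2_pos (n : M.D .nat) : 0 < of (pow2 n) := of_pos (pow2_pos n)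
theorem eps_pos (n : M.D .nat) : 0 < eps n := inv_pos.2 (of_pow2_pos n)
theorem eps_zero : eps (0 : M.D .nat) = 1 := by simp [eps]
theorem eps_add (m n : M.D .nat) : eps (m + n) = eps m * eps n := by
  rw [eps, pow2_add, map_mul, mul_inv]; rfl
theorem eps_succ (n : M.D .nat) : eps (n + 1) = eps n / 2 := by
  rw [eps, pow2_succ, map_mul, mul_inv, map_ofNat, eps]; ring
theorem eps_add_two (n : M.D .nat) : eps (n + 2) = eps n / 4 := by
  rw [show n + 2 = n + 1 + 1 by ring, eps_succ, eps_succ]; ring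
theorem eps_add_four (n : M.D .nat) : eps (n + 4) = eps n / 16 := by
  rw [show n + 4 = n + 2 + 2 by ring, eps_add_two, eps_add_two]; ring
theorem eps_le_one (n : M.D .nat) : eps n ≤ 1 := by
  rw [eps]
  refine inv_le_one_of_one_le₀ ?_
  rw [← map_one of, of_le_of]
  exact (zero_add (1 : M.D .nat)) ▸ lt_iff_succ_le.1 (pow2_pos n)
theorem eps_anti {m n : M.D .nat} (h : m ≤ n) : eps n ≤ eps m := by
  obtain ⟨c, rfl⟩ := le_iff_exists_add.1 h
  rw [eps_add]
  exact mul_le_of_le_one_right (eps_pos m).le (eps_le_one c)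

def num (q : M.D .nat) : M.D .nat := half (fst q) * (1 - par (fst q))
def neg (q : M.D .nat) : M.D .nat := (half (fst q) + 1) * par (fst q)
def den (q : M.D .nat) : M.D .nat := snd q + 1

@[simp] theorem eval_ratPos (e : M.Env Γ) (q : Tm Γ .nat) : eval e (ratPos q) = num (eval e q) := by
  simp [ratPos, num]
@[simp] theorem eval_ratNeg (e : M.Env Γ) (q : Tm Γ .nat) : eval e (ratNeg q) = neg (eval e q) := by
  simp [ratNeg, neg]
@[simp] theorem eval_ratDen (e : M.Env Γ) (q : Tm Γ .nat) : eval e (ratDen q) = den (eval e q) := by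
  simp [ratDen, den]

theorem den_pos (q : M.D .nat) : 0 < of (den q) := of_pos (lt_succ_iff.2 zero_le)

/-- The rational with code `q`. -/
noncomputable def val (q : M.D .nat) : M.K := (of (num q) - of (neg q)) / of (den q)

theorem val_mul_den (q : M.D .nat) : val q * of (den q) = of (num q) - of (neg q) :=
  div_mul_cancel₀ _ (den_pos q).ne'

/-- The cleared comparison differs from the rational one by a positive factor, so `≤` and `<` both
reduce to a sign. -/
theorem diff_eq (q r k n : M.D .nat) :
    of (pow2 n * (num q * den r + neg r * den q)) -
      of (pow2 n * (neg q * den r + num r * den q) + k * (den q * den r)) =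
    (val q - val r - of k * eps n) * (of (pow2 n) * (of (den q) * of (den r))) := by
  have h₁ := val_mul_den q
  have h₂ := val_mul_den r
  have h₃ : eps n * of (pow2 n) = 1 := inv_mul_cancel₀ (of_pow2_pos n).ne'
  simp only [map_add, map_mul]
  linear_combination (-of (pow2 n) * of (den r)) * h₁ + of (pow2 n) * of (den q) * h₂ +
    of k * of (den q) * of (den r) * h₃

theorem diff_pos (q r n : M.D .nat) : 0 < of (pow2 n) * (of (den q) * of (den r)) :=
  mul_pos (of_pow2_pos n) (mul_pos (den_pos q) (den_pos r))

theorem diff_le_iff (q r k n : M.D .nat) :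
    pow2 n * (num q * den r + neg r * den q) ≤
      pow2 n * (neg q * den r + num r * den q) + k * (den q * den r) ↔
    val q - val r ≤ of k * eps n := by
  rw [← of_le_of, ← sub_nonpos, diff_eq, ← sub_nonpos (a := val q - val r),
    ← not_lt, mul_pos_iff_of_pos_right (diff_pos q r n), not_lt]

theorem diff_lt_iff (q r k n : M.D .nat) :
    pow2 n * (num q * den r + neg r * den q) <
      pow2 n * (neg q * den r + num r * den q) + k * (den q * den r) ↔
    val q - val r < of k * eps n := by
  rw [← of_lt_of, ← sub_neg, diff_eq, ← sub_neg (a := val q - val r),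
    ← not_le, mul_nonneg_iff_of_pos_right (diff_pos q r n), not_le]

@[simp] theorem eval_diffL (e : M.Env Γ) (q r n : Tm Γ .nat) : eval e (diffL q r n) =
    pow2 (eval e n) * (num (eval e q) * den (eval e r) + neg (eval e r) * den (eval e q)) := by
  simp [diffL]
@[simp] theorem eval_diffR (e : M.Env Γ) (q r k n : Tm Γ .nat) : eval e (diffR q r k n) =
    pow2 (eval e n) * (neg (eval e q) * den (eval e r) + num (eval e r) * den (eval e q)) +
      eval e k * (den (eval e q) * den (eval e r)) := by
  simp [diffR]

@[simp] theorem sat_leN (e : M.Env Γ) (s t : Tm Γ .nat) :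
    Sat e (leN s t) ↔ eval e s ≤ eval e t := by
  simp [leN, le_iff_sub]
@[simp] theorem sat_ltN (e : M.Env Γ) (s t : Tm Γ .nat) :
    Sat e (ltN s t) ↔ eval e s < eval e t := by
  simp [ltN, lt_iff_succ_le]

@[simp] theorem sat_diffLe (e : M.Env Γ) (q r k n : Tm Γ .nat) : Sat e (diffLe q r k n) ↔
    val (eval e q) - val (eval e r) ≤ of (eval e k) * eps (eval e n) := by
  simp only [diffLe, sat_leN, eval_diffL, eval_diffR, diff_le_iff]

@[simp] theorem sat_diffLt (e : M.Env Γ) (q r k n : Tm Γ .nat) : Sat e (diffLt q r k n) ↔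
    val (eval e q) - val (eval e r) < of (eval e k) * eps (eval e n) := by
  simp only [diffLt, sat_ltN, eval_diffL, eval_diffR, diff_lt_iff]

/-- The code of `(p - m) / d`. -/
def rat (p m d : M.D .nat) : M.D .nat := eval (cons p (cons m (cons d nil))) (ratT v0 v1 v2)

theorem rat_eq (p m d : M.D .nat) : rat p m d =
    pair ((p - m) + (p - m) + ((m - p) + (m - p) - 1)) (d - 1) := by
  simp [rat, ratT]

@[simp] theorem eval_ratT (e : M.Env Γ) (p m d : Tm Γ .nat) :
    eval e (ratT p m d) = rat (eval e p) (eval e m) (eval e d) := by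
  rw [rat_eq]; simp [ratT]

theorem val_rat (p m : M.D .nat) {d : M.D .nat} (hd : 0 < d) :
    val (rat p m d) = (of p - of m) / of d := by
  have hden : den (rat p m d) = d := by
    rw [den, rat_eq, snd_pair]
    exact tsub_add_cancel_of_le ((zero_add (1 : M.D .nat)) ▸ lt_iff_succ_le.1 hd)
  rw [val, hden]
  congr 1
  rw [num, neg, rat_eq, fst_pair]
  rcases le_total m p with h | h
  · rw [le_iff_sub.1 h, add_zero, zero_tsub, add_zero, par_double, half_double, tsub_zero, mul_one,
      mul_zero, of_sub h, map_zero, sub_zero]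
  · rw [le_iff_sub.1 h, add_zero, zero_add]
    rcases h.eq_or_lt with rfl | h'
    · simp
    · obtain ⟨c, hc⟩ := le_iff_exists_add.1 (lt_iff_succ_le.1 h')
      have : m - p = c + 1 := by rw [hc, add_assoc, add_tsub_cancel_left, add_comm]
      rw [this, show c + 1 + (c + 1) = c + c + 1 + 1 by ring, add_tsub_cancel_right,
        par_double_succ, half_double_succ, tsub_self, mul_zero, mul_one, map_zero, zero_sub, ← this,
        of_sub h]
      ring

/-! ### Reals -/

def IsReal (x : M.D .one) : Prop := ∀ n i, |val (x ⋆ n) - val (x ⋆ (n + i))| < eps n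
def Approx (x y : M.D .one) : Prop := ∀ n, M.st n → |val (x ⋆ n) - val (y ⋆ n)| ≤ 2 * eps n
def LeR (x y : M.D .one) : Prop := ∀ n, val (x ⋆ n) - val (y ⋆ n) ≤ 2 * eps n

structure InUnit (x : M.D .one) : Prop where
  isReal : IsReal x
  nonneg : ∀ n, -(2 * eps n) ≤ val (x ⋆ n)
  le_one : ∀ n, val (x ⋆ n) ≤ 1 + 2 * eps n

@[simp] theorem sat_isReal (e : M.Env Γ) (x : Tm Γ .one) :
    Sat e (isReal x) ↔ IsReal (eval e x) := by
  simp [isReal, IsReal, abs_sub_lt_iff]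

@[simp] theorem sat_leR (e : M.Env Γ) (x y : Tm Γ .one) :
    Sat e (leR x y) ↔ LeR (eval e x) (eval e y) := by
  simp [leR, LeR, map_ofNat of]

@[simp] theorem sat_approxR (e : M.Env Γ) (x y : Tm Γ .one) :
    Sat e (approxR x y) ↔ Approx (eval e x) (eval e y) := by
  simp [approxR, Approx, abs_sub_le_iff, map_ofNat of]

@[simp] theorem app_constR (e : M.Env Γ) (q : Tm Γ .nat) (n : M.D .nat) :
    eval e (constR q) ⋆ n = eval e q := by
  rw [constR, eval_app, eval_con, app_combK]

theorem val_pair_zero : val (pair (0 : M.D .nat) 0) = 0 := by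
  simp [val, num, neg]

theorem val_pair_two : val (pair (2 : M.D .nat) 0) = 1 := by
  have h₁ := par_double (1 : M.D .nat)
  have h₂ := half_double (1 : M.D .nat)
  rw [one_add_one_eq_two] at h₁ h₂
  simp [val, num, neg, h₁, h₂, den]

@[simp] theorem sat_inUnit (e : M.Env Γ) (x : Tm Γ .one) :
    Sat e (inUnit x) ↔ InUnit (eval e x) := by
  simp only [inUnit, sat_and, sat_isReal, sat_leR, LeR, zeroR, oneR, app_constR, eval_app,
    eval_pairC, eval_numT, Nat.cast_zero, Nat.cast_ofNat, val_pair_zero, val_pair_two]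
  constructor
  · rintro ⟨h₁, h₂, h₃⟩
    exact ⟨h₁, fun n => by linarith [h₂ n], fun n => by linarith [h₃ n]⟩
  · rintro ⟨h₁, h₂, h₃⟩
    exact ⟨h₁, fun n => by linarith [h₂ n], fun n => by linarith [h₃ n]⟩

/-- `x ≪ y` for reals. -/
def LL (x y : M.D .one) : Prop := ∃ m, M.st m ∧ 2 * eps m < val (y ⋆ m) - val (x ⋆ m)

theorem IsReal.bounds {x : M.D .one} (hx : IsReal x) {m n : M.D .nat} (h : m ≤ n) :
    val (x ⋆ m) - val (x ⋆ n) < eps m ∧ val (x ⋆ n) - val (x ⋆ m) < eps m := by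
  obtain ⟨c, rfl⟩ := le_iff_exists_add.1 h
  exact abs_sub_lt_iff.1 (hx m c)

/-- A gap above `2 · 2⁻ⁿ` at one place fixes the order of the values at all later places. Hence the
standard gap provided by the failure of `≈` must point the same way as the possibly nonstandard gap
provided by `<`; otherwise the two clash at `max m n`. -/
theorem ll_iff {x y : M.D .one} (hx : IsReal x) (hy : IsReal y) :
    ¬ LeR y x ∧ ¬ Approx x y ↔ LL x y := by
  constructor
  · rintro ⟨h₁, h₂⟩
    simp only [LeR, Approx, not_forall, not_le, lt_abs] at h₁ h₂
    obtain ⟨n, hn⟩ := h₁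
    obtain ⟨m, hm, h | h⟩ := h₂
    · exfalso
      have a₁ := hx.bounds (le_max_left m n)
      have a₂ := hy.bounds (le_max_left m n)
      have b₁ := hx.bounds (le_max_right m n)
      have b₂ := hy.bounds (le_max_right m n)
      linarith
    · exact ⟨m, hm, by linarith⟩
  · rintro ⟨m, hm, h⟩
    exact ⟨fun h' => absurd (h' m) (by linarith),
      fun h' => absurd (abs_sub_le_iff.1 (h' m hm)).2 (by linarith)⟩

@[simp] theorem sat_llR (e : M.Env Γ) (x y : Tm Γ .one) : Sat e (llR x y) ↔
    ¬ LeR (eval e y) (eval e x) ∧ ¬ Approx (eval e x) (eval e y) := by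
  simp [llR, ltR]

/-! ### The principles in a model -/

def Stp (M : P0Model) : Prop := ∀ α : M.D .one, (∀ n, α ⋆ n ≤ 1) →
  ∃ β : M.D .one, M.st β ∧ (∀ n, β ⋆ n ≤ 1) ∧ ∀ n, M.st n → α ⋆ n = β ⋆ n

def UnitCompact (M : P0Model) : Prop := ∀ x : M.D .one, InUnit x →
  ∃ y : M.D .one, M.st y ∧ InUnit y ∧ Approx x y

theorem sat_STP : Sat (M := M.toStr) nil STP ↔ M.Stp := by
  simp [STP, Stp, leOne, approxOne]

theorem sat_unitCompact : Sat (M := M.toStr) nil unitCompact ↔ M.UnitCompact := by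
  simp [unitCompact, UnitCompact]

/-- `x` is in the `n`-th interval, in the strong sense. -/
def Inside (c d : M.D (.nat ⇒ₜ .one)) (n : M.D .nat) (x : M.D .one) : Prop :=
  LL (c ⋆ n) x ∧ LL x (d ⋆ n)

def StCover (c d : M.D (.nat ⇒ₜ .one)) : Prop :=
  ∀ x : M.D .one, M.st x → InUnit x → ∃ n, M.st n ∧ Inside c d n x

def Intervals (c d : M.D (.nat ⇒ₜ .one)) : Prop := ∀ n, IsReal (c ⋆ n) ∧ IsReal (d ⋆ n)

def HeineBorelSt (M : P0Model) : Prop := ∀ c d : M.D (.nat ⇒ₜ .one), Intervals c d → StCover c d →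
  ∃ k, M.st k ∧ ∀ y : M.D .one, M.st y → InUnit y → ∃ i, i ≤ k ∧ Inside c d i y

def HeineBorel (M : P0Model) : Prop := ∀ c d : M.D (.nat ⇒ₜ .one), Intervals c d → StCover c d →
  ∃ k, M.st k ∧ ∀ y : M.D .one, InUnit y → ∃ i, i ≤ k ∧ Inside c d i y

theorem sat_inInterval (e : M.Env Γ) (c d : Tm Γ (.nat ⇒ₜ .one)) (i : Tm Γ .nat) (y : Tm Γ .one)
    (h : Intervals (eval e c) (eval e d)) (hy : IsReal (eval e y)) :
    Sat e (inInterval c d i y) ↔ Inside (eval e c) (eval e d) (eval e i) (eval e y) := by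
  rw [inInterval, sat_and, sat_llR, sat_llR, eval_app, eval_app, ll_iff (h _).1 hy,
    ll_iff hy (h _).2]
  rfl

theorem sat_stCover (e : M.Env Γ) (c d : Tm Γ (.nat ⇒ₜ .one))
    (h : Intervals (eval e c) (eval e d)) :
    Sat e (stCover c d) ↔ StCover (eval e c) (eval e d) := by
  simp only [stCover, sat_allSt, sat_imp, sat_inUnit, sat_exSt, StCover, eval_v0]
  refine forall_congr' fun x => forall_congr' fun _ => forall_congr' fun hx =>
    exists_congr fun n => and_congr_right fun _ => ?_
  rw [sat_inInterval _ _ _ _ _ (by simpa using h) (by simpa using hx.isReal)]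
  simp

theorem sat_finCovers (e : M.Env Γ) (c d : Tm Γ (.nat ⇒ₜ .one)) (k : Tm Γ .nat) (y : Tm Γ .one)
    (h : Intervals (eval e c) (eval e d)) :
    Sat e (finCovers c d k y) ↔ (InUnit (eval e y) →
      ∃ i, i ≤ eval e k ∧ Inside (eval e c) (eval e d) i (eval e y)) := by
  simp only [finCovers, sat_imp, sat_inUnit, sat_ex, sat_and, sat_leN, eval_v0, eval_wk]
  refine forall_congr' fun hy => exists_congr fun i => and_congr_right fun _ => ?_
  rw [sat_inInterval _ _ _ _ _ (by simpa using h) (by simpa using hy.isReal)]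
  simp

theorem sat_areIntervals (e : M.Env Γ) (c d : Tm Γ (.nat ⇒ₜ .one)) :
    Sat e (areIntervals c d) ↔ Intervals (eval e c) (eval e d) := by
  simp [areIntervals, Intervals]

theorem sat_HBLns : Sat (M := M.toStr) nil HBLns ↔ M.HeineBorelSt := by
  simp only [HBLns, sat_all, sat_imp, sat_areIntervals, HeineBorelSt, eval_v0, eval_v1]
  refine forall_congr' fun c => forall_congr' fun d => forall_congr' fun h => ?_
  rw [sat_stCover _ _ _ (by simpa using h)]
  simp only [sat_exSt, sat_allSt, eval_v0, eval_v1]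
  refine forall_congr' fun _ => exists_congr fun k => and_congr_right fun _ =>
    forall_congr' fun y => forall_congr' fun _ => ?_
  rw [sat_finCovers _ _ _ _ _ (by simpa using h)]
  simp

theorem sat_HBLnsAll : Sat (M := M.toStr) nil HBLnsAll ↔ M.HeineBorel := by
  simp only [HBLnsAll, sat_all, sat_imp, sat_areIntervals, HeineBorel, eval_v0, eval_v1]
  refine forall_congr' fun c => forall_congr' fun d => forall_congr' fun h => ?_
  rw [sat_stCover _ _ _ (by simpa using h)]
  simp only [sat_exSt, sat_all, eval_v0, eval_v1]
  refine forall_congr' fun _ => exists_congr fun k => and_congr_right fun _ =>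
    forall_congr' fun y => ?_
  rw [sat_finCovers _ _ _ _ _ (by simpa using h)]
  simp

end P0Model

/-- `0` if and only if `q - r ≤ k / 2 ^ n`. -/
def diffLeT {Γ : List Ty} (q r k n : Tm Γ Ty.nat) : Tm Γ Ty.nat :=
  subT (diffL q r n) (diffR q r k n)

/-- `0` if and only if `q - r < k / 2 ^ n`. -/
def diffLtT {Γ : List Ty} (q r k n : Tm Γ Ty.nat) : Tm Γ Ty.nat :=
  subT (succT (diffL q r n)) (diffR q r k n)

namespace P0Model

open Str

variable {M : P0Model} {Γ Δ : List Ty} {σ τ ρ : Ty}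

theorem st_nil : ∀ σ (v : Var [] σ), M.st (nil (M := M.toStr) σ v) := fun _ v => by cases v

theorem st_cons {e : M.Env Γ} {a : M.D ρ} (ha : M.st a) (he : ∀ σ (v : Var Γ σ), M.st (e σ v)) :
    ∀ σ (v : Var (ρ :: Γ) σ), M.st (cons a e σ v)
  | _, .zero => ha
  | _, .succ v => he _ v

theorem eval_diffLeT (e : M.Env Γ) (q r k n : Tm Γ .nat) : eval e (diffLeT q r k n) = 0 ↔
    val (eval e q) - val (eval e r) ≤ of (eval e k) * eps (eval e n) := by
  have := sat_diffLe e q r k n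
  rwa [diffLe, leN, sat_eq, eq_iff, eval_zeroT] at this

theorem eval_diffLtT (e : M.Env Γ) (q r k n : Tm Γ .nat) : eval e (diffLtT q r k n) = 0 ↔
    val (eval e q) - val (eval e r) < of (eval e k) * eps (eval e n) := by
  have := sat_diffLt e q r k n
  rwa [diffLt, ltN, leN, sat_eq, eq_iff, eval_zeroT] at this

theorem of_pow2_mul_eps (n : M.D .nat) : of (pow2 n) * eps n = 1 :=
  mul_inv_cancel₀ (of_pow2_pos n).ne'

theorem val_dyadic (k n : M.D .nat) : val (rat k 0 (pow2 n)) = of k * eps n := by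
  rw [val_rat _ _ (pow2_pos n), map_zero, sub_zero, eps, div_eq_mul_inv]

theorem eps_add_three (n : M.D .nat) : eps (n + 3) = eps n / 8 := by
  rw [show n + 3 = n + 2 + 1 by ring, eps_succ, eps_add_two]; ring

theorem le_one_iff {a : M.D .nat} : a ≤ 1 ↔ a = 0 ∨ a = 1 := by
  constructor
  · intro h
    rcases zero_or_succ a with rfl | ⟨b, rfl⟩
    · exact Or.inl rfl
    · right
      have : b ≤ 0 := (add_le_add_iff_right 1).1 (by rwa [zero_add])
      rw [le_zero_iff.1 this, zero_add]
  · rintro (rfl | rfl)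
    · exact zero_le
    · exact le_rfl

theorem IsReal.sub_lt {x : M.D .one} (hx : IsReal x) (m n : M.D .nat) :
    val (x ⋆ m) - val (x ⋆ n) < eps m + eps n := by
  rcases le_total m n with h | h
  · linarith [(hx.bounds h).1, eps_pos n]
  · linarith [(hx.bounds h).2, eps_pos m]

/-! ### Standard parts of bounded sequences -/

/-- `STP` is applied to the 0-1 sequence that vanishes at `pair n k` exactly if `f(n) ≤ k`. With its
standard part in place of it, `h(n)` is the least `k ≤ g(n)` at which it vanishes. -/
theorem Stp.bounded (hM : M.Stp) {f g : M.D .one} (hg : M.st g) (hfg : ∀ n, f ⋆ n ≤ g ⋆ n) :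
    ∃ h : M.D .one, M.st h ∧ (∀ n, h ⋆ n ≤ g ⋆ n) ∧ ∀ n, M.st n → h ⋆ n = f ⋆ n := by
  let α : M.D .one := eval (cons f nil)
    (lam (ifT (subT (v1 ⬝ (fstC ⬝ v0)) (sndC ⬝ v0)) zeroT (numT 1)))
  have hα : ∀ u, α ⋆ u = if f ⋆ fst u - snd u = 0 then 0 else 1 := fun u => by simp [α]
  obtain ⟨β, hβ, -, hαβ⟩ := hM α fun n => by
    rw [hα]; split_ifs
    · exact zero_le
    · exact le_rfl
  let F : M.D .nat → M.D .one := fun n => eval (cons n (cons β nil)) (lam (v2 ⬝ (pairC ⬝ v1 ⬝ v0)))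
  have hF : ∀ n k, F n ⋆ k = β ⋆ pair n k := fun n k => by simp [F]
  let h : M.D .one := eval (cons β (cons g nil))
    (lam (muC ⬝ (v2 ⬝ v0) ⬝ lam (v2 ⬝ (pairC ⬝ v1 ⬝ v0))))
  have hh : ∀ n, h ⋆ n = mu (g ⋆ n) (F n) := fun n => by
    have : F n = eval (cons n (cons β (cons g nil))) (lam (v2 ⬝ (pairC ⬝ v1 ⬝ v0))) :=
      ext fun k => by simp [F]
    simp [h, this]
  have hst : M.st h := st_eval _ (st_cons hβ (st_cons hg st_nil)) _
  refine ⟨h, hst, fun n => hh n ▸ mu_le _ _, fun n hn => ?_⟩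
  have hkey : ∀ k, M.st k → (F n ⋆ k = 0 ↔ f ⋆ n ≤ k) := fun k hk => by
    rw [hF, ← hαβ _ (st_pair hn hk), hα, fst_pair, snd_pair, le_iff_sub]
    split_ifs with h'
    · simp [h']
    · simp [h']
  have hk : M.st (h ⋆ n) := st_app hst hn
  rw [hh] at hk ⊢
  refine le_antisymm (not_lt.1 fun hlt => ?_) ?_
  · rcases zero_or_succ (mu (g ⋆ n) (F n)) with h0 | ⟨k, hk'⟩
    · rw [h0] at hlt; exact not_lt_zero hlt
    -- `f(n)` is not known to be standard, so the comparison is made at `h(n) - 1`, which is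
    -- standard because `h(n)` is. Downward closure of the standard numbers is not needed.
    · have hst' : M.st k := by
        have := st_sub hk st_one
        rwa [hk', add_tsub_cancel_right] at this
      rw [hk', lt_succ_iff] at hlt
      exact app_ne_of_lt_mu (F n) (b := g ⋆ n) (by rw [hk']; exact lt_add_one k)
        ((hkey k hst').2 hlt)
  · rcases (mu_le (F n) (g ⋆ n)).eq_or_lt with h' | h'
    · rw [h']; exact hfg n
    · exact (hkey _ hk).1 (app_mu _ h')

/-! ### Standard reals from sequences that are Cauchy at standard arguments -/

/-- `T` vanishes at `j` if fast convergence fails between some `i < j` and `j`. The value `y(n)` is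
`s(n)` as long as no such `j ≤ n` exists, and `s(j - 1)` for the first such `j` afterwards, so
convergence holds everywhere. Every value of `y` is one of `s`, so bounds are inherited. -/
theorem exists_real {s : M.D .one} (hs : M.st s)
    (hc : ∀ i j, M.st i → M.st j → i ≤ j → |val (s ⋆ i) - val (s ⋆ j)| < eps i) :
    ∃ y : M.D .one, M.st y ∧ IsReal y ∧ (∀ n, M.st n → y ⋆ n = s ⋆ n) ∧
      ∀ n, ∃ m, y ⋆ n = s ⋆ m := by
  let B : Tm [.nat, .nat, .one] .nat := subT (numT 1)
    (addT (diffLtT (v2 ⬝ v0) (v2 ⬝ v1) (numT 1) v0) (diffLtT (v2 ⬝ v1) (v2 ⬝ v0) (numT 1) v0))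
  let bad : M.D .nat → M.D .one := fun j => eval (cons j (cons s nil)) (lam B)
  have hbad : ∀ i j, bad j ⋆ i = 0 ↔ ¬ |val (s ⋆ i) - val (s ⋆ j)| < eps i := fun i j => by
    simp only [bad, app_lam, B, eval_subT, sub_def, eval_numT, Nat.cast_one,
      Arith.one_sub_eq_zero, eval_addT, Ne, add_eq_zero, eval_diffLtT, abs_sub_lt_iff, eval_app,
      eval_v0, eval_v1, eval_v2, map_one, one_mul]
  let T : M.D .one := eval (cons s nil) (lam (subT (succT (muC ⬝ v0 ⬝ lam B)) v0))
  have hT : ∀ j, T ⋆ j = 0 ↔ mu j (bad j) < j := fun j => by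
    simp [T, bad, lt_iff_succ_le, le_iff_sub]
  have hTst : M.st T := st_eval _ (st_cons hs st_nil) _
  let y : M.D .one := eval (cons s (cons T nil))
    (lam (v1 ⬝ subT (muC ⬝ succT v0 ⬝ v2) (numT 1)))
  have hy : ∀ n, y ⋆ n = s ⋆ (mu (n + 1) T - 1) := fun n => by simp [y]
  have hgood : ∀ i j, T ⋆ j ≠ 0 → i < j → |val (s ⋆ i) - val (s ⋆ j)| < eps i := fun i j hj hi => by
    by_contra h'
    exact hj ((hT j).2 ((mu_le_of_app _ ((hbad i j).2 h')).trans_lt hi))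
  -- `T` cannot vanish at 0, as no `i` is below 0; hence subtracting 1 in `y` never truncates.
  have hmu0 : ∀ n, mu (n + 1) T ≠ 0 := fun n h' => by
    have : T ⋆ mu (n + 1) T = 0 := app_mu T (h'.symm ▸ lt_succ_iff.2 zero_le)
    rw [h', hT] at this
    exact not_lt_zero this
  have hmono : ∀ n i, mu (n + 1) T ≤ mu (n + i + 1) T := fun n i => by
    by_contra! h'
    refine app_ne_of_lt_mu T h' (app_mu T (h'.trans_le ((mu_le T _).trans ?_)))
    exact add_le_add_left (le_add_of_nonneg_right zero_le) 1
  refine ⟨y, st_eval _ (st_cons hs (st_cons hTst st_nil)) _, fun n i => ?_, fun n hn => ?_,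
    fun n => ⟨_, hy n⟩⟩
  · rw [hy, hy]
    obtain ⟨b, hb⟩ := (zero_or_succ (mu (n + i + 1) T)).resolve_left (hmu0 _)
    rcases (mu_le T (n + 1)).eq_or_lt with h' | h'
    · have hnb : n ≤ b := by
        have := hmono n i
        rwa [h', hb, add_le_add_iff_right] at this
      rw [h', hb, add_tsub_cancel_right, add_tsub_cancel_right]
      rcases hnb.eq_or_lt with rfl | hnb
      · rw [sub_self, abs_zero]; exact eps_pos n
      · exact hgood n b (app_ne_of_lt_mu T (b := n + i + 1) (by rw [hb]; exact lt_add_one b)) hnb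
    · rw [(hmono n i).antisymm (mu_le_of_app T (app_mu T h')), sub_self, abs_zero]
      exact eps_pos n
  · rw [hy]
    rcases (mu_le T (n + 1)).eq_or_lt with h' | h'
    · rw [h', add_tsub_cancel_right]
    · exfalso
      have hj : M.st (mu (n + 1) T) := st_mu (st_add hn st_one) hTst
      have hlt := (hT _).1 (app_mu T h')
      -- For standard `n` the first failure `j`, and the least `i` that witnesses it, are values of
      -- standard objects at standard arguments, so the hypothesis at standard places excludes them.
      have hi : M.st (mu (mu (n + 1) T) (bad (mu (n + 1) T))) :=
        st_mu hj (st_eval _ (st_cons hj (st_cons hs st_nil)) _)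
      exact (hbad _ _).1 (app_mu _ hlt) (hc _ _ hi hj hlt.le)

/-! ### Equivalence of `STP` and nonstandard compactness of the unit interval -/

theorem Stp.unitCompact (hM : M.Stp) : M.UnitCompact := by
  intro x hx
  -- Two dyadic approximations, each off by at most `2 · 2⁻⁽ⁿ⁺³⁾`, and the variation of `x` add up
  -- to less than five eighths of `2⁻ⁿ`; the shift by 3 makes this fast enough.
  let g : M.D .one := eval nil (lam (pow2T (addT v0 (numT 3))))
  have hg : ∀ n, g ⋆ n = pow2 (n + 3) := fun n => by simp [g]
  let T : Tm [.nat, .nat, .one] .nat := diffLeT (v2 ⬝ addT v1 (numT 3))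
    (ratT v0 zeroT (pow2T (addT v1 (numT 3)))) zeroT zeroT
  let F : M.D .nat → M.D .one := fun n => eval (cons n (cons x nil)) (lam T)
  have hF : ∀ n k, F n ⋆ k = 0 ↔ val (x ⋆ (n + 3)) ≤ of k * eps (n + 3) := fun n k => by
    simp only [F, app_lam, T, eval_diffLeT]
    simp [val_dyadic]
  let f : M.D .one := eval (cons x nil) (lam (muC ⬝ pow2T (addT v0 (numT 3)) ⬝ lam T))
  have hf : ∀ n, f ⋆ n = mu (pow2 (n + 3)) (F n) := fun n => by simp [f, F]
  have happrox : ∀ n, |val (x ⋆ (n + 3)) - of (f ⋆ n) * eps (n + 3)| ≤ 2 * eps (n + 3) := fun n => by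
    have hpos := eps_pos (n + 3)
    rw [abs_sub_le_iff, hf]
    constructor
    · rcases (mu_le (F n) (pow2 (n + 3))).eq_or_lt with h | h
      · rw [h, of_pow2_mul_eps]; linarith [hx.le_one (n + 3)]
      · linarith [(hF n _).1 (app_mu _ h)]
    · rcases zero_or_succ (mu (pow2 (n + 3)) (F n)) with h | ⟨k, h⟩
      · rw [h, map_zero]; linarith [hx.nonneg (n + 3)]
      · have := app_ne_of_lt_mu (F n) (b := pow2 (n + 3)) (k := k) (by rw [h]; exact lt_add_one k)
        rw [Ne, hF, not_le] at this
        rw [h, map_add, map_one]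
        linarith
  obtain ⟨h, hh, hhg, hhf⟩ := hM.bounded (f := f) (g := g) (st_closed _) fun n => by
    rw [hf, hg]; exact mu_le _ _
  let s : M.D .one := eval (cons h nil) (lam (ratT (v1 ⬝ v0) zeroT (pow2T (addT v0 (numT 3)))))
  have hs : ∀ n, val (s ⋆ n) = of (h ⋆ n) * eps (n + 3) := fun n => by simp [s, val_dyadic]
  have hsx : ∀ n, M.st n → |val (x ⋆ (n + 3)) - val (s ⋆ n)| ≤ 2 * eps (n + 3) := fun n hn => by
    rw [hs, hhf n hn]; exact happrox n
  obtain ⟨y, hyst, hyr, hys, hyv⟩ := exists_real (s := s) (st_eval _ (st_cons hh st_nil) _)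
    fun i j hi hj hij => by
      have h₁ := abs_sub_le_iff.1 (hsx i hi)
      have h₂ := abs_sub_le_iff.1 (hsx j hj)
      have h₃ := hx.isReal.bounds (add_le_add_left hij 3)
      have h₄ := eps_anti (add_le_add_left hij 3)
      have h₅ := eps_pos i
      rw [eps_add_three i] at h₁ h₃ h₄
      rw [abs_sub_lt_iff]
      constructor <;> linarith
  have hv : ∀ n, 0 ≤ val (y ⋆ n) ∧ val (y ⋆ n) ≤ 1 := fun n => by
    obtain ⟨m, hm⟩ := hyv n
    rw [hm, hs]
    refine ⟨mul_nonneg (of_nonneg _) (eps_pos _).le, ?_⟩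
    rw [← of_pow2_mul_eps (m + 3), ← hg]
    exact mul_le_mul_of_nonneg_right (of_le_of.2 (hhg m)) (eps_pos _).le
  refine ⟨y, hyst, ⟨hyr, fun n => ?_, fun n => ?_⟩, fun n hn => ?_⟩
  · linarith [eps_pos n, (hv n).1]
  · linarith [eps_pos n, (hv n).2]
  · have h₁ := abs_sub_le_iff.1 (hsx n hn)
    have h₂ := hx.isReal.bounds (le_add_of_nonneg_right (zero_le (a := 3)) : n ≤ n + 3)
    have h₃ := eps_pos n
    rw [eps_add_three] at h₁
    rw [hys n hn, abs_sub_le_iff]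
    constructor <;> linarith

theorem UnitCompact.stp (hM : M.UnitCompact) : M.Stp := by
  intro α hα
  let t : Tm [.nat, .one] .nat := recT v0 (v1 ⬝ zeroT) (addT (mulT (numT 4) v1) (v3 ⬝ succT v0))
  let s : M.D .one := eval (cons α nil) (lam t)
  have hrep : Rep₂ fun p i : M.D .nat => 4 * p + α ⋆ (i + 1) := by
    simpa using rep₂_eval (M := M) (cons α nil) (addT (mulT (numT 4) v1) (v2 ⬝ succT v0))
  have hs : ∀ n, s ⋆ n = nrec n (α ⋆ 0) fun p i => 4 * p + α ⋆ (i + 1) := fun n => by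
    simp [s, t]
  have hs0 : s ⋆ 0 = α ⋆ 0 := by rw [hs, nrec_zero hrep]
  have hs1 : ∀ n, s ⋆ (n + 1) = 4 * s ⋆ n + α ⋆ (n + 1) := fun n => by
    rw [hs, hs, ← S_eq, nrec_succ hrep, S_eq]
  -- `s(n)` is the integer with base-4 digits `α(0), …, α(n)`. The bound says that `i` further
  -- digits, each at most 1, contribute at most `(4ⁱ - 1) / 3`.
  have hbound : ∀ k i, s ⋆ k * pow2 (i + i) ≤ s ⋆ (k + i) ∧
      3 * s ⋆ (k + i) + 1 ≤ (3 * s ⋆ k + 1) * pow2 (i + i) := fun k i => by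
    have r₁ : Rep fun i : M.D .nat => pow2 (i + i) := rep_pow2 (rep_id.add rep_id)
    have r₂ : Rep fun i : M.D .nat => s ⋆ (k + i) := (Rep.const s).app ((Rep.const k).add rep_id)
    refine QP.induction (.and (.le ((Rep.const _).mul r₁) r₂)
      (.le (((Rep.const 3).mul r₂).add (Rep.const 1)) ((Rep.const _).mul r₁))) ?_ ?_ i
    · simp
    · rintro n ⟨h₁, h₂⟩
      have h₃ := hα (k + n + 1)
      have h₄ : pow2 (n + 1 + (n + 1)) = 4 * pow2 (n + n) := by
        rw [show n + 1 + (n + 1) = n + n + 1 + 1 by ring, pow2_succ, pow2_succ]; ring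
      rw [← add_assoc k n 1, hs1, h₄]
      rw [← of_le_of] at h₁ h₂ h₃
      simp only [map_add, map_mul, map_one, map_ofNat] at h₁ h₂ h₃
      have h₅ := of_nonneg (α ⋆ (k + n + 1))
      refine ⟨?_, ?_⟩ <;> rw [← of_le_of] <;> simp only [map_add, map_mul, map_one, map_ofNat] <;>
        linarith
  let x : M.D .one := eval (cons s nil)
    (lam (ratT (v1 ⬝ v0) zeroT (pow2T (addT (addT v0 v0) (numT 2)))))
  have hx : ∀ n, val (x ⋆ n) = of (s ⋆ n) * eps (n + n + 2) := fun n => by simp [x, val_dyadic]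
  have hxb : ∀ k i, val (x ⋆ k) ≤ val (x ⋆ (k + i)) ∧
      val (x ⋆ (k + i)) ≤ val (x ⋆ k) + eps (k + k + 2) / 3 := fun k i => by
    obtain ⟨h₁, h₂⟩ := hbound k i
    rw [← of_le_of] at h₁ h₂
    simp only [map_add, map_mul, map_one, map_ofNat] at h₁ h₂
    have h₃ : eps (k + i + (k + i) + 2) = eps (k + k + 2) * eps (i + i) := by
      rw [← eps_add]; congr 1; ring
    have h₄ := of_pow2_mul_eps (i + i)
    have h₅ := eps_pos (i + i)
    have h₆ := eps_pos (k + k + 2)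
    rw [hx, hx, h₃]
    have h₁' := mul_le_mul_of_nonneg_right h₁ (mul_pos h₆ h₅).le
    have h₂' := mul_le_mul_of_nonneg_right h₂ (mul_pos h₆ h₅).le
    rw [show of (s ⋆ k) * of (pow2 (i + i)) * (eps (k + k + 2) * eps (i + i)) =
      of (s ⋆ k) * eps (k + k + 2) * (of (pow2 (i + i)) * eps (i + i)) by ring, h₄] at h₁'
    rw [show (3 * of (s ⋆ k) + 1) * of (pow2 (i + i)) * (eps (k + k + 2) * eps (i + i)) =
      (3 * of (s ⋆ k) + 1) * eps (k + k + 2) * (of (pow2 (i + i)) * eps (i + i)) by ring, h₄] at h₂'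
    have h₇ := mul_pos h₆ h₅
    constructor <;> linarith
  have hx1 : ∀ n, 0 ≤ val (x ⋆ n) ∧ val (x ⋆ n) ≤ 1 := fun n => by
    refine ⟨by rw [hx]; exact mul_nonneg (of_nonneg _) (eps_pos _).le, ?_⟩
    have h₁ := (hxb 0 n).2
    have h₂ : of (s ⋆ 0) ≤ 1 := by rw [hs0, ← map_one of]; exact of_le_of.2 (hα 0)
    rw [zero_add n, hx 0, show (0 : M.D .nat) + 0 + 2 = 0 + 2 by ring, eps_add_two, eps_zero] at h₁
    linarith
  have hxu : InUnit x := by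
    refine ⟨fun n i => ?_, fun n => ?_, fun n => ?_⟩
    · obtain ⟨h₁, h₂⟩ := hxb n i
      have h₃ : eps (n + n + 2) ≤ eps n := eps_anti (by
        rw [add_assoc]; exact le_add_of_nonneg_right zero_le)
      have h₄ := eps_pos n
      rw [abs_sub_lt_iff]
      constructor <;> linarith
    · linarith [eps_pos n, (hx1 n).1]
    · linarith [eps_pos n, (hx1 n).2]
  obtain ⟨y, hy, -, hxy⟩ := hM x hxu
  -- In units of `2⁻⁽²ⁿ⁺⁴⁾` the real `x` at place `2n + 6` lies between `4 s(n)` and `4 s(n) + 4/3`,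
  -- and `y` is at most `1/2` away. The thresholds `4 k + 3` therefore separate: the least `k` that
  -- passes is `s(n)`, whose parity is `α(n)`.
  let T : Tm [.nat, .nat, .one] .nat := diffLeT (v2 ⬝ addT (addT v1 v1) (numT 6))
    (ratT (addT (mulT (numT 4) v0) (numT 3)) zeroT (pow2T (addT (addT v1 v1) (numT 4)))) zeroT zeroT
  let F : M.D .nat → M.D .one := fun n => eval (cons n (cons y nil)) (lam T)
  have hF : ∀ n k, F n ⋆ k = 0 ↔ val (y ⋆ (n + n + 6)) ≤ (4 * of k + 3) * eps (n + n + 4) :=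
    fun n k => by
      simp only [F, app_lam, T, eval_diffLeT]
      simp [val_dyadic, map_ofNat of]
  let β : M.D .one := eval (cons y nil)
    (lam (parC ⬝ (muC ⬝ pow2T (addT (addT v0 v0) (numT 2)) ⬝ lam T)))
  have hβ : ∀ n, β ⋆ n = par (mu (pow2 (n + n + 2)) (F n)) := fun n => by simp [β, F]
  refine ⟨β, st_eval _ (st_cons hy st_nil) _, fun n => hβ n ▸ par_le_one _, fun n hn => ?_⟩
  have hpar : par (s ⋆ n) = α ⋆ n := by
    have : ∃ d, s ⋆ n = d + d + α ⋆ n := by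
      rcases zero_or_succ n with rfl | ⟨k, rfl⟩
      · exact ⟨0, by rw [hs0]; simp⟩
      · exact ⟨2 * s ⋆ k, by rw [hs1]; ring⟩
    obtain ⟨d, hd⟩ := this
    rcases le_one_iff.1 (hα n) with h | h
    · rw [hd, h, add_zero, par_double]
    · rw [hd, h, par_double_succ]
  suffices h : mu (pow2 (n + n + 2)) (F n) = s ⋆ n by rw [hβ, h, hpar]
  have hm : M.st (n + n + 6) := st_add (st_add hn hn) (st_ofNat 6)
  obtain ⟨h₁, h₂⟩ := abs_sub_le_iff.1 (hxy _ hm)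
  obtain ⟨h₃, h₄⟩ := hxb n (n + 6)
  have e₁ : eps (n + n + 2) = 4 * eps (n + n + 4) := by
    rw [show n + n + 4 = n + n + 2 + 2 by ring, eps_add_two (n + n + 2)]; ring
  have e₂ : eps (n + n + 6) = eps (n + n + 4) / 4 := by
    rw [show n + n + 6 = n + n + 4 + 2 by ring, eps_add_two (n + n + 4)]
  have hpos := eps_pos (n + n + 4)
  rw [← add_assoc, hx n, e₁] at h₃ h₄
  rw [e₂] at h₁ h₂
  have hle : mu (pow2 (n + n + 2)) (F n) ≤ s ⋆ n := mu_le_of_app _ ((hF _ _).2 (by linarith))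
  refine hle.antisymm (not_lt.1 fun hlt => ?_)
  have hb : s ⋆ n ≤ pow2 (n + n + 2) := by
    rw [← of_le_of]
    have := (hx1 n).2
    rw [hx, ← of_pow2_mul_eps (n + n + 2)] at this
    exact le_of_mul_le_mul_right this (eps_pos _)
  have := (hF _ _).1 (app_mu _ (hlt.trans_le hb))
  have h₅ := of_le_of.2 (lt_iff_succ_le.1 hlt)
  rw [map_add, map_one] at h₅
  have h₆ := mul_le_mul_of_nonneg_right h₅ hpos.le
  linarith

/-! ### Finite sequences and idealisation -/

def len (w : M.D (.seq σ)) : M.D .nat := M.con (.len σ) ⋆ w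
def get (w : M.D (.seq σ)) (i : M.D .nat) : M.D σ := M.con (.get σ) ⋆ w ⋆ i

@[simp] theorem sat_mem (e : M.Env Γ) (z : Tm Γ σ) (s : Tm Γ (.seq σ)) :
    Sat e (mem z s) ↔ ∃ i, i < len (eval e s) ∧ get (eval e s) i = eval e z := by
  simp [mem, len, get, lenT, getT, M.e_iff]

/-- The sum of the entries is computed from `w` by recursion, so it is standard, and it dominates
each entry. -/
theorem exists_bound (w : M.D (.seq .nat)) (hw : M.st w) :
    ∃ K : M.D .nat, M.st K ∧ ∀ i, i < len w → get w i ≤ K := by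
  let t : Tm [.nat, .seq .nat] .nat := recT v0 zeroT (addT v1 (getT v3 v0))
  let m : M.D .one := eval (cons w nil) (lam t)
  have hrep : Rep₂ fun p i : M.D .nat => p + get w i := by
    simpa [getT, get] using rep₂_eval (M := M) (cons w nil) (addT v1 (getT v2 v0))
  have hm : ∀ n, m ⋆ n = nrec n 0 fun p i => p + get w i := fun n => by
    simp [m, t, getT, get]
  have hm1 : ∀ n, m ⋆ (n + 1) = m ⋆ n + get w n := fun n => by
    rw [hm, hm, ← S_eq, nrec_succ hrep]
  refine ⟨m ⋆ len w, st_app (st_eval _ (st_cons hw st_nil) _)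
    (st_app (st_closed (.con (.len .nat))) hw), fun i hi => ?_⟩
  refine QP.induction (.imp (.lt (.const i) rep_id) (.le (.const (get w i)) (rep_app m)))
    (fun h => absurd h not_lt_zero) (fun n ih h => ?_) (len w) hi
  rw [hm1]
  rcases (lt_succ_iff.1 h).eq_or_lt with rfl | h
  · exact le_add_of_nonneg_left zero_le
  · exact (ih h).trans (le_add_of_nonneg_right zero_le)

/-- Idealisation for an internal formula that gets stronger as its number variable grows. -/
theorem exists_of_forall_bound (e : M.Env Γ) {φ : Fm (.nat :: τ :: Γ)} (hφ : φ.Internal)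
    (hanti : ∀ (y : M.D τ) (K L : M.D .nat), K ≤ L →
      Sat (cons L (cons y e)) φ → Sat (cons K (cons y e)) φ)
    (h : ∀ K : M.D .nat, M.st K → ∃ y : M.D τ, Sat (cons K (cons y e)) φ) :
    ∃ y : M.D τ, ∀ K : M.D .nat, M.st K → Sat (cons K (cons y e)) φ := by
  have := M.isP0 _ _ (.idealisation _ _ φ hφ) e
  simp only [idealisation, sat_imp, sat_allSt, sat_ex, sat_all, sat_mem, sat_rename] at this
  refine this fun w hw => ?_
  obtain ⟨K, hK, hwK⟩ := exists_bound w hw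
  obtain ⟨y, hy⟩ := h K hK
  refine ⟨y, ?_⟩
  rintro z ⟨i, hi, hz⟩
  have hzK : z ≤ K := by
    have := hwK i hi
    exact (show get w i = z from hz) ▸ this
  have := hanti y z K hzK hy
  convert this using 1
  rw [cons_comp_lift, cons_comp_lift]
  rfl

/-! ### From compactness to coverings -/

/-- The sequence `n ↦ x (n + 2)`. -/
def shift (x : M.D .one) : M.D .one := eval (cons x nil) (lam (v1 ⬝ addT v0 (numT 2)))

theorem app_shift (x : M.D .one) (n : M.D .nat) : shift x ⋆ n = x ⋆ (n + 2) := by simp [shift]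

theorem st_shift {x : M.D .one} (hx : M.st x) : M.st (shift x) := st_eval _ (st_cons hx st_nil) _

/-- Shifting sharpens the error at each place by a factor 4. Below, this leaves room in the strict
inequalities, which unshifted reals would use up. -/
theorem InUnit.shift {x : M.D .one} (hx : InUnit x) : InUnit (shift x) := by
  have h (n : M.D .nat) := eps_pos n
  refine ⟨fun n i => ?_, fun n => ?_, fun n => ?_⟩
  · have := hx.isReal (n + 2) i
    rw [eps_add_two, show n + 2 + i = n + i + 2 by ring] at this
    rw [app_shift, app_shift]
    linarith [h n]
  · have := hx.nonneg (n + 2)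
    rw [eps_add_two] at this
    rw [app_shift]; linarith [h n]
  · have := hx.le_one (n + 2)
    rw [eps_add_two] at this
    rw [app_shift]; linarith [h n]

/-- `y` is in `[0, 1]`, and no `n ≤ K` has `y` in the `n`-th interval with a margin at places up to
`K`. In `[K, y, c, d]`. -/
def outside : Fm [.nat, .one, .nat ⇒ₜ .one, .nat ⇒ₜ .one] :=
  inUnit v1 ∧ᶠ .all .nat (leN v0 v1 ⇒ᶠ .all .nat (leN v0 v2 ⇒ᶠ .all .nat (leN v0 v3 ⇒ᶠ
    (diffLe (v1.wk.wk.wk ⬝ v1) (v2.wk.wk.wk ⬝ v2 ⬝ v1) (numT 5) v1).neg ⇒ᶠ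
      diffLe (v3.wk.wk.wk ⬝ v2 ⬝ v0) (v1.wk.wk.wk ⬝ v0) (numT 5) v0)))

theorem sat_outside (K : M.D .nat) (y : M.D .one) (c d : M.D (.nat ⇒ₜ .one)) :
    Sat (cons K (cons y (cons c (cons d nil)))) outside ↔ InUnit y ∧ ∀ n, n ≤ K → ∀ m, m ≤ K →
      ∀ p, p ≤ K → 5 * eps m < val (y ⋆ m) - val (c ⋆ n ⋆ m) →
        val (d ⋆ n ⋆ p) - val (y ⋆ p) ≤ 5 * eps p := by
  simp [outside, map_ofNat of, lt_sub_iff_add_lt]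

theorem internal_outside : outside.Internal := by
  simp [outside, Fm.Internal, Fm.and, Fm.neg, inUnit, isReal, leR, leN, diffLe, diffLt, ltN]

theorem UnitCompact.heineBorel (hM : M.UnitCompact) : M.HeineBorel := by
  intro c d hcd hcov
  by_contra! hno
  obtain ⟨y, hy⟩ := exists_of_forall_bound (cons c (cons d nil)) internal_outside
    (fun y K L hKL h => by
      rw [sat_outside] at h ⊢
      exact ⟨h.1, fun n hn m hm p hp =>
        h.2 n (hn.trans hKL) m (hm.trans hKL) p (hp.trans hKL)⟩)
    (fun K hK => by
      obtain ⟨y, hy, hK'⟩ := hno K hK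
      refine ⟨y, (sat_outside ..).2 ⟨hy, fun n hn m hm p hp h₁ => ?_⟩⟩
      by_contra! h₂
      -- `m` and `p` may be nonstandard, so the gaps are moved to the standard place `K`. Of the
      -- margin `5 · 2⁻ᵐ` at most two parts are lost, and the remaining three exceed `2 · 2⁻ᴷ`.
      refine hK' n hn ⟨⟨K, hK, ?_⟩, ⟨K, hK, ?_⟩⟩
      · linarith [(hy.isReal.bounds hm).1, ((hcd n).1.bounds hm).2, eps_anti hm, eps_pos m]
      · linarith [(hy.isReal.bounds hp).2, ((hcd n).2.bounds hp).1, eps_anti hp, eps_pos p])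
  simp only [sat_outside] at hy
  obtain ⟨x, hx, hxu, hyx⟩ := hM y (hy 0 st_zero).1
  -- From the gap `2 · 2⁻ᵐ` at `m`, passing to `y` at place `m + 4` costs 1 for the end point, `1/4`
  -- for the shifted `x` and `1/8` for `x ≈ y`. The remaining `5/8` exceeds the margin `5/16` in
  -- `outside`.
  obtain ⟨n, hn, ⟨m, hm, h₁⟩, ⟨p, hp, h₂⟩⟩ := hcov (shift x) (st_shift hx) hxu.shift
  let K := n + (m + 4) + (p + 4)
  have hK : M.st K := st_add (st_add hn (st_add hm (st_ofNat 4))) (st_add hp (st_ofNat 4))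
  have hyr := (hy 0 st_zero).1.isReal
  have hm4 := hyx (m + 4) (st_add hm (st_ofNat 4))
  have hp4 := hyx (p + 4) (st_add hp (st_ofNat 4))
  have hmx := hxu.isReal.bounds (show m + 2 ≤ m + 4 by gcongr; exact_mod_cast (by norm_num : 2 ≤ 4))
  have hpx := hxu.isReal.bounds (show p + 2 ≤ p + 4 by gcongr; exact_mod_cast (by norm_num : 2 ≤ 4))
  have hmc := (hcd n).1.bounds (le_add_of_nonneg_right (zero_le (a := 4)) : m ≤ m + 4)
  have hpd := (hcd n).2.bounds (le_add_of_nonneg_right (zero_le (a := 4)) : p ≤ p + 4)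
  rw [app_shift] at h₁ h₂
  rw [abs_sub_le_iff] at hm4 hp4
  have em := eps_pos m
  have ep := eps_pos p
  rw [eps_add_two] at hmx hpx
  rw [eps_add_four] at hm4 hp4
  have := (hy K hK).2 n (by simp only [K]; rw [add_assoc]; exact le_add_of_nonneg_right zero_le)
    (m + 4) (by simp only [K]; rw [add_right_comm]; exact le_add_of_nonneg_left zero_le)
    (p + 4) (le_add_of_nonneg_left zero_le) (by rw [eps_add_four]; linarith)
  rw [eps_add_four] at this
  linarith

theorem HeineBorel.heineBorelSt (hM : M.HeineBorel) : M.HeineBorelSt := fun c d hcd hcov => by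
  obtain ⟨k, hk, h⟩ := hM c d hcd hcov
  exact ⟨k, hk, fun y _ => h y⟩

/-! ### Intervals around rationals that avoid a given real -/

/-- A code of `a + 2⁻ᵐ`. -/
def upT {Γ : List Ty} (a m : Tm Γ Ty.nat) : Tm Γ Ty.nat :=
  ratT (addT (mulT (ratPos a) (pow2T m)) (ratDen a)) (mulT (ratNeg a) (pow2T m))
    (mulT (ratDen a) (pow2T m))

/-- A code of `a - 2⁻ᵐ`. -/
def downT {Γ : List Ty} (a m : Tm Γ Ty.nat) : Tm Γ Ty.nat :=
  ratT (mulT (ratPos a) (pow2T m)) (addT (mulT (ratNeg a) (pow2T m)) (ratDen a))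
    (mulT (ratDen a) (pow2T m))

theorem den_mul_pow2_pos (a m : M.D .nat) : 0 < den a * pow2 m :=
  mul_pos (lt_succ_iff.2 zero_le) (pow2_pos m)

theorem val_eval_upT (e : M.Env Γ) (a m : Tm Γ .nat) :
    val (eval e (upT a m)) = val (eval e a) + eps (eval e m) := by
  have h₁ := (of_pow2_pos (eval e m)).ne'
  have h₂ := (den_pos (eval e a)).ne'
  rw [upT, eval_ratT]
  simp only [eval_addT, eval_mulT, eval_ratPos, eval_ratNeg, eval_ratDen, eval_pow2T]
  rw [val_rat _ _ (den_mul_pow2_pos _ _), val, eps]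
  simp only [map_add, map_mul]
  field_simp
  ring

theorem val_eval_downT (e : M.Env Γ) (a m : Tm Γ .nat) :
    val (eval e (downT a m)) = val (eval e a) - eps (eval e m) := by
  have h₁ := (of_pow2_pos (eval e m)).ne'
  have h₂ := (den_pos (eval e a)).ne'
  rw [downT, eval_ratT]
  simp only [eval_addT, eval_mulT, eval_ratPos, eval_ratNeg, eval_ratDen, eval_pow2T]
  rw [val_rat _ _ (den_mul_pow2_pos _ _), val, eps]
  simp only [map_add, map_mul]
  field_simp
  ring

theorem isReal_of_const {x : M.D .one} {q : M.D .nat} (h : ∀ n, x ⋆ n = q) : IsReal x :=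
  fun n i => by rw [h, h, sub_self, abs_zero]; exact eps_pos n

/-- For a real `x` in the unit interval without standard part there is a standard covering that
consists of intervals `(a - 2⁻ᵐ, a + 2⁻ᵐ)` with `|x(m) - a| ≥ 2 / 2ᵐ`. -/
theorem exists_intervals {x : M.D .one}
    (hx : InUnit x) (hno : ∀ y : M.D .one, M.st y → InUnit y → ¬ Approx x y) :
    ∃ c d : M.D (.nat ⇒ₜ .one), Intervals c d ∧ StCover c d ∧
      ∀ (j : M.D .nat) (y : M.D .one), IsReal y → Inside c d j y →
        (2 * eps (snd j) ≤ val (x ⋆ snd j) - val (fst j) ∨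
          2 * eps (snd j) ≤ val (fst j) - val (x ⋆ snd j)) ∧
        (∃ p, 2 * eps p < val (y ⋆ p) - (val (fst j) - eps (snd j))) ∧
        ∃ p, 2 * eps p < val (fst j) + eps (snd j) - val (y ⋆ p) := by
  -- The index `j` codes a centre `fst j` and a radius exponent `snd j`. Candidates too close to `x`
  -- get equal end points, so that they contain nothing.
  let near : Tm [.nat, .one] .nat := addT (diffLtT (v1 ⬝ (sndC ⬝ v0)) (fstC ⬝ v0) (numT 2) (sndC ⬝ v0))
    (diffLtT (fstC ⬝ v0) (v1 ⬝ (sndC ⬝ v0)) (numT 2) (sndC ⬝ v0))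
  let c : M.D (.nat ⇒ₜ .one) :=
    eval (cons x nil) (lam (constR (ifT near zeroT (downT (fstC ⬝ v0) (sndC ⬝ v0)))))
  let d : M.D (.nat ⇒ₜ .one) :=
    eval (cons x nil) (lam (constR (ifT near zeroT (upT (fstC ⬝ v0) (sndC ⬝ v0)))))
  have hnear : ∀ j, eval (cons j (cons x nil)) near = 0 ↔
      |val (x ⋆ snd j) - val (fst j)| < 2 * eps (snd j) := fun j => by
    simp only [near, eval_addT, add_eq_zero, eval_diffLtT, abs_sub_lt_iff]
    simp [map_ofNat of]
  have hc : ∀ j n, c ⋆ j ⋆ n = if |val (x ⋆ snd j) - val (fst j)| < 2 * eps (snd j) then 0 else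
      eval (cons j (cons x nil)) (downT (fstC ⬝ v0) (sndC ⬝ v0)) := fun j n => by
    simp only [c, app_lam, app_constR, eval_ifT, hnear, eval_zeroT]
  have hd : ∀ j n, d ⋆ j ⋆ n = if |val (x ⋆ snd j) - val (fst j)| < 2 * eps (snd j) then 0 else
      eval (cons j (cons x nil)) (upT (fstC ⬝ v0) (sndC ⬝ v0)) := fun j n => by
    simp only [d, app_lam, app_constR, eval_ifT, hnear, eval_zeroT]
  refine ⟨c, d, fun j => ⟨isReal_of_const (hc j), isReal_of_const (hd j)⟩,
    fun y hy hyu => ?_, ?_⟩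
  · have := hno _ (st_shift hy) hyu.shift
    simp only [Approx, not_forall, not_le, app_shift] at this
    obtain ⟨p, hp, h⟩ := this
    have hp4 := st_add hp (st_ofNat 4)
    have hp6 := st_add hp4 (st_ofNat 2)
    -- The gap `2 · 2⁻ᵖ` between `x` and the shifted `y` drops by less than `5/4` on moving to later
    -- places, far more than the required `2/16` remains. Two further places put `y` inside the
    -- interval with the required gap.
    have hfar : ¬ |val (x ⋆ (p + 4)) - val (y ⋆ (p + 4 + 2))| < 2 * eps (p + 4) := fun h' => by
      have hxp := hx.isReal p 4
      have hyp := hyu.isReal (p + 2) 4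
      rw [show p + 2 + 4 = p + 4 + 2 by ring, eps_add_two] at hyp
      rw [eps_add_four] at h'
      have e := eps_pos p
      rw [abs_sub_lt_iff] at hxp hyp h'
      rcases lt_abs.1 h with h | h <;> linarith
    have e := eps_pos (p + 4)
    refine ⟨pair (y ⋆ (p + 4 + 2)) (p + 4), st_pair (st_app hy hp6) hp4,
      ⟨p + 4 + 2, hp6, ?_⟩, ⟨p + 4 + 2, hp6, ?_⟩⟩
    · rw [hc, fst_pair, snd_pair, if_neg hfar, val_eval_downT, eps_add_two]
      simp only [eval_app, eval_fstC, eval_sndC, eval_v0, fst_pair, snd_pair]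
      linarith
    · rw [hd, fst_pair, snd_pair, if_neg hfar, val_eval_upT, eps_add_two]
      simp only [eval_app, eval_fstC, eval_sndC, eval_v0, fst_pair, snd_pair]
      linarith
  · rintro j y hy ⟨⟨p, -, hp⟩, ⟨q, -, hq⟩⟩
    rw [hc] at hp
    rw [hd] at hq
    split_ifs at hp hq with h
    · exfalso
      linarith [hy.sub_lt p q, eps_pos p, eps_pos q]
    · rw [val_eval_downT] at hp
      rw [val_eval_upT] at hq
      simp only [eval_app, eval_fstC, eval_sndC, eval_v0] at hp hq
      rw [not_lt, le_abs, neg_sub] at h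
      exact ⟨h, ⟨p, hp⟩, ⟨q, hq⟩⟩

theorem HeineBorel.unitCompact (hM : M.HeineBorel) : M.UnitCompact := by
  intro x hx
  by_contra! hno
  obtain ⟨c, d, hcd, hcov, h⟩ := exists_intervals hx hno
  obtain ⟨k, -, hk⟩ := hM c d hcd hcov
  obtain ⟨i, -, hi⟩ := hk x hx
  -- The final quantifier of `HBL'_ns` reaches nonstandard points, so `x` itself must lie in an
  -- interval that was chosen to avoid it.
  obtain ⟨h₁, ⟨p, hp⟩, ⟨q, hq⟩⟩ := h i x hx.isReal hi
  have := hx.isReal.sub_lt (snd i) q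
  have := hx.isReal.sub_lt p (snd i)
  have := eps_pos p
  have := eps_pos q
  rcases h₁ with h₁ | h₁ <;> linarith

/-! ### Maxima, and coverings of the standard points -/

/-- `A` keeps the index of the running maximum by recursion. With `i` fixed, maximality is a
quantifier-free statement about the bound and is proved by induction. -/
theorem exists_max (f : M.D .one) (k : M.D .nat) :
    ∃ b, b ≤ k ∧ ∀ i, i ≤ k → val (f ⋆ i) ≤ val (f ⋆ b) := by
  let C : M.D .one :=
    eval (cons f nil) (lam (diffLeT (v1 ⬝ (fstC ⬝ v0)) (v1 ⬝ (sndC ⬝ v0)) zeroT zeroT))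
  have hC : ∀ i j, C ⋆ pair i j = 0 ↔ val (f ⋆ i) ≤ val (f ⋆ j) := fun i j => by
    simp only [C, app_lam, eval_diffLeT]
    simp
  let A : M.D .one := eval (cons C nil)
    (lam (recT v0 zeroT (ifT (v3 ⬝ (pairC ⬝ v1 ⬝ succT v0)) (succT v0) v1)))
  have hrep : Rep₂ fun p i : M.D .nat => if C ⋆ pair p (i + 1) = 0 then i + 1 else p := by
    simpa using rep₂_eval (M := M) (cons C nil)
      (ifT (v2 ⬝ (pairC ⬝ v1 ⬝ succT v0)) (succT v0) v1)
  have hA : ∀ n, A ⋆ n = nrec n 0 fun p i => if C ⋆ pair p (i + 1) = 0 then i + 1 else p :=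
    fun n => by simp [A]
  have hA1 : ∀ n, A ⋆ (n + 1) =
      if C ⋆ pair (A ⋆ n) (n + 1) = 0 then n + 1 else A ⋆ n := fun n => by
    rw [hA, ← S_eq, nrec_succ hrep, ← hA, S_eq]
  refine ⟨A ⋆ k, ?_, fun i => ?_⟩
  · refine QP.induction (.le (rep_app A) rep_id) ?_ (fun n h => ?_) k
    · rw [hA, nrec_zero hrep]
    · rw [hA1]
      split_ifs
      · exact le_rfl
      · exact h.trans (le_add_of_nonneg_right zero_le)
  · rw [← hC]
    have hr : Rep fun n => C ⋆ pair i (A ⋆ n) :=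
      (Rep.const C).app (((Rep.const _).app (Rep.const i)).app (rep_app A))
    refine QP.induction (.imp (.le (.const i) rep_id) (.eq hr (.const 0))) ?_ (fun n ih h => ?_) k
    · intro h
      rw [le_zero_iff.1 h, hA, nrec_zero hrep, hC]
    · rw [hA1, hC]
      split_ifs with h'
      · rcases h.eq_or_lt with rfl | h
        · exact le_rfl
        · exact ((hC _ _).1 (ih (lt_succ_iff.1 h))).trans ((hC _ _).1 h')
      · rcases h.eq_or_lt with rfl | h
        · rw [hC, not_le] at h'; exact h'.le
        · exact (hC _ _).1 (ih (lt_succ_iff.1 h))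

theorem HeineBorelSt.unitCompact (hM : M.HeineBorelSt)
    (hdown : ∀ n m : M.D .nat, M.st n → m ≤ n → M.st m) : M.UnitCompact := by
  intro x hx
  by_contra! hno
  obtain ⟨c, d, hcd, hcov, h⟩ := exists_intervals hx hno
  obtain ⟨k, hk, hcover⟩ := hM c d hcd hcov
  let z : Tm [.nat, .one] .nat := pairC ⬝ numT 0 ⬝ numT 0
  let up : Tm [.nat, .one] .nat := upT (fstC ⬝ v0) (sndC ⬝ v0)
  -- The right end point for an interval left of `x`, if it is nonnegative; all other indices
  -- contribute 0, so the maximum stays in the unit interval.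
  let f : M.D .one := eval (cons x nil) (lam
    (ifT (diffLtT (v1 ⬝ (sndC ⬝ v0)) (fstC ⬝ v0) (numT 2) (sndC ⬝ v0)) z
      (ifT (diffLeT z up zeroT zeroT) up z)))
  have hz : ∀ i, eval (cons i (cons x nil)) z = pair 0 0 := fun i => by simp [z]
  have hup : ∀ i, val (eval (cons i (cons x nil)) up) = val (fst i) + eps (snd i) := fun i => by
    simp only [up, val_eval_upT, eval_app, eval_fstC, eval_sndC, eval_v0]
  have hf : ∀ i, f ⋆ i = if val (x ⋆ snd i) - val (fst i) < 2 * eps (snd i) then pair 0 0 else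
      if 0 ≤ val (fst i) + eps (snd i) then eval (cons i (cons x nil)) up else pair 0 0 :=
    fun i => by
      simp only [f, app_lam, eval_ifT, eval_diffLtT, eval_diffLeT, hz, hup, val_pair_zero,
        eval_app, eval_fstC, eval_sndC, eval_v0, eval_v1, eval_numT, Nat.cast_ofNat,
        map_ofNat of, eval_zeroT, map_zero, zero_mul, zero_sub, neg_nonpos]
  obtain ⟨b, hb, hmax⟩ := exists_max f k
  have hst : M.st (f ⋆ b) := by
    have hz' : M.st (pair (0 : M.D .nat) 0) := st_pair st_zero st_zero
    rw [hf]
    split_ifs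
    · exact hz'
    -- `f` depends on the nonstandard `x`, but the end point itself depends on the index alone,
    -- which `D` makes standard.
    · have := st_eval (cons b nil) (st_cons (hdown k b hk hb) st_nil)
        (upT (fstC ⬝ v0) (sndC ⬝ v0))
      simpa [up, upT] using this
    · exact hz'
  have hnonneg : ∀ i, 0 ≤ val (f ⋆ i) := fun i => by
    rw [hf]
    split_ifs with h₁ h₂
    · exact val_pair_zero.ge
    · rwa [hup]
    · exact val_pair_zero.ge
  have hle : ∀ i n, val (f ⋆ i) ≤ val (x ⋆ n) + 2 * eps n := fun i n => by
    have := hx.nonneg n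
    rw [hf]
    split_ifs with h₁ h₂
    · rw [val_pair_zero]; linarith
    · rw [hup]; linarith [hx.isReal.sub_lt (snd i) n, eps_pos n]
    · rw [val_pair_zero]; linarith
  let y : M.D .one := eval (cons (f ⋆ b) nil) (constR v0)
  have hy : ∀ n, y ⋆ n = f ⋆ b := fun n => app_constR _ _ n
  have hyu : InUnit y := by
    refine ⟨isReal_of_const hy, fun n => ?_, fun n => ?_⟩
    · rw [hy]; linarith [hnonneg b, eps_pos n]
    -- Two errors of `2 · 2⁻⁽ⁿ⁺¹⁾` add up to the permitted `2 · 2⁻ⁿ`.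
    · have h₁ := hle b (n + 1)
      have h₂ := hx.le_one (n + 1)
      rw [eps_succ] at h₁ h₂
      rw [hy]; linarith
  obtain ⟨i, hi, hin⟩ := hcover y (st_eval _ (st_cons hst st_nil) _) hyu
  obtain ⟨h₁, ⟨p, hp⟩, ⟨q, hq⟩⟩ := h i y hyu.isReal hin
  rw [hy] at hp hq
  have ep := eps_pos p
  have eq := eps_pos q
  -- An interval left of `x` that contains `y` would have a right end point beyond the maximum; an
  -- interval right of `x` would put `y` above `x`.
  rcases h₁ with h₁ | h₁
  · have h₂ := hmax i hi
    have h₃ := hnonneg b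
    rw [hf i, if_neg (not_lt.2 h₁), if_pos (by linarith), hup] at h₂
    linarith
  · have h₂ := hle b (p + 1)
    have h₃ := hx.isReal.sub_lt (p + 1) (snd i)
    rw [eps_succ] at h₂ h₃
    linarith

theorem sat_stDownward : Sat (M := M.toStr) nil stDownward ↔
    ∀ n m : M.D .nat, M.st n → m ≤ n → M.st m := by
  simp [stDownward]

end P0Model

end NSA

/-! ### The four provability statements -/

theorem theorem4p15 :
    NSA.Proves NSA.P0 (NSA.Fm.iff NSA.STP NSA.unitCompact) ∧
    NSA.Proves NSA.P0 (NSA.Fm.iff NSA.unitCompact NSA.HBLnsAll) ∧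
    NSA.Proves NSA.P0 (NSA.Fm.imp NSA.unitCompact NSA.HBLns) ∧
    NSA.Proves (insert NSA.stDownward NSA.P0)
      (NSA.Fm.imp NSA.HBLns NSA.unitCompact) := by
  refine ⟨NSA.proves_of_forall_model subset_rfl fun M _ => ?_,
    NSA.proves_of_forall_model subset_rfl fun M _ => ?_,
    NSA.proves_of_forall_model subset_rfl fun M _ => ?_,
    NSA.proves_of_forall_model (Set.subset_insert _ _) fun M hM => ?_⟩
  · rw [NSA.Str.sat_iff, NSA.P0Model.sat_STP, NSA.P0Model.sat_unitCompact]
    exact ⟨fun h => h.unitCompact, fun h => h.stp⟩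
  · rw [NSA.Str.sat_iff, NSA.P0Model.sat_unitCompact, NSA.P0Model.sat_HBLnsAll]
    exact ⟨fun h => h.heineBorel, fun h => h.unitCompact⟩
  · rw [NSA.Str.sat_imp, NSA.P0Model.sat_unitCompact, NSA.P0Model.sat_HBLns]
    exact fun h => h.heineBorel.heineBorelSt
  · rw [NSA.Str.sat_imp, NSA.P0Model.sat_unitCompact, NSA.P0Model.sat_HBLns]
    exact fun h => h.unitCompact (NSA.P0Model.sat_stDownward.1 (hM _ (Set.mem_insert _ _)))
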